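/- **Setting.** Let $d\ge 1$ and $0<H<1$, and let $X=(X_s)_{s\ge 0}$, $X_s=(X_s^1,\dots,X_s^d)$, be a jointly measurable $d$-dimensional centered Gaussian process whose components are independent copies of one real process. Suppose that $X$ is self-similar with index $H$, i.e. $(X_{as})_{s\ge0}$ and $(a^HX_s)_{s\ge0}$ have the same law for each $a>0$, and that the following three conditions hold. * *Strong local nondeterminism.* There is $\kappa>0$ such that for all $m\ge1$ and $0<s_1\le\dots\le s_m<t$, almost surely $$\mathrm{Var}(X^1_t\mid X^1_{s_1},\dots,X^1_{s_m})\ge\kappa\min_{1\le j\le m}|t-s_j|^{2H}.$$ * *(A)* For every $t>0$ there are $\eta\ge1$, $\sigma>0$ and a non-negative function $\phi$ on $[0,1/\eta]$ that decreases to $0$ as $\varepsilon\downarrow0$, such that for all $h\in[0,t/\eta]$ $$0\le h^{2H}(\sigma-\phi(h/t))\le\mathrm{Var}(X^1_{t+h}-X^1_t)\le h^{2H}(\sigma+\phi(h/t)).$$ * *(B)* There is a non-negative decreasing function $\psi$ on $(1,\infty)$ with $\lim_{\eta\to\infty}\psi(\eta)=0$ such that for all $\eta>1$ and $0<t_1<t_2<t_3<t_4$,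 with $\Delta t_i=t_i-t_{i-1}$: if $\Delta t_2/\Delta t_4\le1/\eta$, or $\Delta t_2/\Delta t_4\ge\eta$, or $\max\{\Delta t_2,\Delta t_4\}/\Delta t_3\le1/\eta$, then $$\big|\mathbb E(X^1_{t_4}-X^1_{t_3})(X^1_{t_2}-X^1_{t_1})\big|\le\psi(\eta)\,[\mathbb E(X^1_{t_4}-X^1_{t_3})^2]^{1/2}\,[\mathbb E(X^1_{t_2}-X^1_{t_1})^2]^{1/2}.$$ Let $p_\varepsilon(y)=(2\pi\varepsilon)^{-d/2}e^{-|y|^2/(2\varepsilon)}$. For a multi-index $\mathbf k$, denote by $L^{(\mathbf k)}_t(\lambda)$ the limit as $\varepsilon\downarrow0$, in $L^p$ for every $p\in[1,\infty)$, of $\int_0^t\partial_\lambda^{\mathbf k}\,p_\varepsilon(X_s-\lambda)\,ds$, when it exists. Thus $L_t(\lambda)=L^{(0)}_t(\lambda)$ is the local time of $X$ at $\lambda$, and $L_t^{(\mathbf e_i)}(\lambda)$, $L_t^{(\mathbf e_i+\mathbf e_k)}(\lambda)$ are its partial derivatives $\partial_{\lambda_i}L_t(\lambda)$, $\partial_{\lambda_i}\partial_{\lambda_k}L_t(\lambda)$.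 For $\beta\in\{1,2\}$ let $\Theta^\beta$ be the set of $f\in L^2(\mathbb R^d)$, real-valued, with $\int_{\mathbb R^d}|f(x)||x|^\beta dx<\infty$ and, if $\beta=2$, also $\int_{\mathbb R^d}xf(x)\,dx=0$. **Theorem.** Let $\beta\in\{1,2\}$, $0<H<\frac1{2\beta+d}$ and $f\in\Theta^\beta$. Then for any $t>0$ and $\lambda\in\mathbb R^d$ the local time $L_t(\lambda)$ exists, as do the derivatives $L_t^{(\mathbf e_i)}(\lambda)$ (if $\beta=1$), respectively $L_t^{(\mathbf e_i+\mathbf e_k)}(\lambda)$ (if $\beta=2$), for all $1\le i,k\le d$; for every $n\ge1$ the integral $\int_0^tf(n^H(X_s-\lambda))\,ds$ converges absolutely almost surely; and for every $p\in[1,\infty)$, as $n\to\infty$, $$n^{H\beta}\Big(n^{Hd}\int_0^tf(n^H(X_s-\lambda))\,ds-L_t(\lambda)\int_{\mathbb R^d}f(x)\,dx\Big)\ \xrightarrow{\ L^p\ }\ \begin{cases}\displaystyle\int_{\mathbb R^d}\Big(\sum_{i=1}^dL_t^{(\mathbf e_i)}(\lambda)\,x_i\Big)f(x)\,dx,&\beta=1,\\[2ex]\displaystyle\int_{\mathbb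 R^d}\Big(\frac12\sum_{i,k=1}^dx_i\,L_t^{(\mathbf e_i+\mathbf e_k)}(\lambda)\,x_k\Big)f(x)\,dx,&\beta=2.\end{cases}$$ -/

import Mathlib

open MeasureTheory ProbabilityTheory Filter Topology
open scoped NNReal ENNReal

noncomputable section

/-- `F a` converges to `G` in `L^p(μ)` along the filter `l`: the limit and eventually all the
`F a` belong to `L^p`, and the `L^p` norm of the difference tends to zero. -/
def TendstoInLp {Ω ι : Type*} [MeasurableSpace Ω] (μ : Measure Ω) (p : ℝ≥0∞)
    (F : ι → Ω → ℝ) (l : Filter ι) (G : Ω → ℝ) : Prop :=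
  (∀ᶠ a in l, MemLp (F a) p μ) ∧ MemLp G p μ ∧
    Tendsto (fun a => eLpNorm (F a - G) p μ) l (𝓝 0)

/-- The class `Θ^β` (used for `0 < β ≤ 2`): `f ∈ L²(ℝ^d)` with `∫ |f(x)| |x|^β dx < ∞` and, when
`β > 1`, also `∫ x f(x) dx = 0`. -/
def Theta (d : ℕ) (β : ℝ) : Set (EuclideanSpace ℝ (Fin d) → ℝ) :=
  {f | MemLp f 2 volume ∧ Integrable (fun x => |f x| * ‖x‖ ^ β) volume ∧
    (1 < β → ∫ x, f x • x = 0)}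

/-- Strong local nondeterminism with index `H` of a real process `Z`: for some `κ > 0`, all
`m ≥ 1` and all `0 < s_1 ≤ ⋯ ≤ s_m < t`,
`Var (Z_t | Z_{s_1}, …, Z_{s_m}) ≥ κ min_j |t - s_j|^{2H}`. -/
def StrongLocalNondeterminism {Ω : Type*} [MeasurableSpace Ω] (μ : Measure Ω) (H : ℝ)
    (Z : ℝ≥0 → Ω → ℝ) : Prop :=
  ∃ κ : ℝ, 0 < κ ∧ ∀ (m : ℕ) (s : Fin (m + 1) → ℝ≥0) (t : ℝ≥0),
    Monotone s → 0 < s 0 → s (Fin.last m) < t →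
      ∀ᵐ ω ∂μ, κ * (⨅ j, |(t : ℝ) - s j| ^ (2 * H)) ≤
        Var[Z t; μ | ⨆ j, MeasurableSpace.comap (Z (s j)) inferInstance] ω

/-- Assumption (A): the variance of a short increment over `[t, t + h]` is `σ h^{2H}` up to a
relative error `φ(h / t)`, where `φ(ε)` decreases to `0` as `ε` decreases to `0`. -/
def AssumptionA {Ω : Type*} [MeasurableSpace Ω] (μ : Measure Ω) (H : ℝ)
    (Z : ℝ≥0 → Ω → ℝ) : Prop :=
  ∀ t : ℝ≥0, 0 < t → ∃ (η σ : ℝ) (φ : ℝ → ℝ), 1 ≤ η ∧ 0 < σ ∧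
    (∀ ε ∈ Set.Icc 0 (1 / η), 0 ≤ φ ε) ∧ MonotoneOn φ (Set.Icc 0 (1 / η)) ∧
    Tendsto φ (𝓝[>] 0) (𝓝 0) ∧
    ∀ h : ℝ≥0, (h : ℝ) ≤ t / η →
      0 ≤ (h : ℝ) ^ (2 * H) * (σ - φ (h / t)) ∧
      (h : ℝ) ^ (2 * H) * (σ - φ (h / t)) ≤ Var[fun ω => Z (t + h) ω - Z t ω; μ] ∧
      Var[fun ω => Z (t + h) ω - Z t ω; μ] ≤ (h : ℝ) ^ (2 * H) * (σ + φ (h / t))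

/-- Assumption (B): increments over two disjoint time intervals are asymptotically uncorrelated
when the ratio of the lengths is extreme, or when the gap between the intervals is long. -/
def AssumptionB {Ω : Type*} [MeasurableSpace Ω] (μ : Measure Ω) (Z : ℝ≥0 → Ω → ℝ) : Prop :=
  ∃ ψ : ℝ → ℝ, (∀ η, 1 < η → 0 ≤ ψ η) ∧ AntitoneOn ψ (Set.Ioi 1) ∧
    Tendsto ψ atTop (𝓝 0) ∧
    ∀ (η : ℝ) (t₁ t₂ t₃ t₄ : ℝ≥0), 1 < η → 0 < t₁ → t₁ < t₂ → t₂ < t₃ → t₃ < t₄ →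
      (((t₂ : ℝ) - t₁) / (t₄ - t₃) ≤ 1 / η ∨ η ≤ ((t₂ : ℝ) - t₁) / (t₄ - t₃) ∨
        max ((t₂ : ℝ) - t₁) (t₄ - t₃) / (t₃ - t₂) ≤ 1 / η) →
      |∫ ω, (Z t₄ ω - Z t₃ ω) * (Z t₂ ω - Z t₁ ω) ∂μ| ≤
        ψ η * (∫ ω, (Z t₄ ω - Z t₃ ω) ^ 2 ∂μ) ^ (1 / 2 : ℝ) *
          (∫ ω, (Z t₂ ω - Z t₁ ω) ^ 2 ∂μ) ^ (1 / 2 : ℝ)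

/-- The class `G_L^{H,d}`: measurable `d`-dimensional centered Gaussian processes whose components
are independent copies of one real process, which are self-similar with index `H`, strongly locally
nondeterministic, and satisfy (A) and (B). As the components have the same law and are independent,
the last three conditions are conditions on the first component. -/
structure IsClassG {Ω : Type*} [MeasurableSpace Ω] (μ : Measure Ω) {d : ℕ} [NeZero d] (H : ℝ)
    (X : ℝ≥0 → Ω → EuclideanSpace ℝ (Fin d)) : Prop where
  measurable : Measurable (Function.uncurry X)
  gaussian : IsGaussianProcess X μ
  centered : ∀ s, ∫ ω, X s ω ∂μ = 0
  indep : iIndepFun (fun (i : Fin d) (ω : Ω) (s : ℝ≥0) => X s ω i) μ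
  copies : ∀ i j : Fin d, IdentDistrib (fun (ω : Ω) (s : ℝ≥0) => X s ω i)
    (fun (ω : Ω) (s : ℝ≥0) => X s ω j) μ μ
  selfSimilar : ∀ a : ℝ≥0, 0 < a → IdentDistrib (fun (ω : Ω) (s : ℝ≥0) => X (a * s) ω)
    (fun (ω : Ω) (s : ℝ≥0) => (a : ℝ) ^ H • X s ω) μ μ
  slnd : StrongLocalNondeterminism μ H (fun s ω => X s ω 0)
  assumptionA : AssumptionA μ H (fun s ω => X s ω 0)
  assumptionB : AssumptionB μ (fun s ω => X s ω 0)

/-- The centered Gaussian density on `ℝ^d` with covariance `ε I`. -/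
def heatKernel {d : ℕ} (ε : ℝ) (y : EuclideanSpace ℝ (Fin d)) : ℝ :=
  (2 * Real.pi * ε) ^ (-(d : ℝ) / 2) * Real.exp (-‖y‖ ^ 2 / (2 * ε))

/-- `∂_{i_1} ⋯ ∂_{i_k}`, in the space variable `x` and at `x = z`, of the smoothed occupation
density `x ↦ ∫_0^t p_ε(X_s - x) ds`, the derivative being taken under the integral sign;
`p_ε` is the Gaussian density with covariance `ε I`. -/
def smoothedLocalTimeDeriv {Ω : Type*} {d : ℕ} (X : ℝ≥0 → Ω → EuclideanSpace ℝ (Fin d))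
    (t : ℝ≥0) (z : EuclideanSpace ℝ (Fin d)) {k : ℕ} (i : Fin k → Fin d) (ε : ℝ) (ω : Ω) : ℝ :=
  ∫ s in (0 : ℝ)..t, iteratedFDeriv ℝ k (fun x => heatKernel ε (X s.toNNReal ω - x)) z
    (fun j => EuclideanSpace.single (i j) 1)

/-- `Y` is (a version of) the derivative `∂_{i_1} ⋯ ∂_{i_k} L_t(z)` with respect to the space
variable of the local time `L_t(z) = ∫_0^t δ(X_s - z) ds`, existing in `L^p` for all `p ≥ 1`: the
limit in every `L^p` of the derivative of the smoothed occupation density as `ε ↓ 0`. -/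
def IsLocalTimeDeriv {Ω : Type*} [MeasurableSpace Ω] (μ : Measure Ω) {d : ℕ}
    (X : ℝ≥0 → Ω → EuclideanSpace ℝ (Fin d)) (t : ℝ≥0) (z : EuclideanSpace ℝ (Fin d)) {k : ℕ}
    (i : Fin k → Fin d) (Y : Ω → ℝ) : Prop :=
  ∀ p : ℝ, 1 ≤ p → TendstoInLp μ (ENNReal.ofReal p)
    (fun ε ω => smoothedLocalTimeDeriv X t z i ε ω) (𝓝[>] 0) Y

/-- `Y` is (a version of) the local time `L_t(z)`: the derivative of order zero. -/
def IsLocalTime {Ω : Type*} [MeasurableSpace Ω] (μ : Measure Ω) {d : ℕ}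
    (X : ℝ≥0 → Ω → EuclideanSpace ℝ (Fin d)) (t : ℝ≥0) (z : EuclideanSpace ℝ (Fin d))
    (Y : Ω → ℝ) : Prop :=
  IsLocalTimeDeriv μ X t z (![] : Fin 0 → Fin d) Y

/-- `n^{Hβ} (n^{Hd} ∫_0^t f(n^H (X_s - z)) ds - L ∫ f(x) dx)`, with `L` the local time `L_t(z)`. -/
def normalizedError {Ω : Type*} {d : ℕ} (X : ℝ≥0 → Ω → EuclideanSpace ℝ (Fin d)) (H β : ℝ)
    (f : EuclideanSpace ℝ (Fin d) → ℝ) (t : ℝ≥0) (z : EuclideanSpace ℝ (Fin d)) (L : Ω → ℝ)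
    (n : ℕ) (ω : Ω) : ℝ :=
  (n : ℝ) ^ (H * β) * ((n : ℝ) ^ (H * d) *
    (∫ s in (0 : ℝ)..t, f ((n : ℝ) ^ H • (X s.toNNReal ω - z))) - L ω * ∫ x, f x)

end

/-! Write `r = n ^ H`. The rescaled functional is the time integral of `r ^ d * f (r • (y - z))`,
whose Fourier transform is `exp (-2πi z·u)` times the transform of `f` at `u / r`. Formally `L_t(z)`
is the time integral of the delta mass at `z`, with transform `exp (-2πi z·u)`, and each derivative
`∂_i` of the local time brings a factor `-2πi u_i`. On the Fourier side the theorem is thus the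
Taylor expansion at `0`, to order `β`, of the transform of `f`. The moments of degree strictly
between `0` and `β` vanish, so `r ^ β` times the increment of the transform between `0` and `u / r`
tends to the term of degree `β`, and is at most a constant times `|u| ^ β`, uniformly in `r`
(`tendsto_pow_mul_realFourier_sub`, `norm_pow_mul_realFourier_sub_le`).

The passage to `L^p` is `IsClassG.tendsto_eLpNorm_timeIntegral`: time integrals tend to zero if the
transforms tend to zero pointwise and are dominated by `C (1 + |u|) ^ β`. By Fourier inversion, an
even moment of a time integral of `g` is at most the integral of the product of the `|ĝ(u_j)|`
against the modulus of the joint characteristic function of the `X_{s_j}`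
(`IsClassG.eLpNorm_timeIntegral_le`). Dominated convergence then needs only that `∏ (1 + |u_j|) ^ β`
is integrable against that modulus (`IsClassG.lintegral_weight_jointCharFun_lt_top`).

For this the times are ordered, with increments `Δ_j`, and `v_j = ∑_{k ≥ j} u_k`. Strong local
nondeterminism, with an upper bound on the variances of increments, bounds the characteristic
function by `∏ exp (-c |v_j|² Δ_j^{2H})` (`IsClassG.exists_norm_integral_cexp_le`). As `∏ (1 +
|u_j|) ≤ ∏ (1 + |v_j|)²`, everything factorizes into weighted Gaussian integrals of order `Δ_j ^ (-H
(2β + d))`, which are integrable at `0` because `H (2β + d) < 1`.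

The delta mass is not a function, so the local time and its derivatives are smoothed by the heat
kernel at scale `ε`. The same criterion shows that the smoothed families are Cauchy
(`IsClassG.exists_isLocalTimeDeriv`). In the limit theorem (`IsClassG.tendstoInLp_normalizedError`)
`ε` is chosen after `n`, so small that the smoothing error survives multiplication by `r ^ β`. -/

noncomputable section

open scoped FourierTransform

/-! ### Variance lower bounds from strong local nondeterminism. -/

section LocalNondeterminism

variable {Ω : Type*} {m₀ : MeasurableSpace Ω} {μ : Measure Ω} [IsProbabilityMeasure μ]

/-- A lower bound on a conditional variance bounds from below the mean square distance to any
square integrable function that is measurable for the conditioning `σ`-algebra. -/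
lemma le_integral_sq_sub_of_le_condVar {m : MeasurableSpace Ω} (hm : m ≤ m₀) {Z V : Ω → ℝ} {c : ℝ}
    (hZ : MemLp Z 2 μ) (hV : MemLp V 2 μ) (hVm : StronglyMeasurable[m] V)
    (h : ∀ᵐ ω ∂μ, c ≤ Var[Z; μ | m] ω) : c ≤ ∫ ω, (Z ω - V ω) ^ 2 ∂μ := by
  have hZV : MemLp (Z - V) 2 μ := hZ.sub hV
  have hce : μ[Z - V | m] =ᵐ[μ] μ[Z | m] - V := by
    have := condExp_sub (hZ.integrable one_le_two) (hV.integrable one_le_two) m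
    rwa [condExp_of_stronglyMeasurable hm hVm (hV.integrable one_le_two)] at this
  -- Subtracting an `m`-measurable function does not change the conditional variance, which is at
  -- most the conditional second moment.
  have hvar : Var[Z - V; μ | m] =ᵐ[μ] Var[Z; μ | m] := by
    refine condExp_congr_ae ?_
    filter_upwards [hce] with ω hω
    simp only [Pi.pow_apply, Pi.sub_apply] at hω ⊢
    rw [hω]; ring
  have h1 : ∀ᵐ ω ∂μ, c ≤ μ[(Z - V) ^ 2 | m] ω := by
    filter_upwards [h, hvar, condVar_ae_le_condExp_sq hm hZV] with ω h1 h2 h3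
    linarith
  calc c = ∫ _, c ∂μ := by simp
    _ ≤ ∫ ω, μ[(Z - V) ^ 2 | m] ω ∂μ := integral_mono_ae (by simp) integrable_condExp h1
    _ = ∫ ω, ((Z - V) ^ 2) ω ∂μ := integral_condExp hm
    _ = _ := by simp

/-- The conditional variance lower bound of strong local nondeterminism, for increments. -/
lemma StrongLocalNondeterminism.exists_le_integral_sq {H : ℝ} (hH : 0 < H) {Z : ℝ≥0 → Ω → ℝ}
    (hZm : ∀ s, Measurable (Z s)) (hZ : ∀ s, MemLp (Z s) 2 μ) (hZ0 : Z 0 = 0)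
    (h : StrongLocalNondeterminism μ H Z) :
    ∃ κ : ℝ, 0 < κ ∧ ∀ (m : ℕ) (s : Fin (m + 2) → ℝ≥0) (w : Fin (m + 1) → ℝ),
      s 0 = 0 → Monotone s → 0 < s 1 →
      κ * (w (Fin.last m) ^ 2 * ((s (Fin.last m).succ : ℝ) - s (Fin.last m).castSucc) ^ (2 * H)) ≤
        ∫ ω, (∑ j, w j * (Z (s j.succ) ω - Z (s j.castSucc) ω)) ^ 2 ∂μ := by
  obtain ⟨κ, hκ, h⟩ := h
  -- Conditioning times must be positive while `s 0 = 0`, so this slot is filled by `s 1 / 2`. If it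
  -- is the last conditioning time, its distance to `t` is only half of `t - r`, whence the factor
  -- `(1 / 2) ^ (2 * H)`.
  refine ⟨κ * (1 / 2) ^ (2 * H), by positivity, fun m s w hs0 hs hs1 => ?_⟩
  set a := w (Fin.last m) with ha
  set t := s (Fin.last m).succ with ht
  set r := s (Fin.last m).castSucc with hr
  have hrt : r ≤ t := hs (Fin.castSucc_lt_succ).le
  have hnn : 0 ≤ ∫ ω, (∑ j, w j * (Z (s j.succ) ω - Z (s j.castSucc) ω)) ^ 2 ∂μ :=
    integral_nonneg fun _ => sq_nonneg _
  rcases eq_or_ne a 0 with h0 | ha0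
  · simpa [h0] using hnn
  rcases hrt.eq_or_lt with hrt' | hrt'
  · rw [hrt', sub_self, Real.zero_rpow (by positivity)]; simpa using hnn
  -- the conditioning times
  set σ : Fin (m + 1) → ℝ≥0 := fun j => if j = 0 then s 1 / 2 else s j.castSucc with hσ
  have hσle : ∀ j, j ≠ 0 → σ j = s j.castSucc := fun j hj => by simp [hσ, hj]
  have hs1' : ∀ j : Fin (m + 1), j ≠ 0 → s 1 ≤ s j.castSucc := fun j hj => by
    apply hs
    rw [Fin.le_def]
    have : (j : ℕ) ≠ 0 := fun h => hj (Fin.ext h)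
    simp; omega
  have hhalf : s 1 / 2 < s 1 := NNReal.half_lt_self hs1.ne'
  have hσm : Monotone σ := by
    intro i j hij
    rcases eq_or_ne j 0 with rfl | hj
    · rw [Fin.le_zero_iff.1 hij]
    rw [hσle j hj]
    rcases eq_or_ne i 0 with rfl | hi
    · simp only [hσ, if_true]
      exact hhalf.le.trans (hs1' j hj)
    · rw [hσle i hi]; exact hs (by simpa using hij)
  have hσ0 : 0 < σ 0 := by simp only [hσ, if_true]; positivity
  have hgap : ∀ j, ((t : ℝ) - r) * (1 / 2) ≤ (t : ℝ) - σ j := by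
    intro j
    have hj : (σ j : ℝ) ≤ σ (Fin.last m) := by exact_mod_cast hσm (Fin.le_last j)
    have : (σ (Fin.last m) : ℝ) ≤ (t + r) / 2 := by
      rcases eq_or_ne (Fin.last m) 0 with hm | hm
      · have hm' : m = 0 := by simpa using congrArg Fin.val hm
        subst hm'
        simp only [hσ, ht, hr]
        simp [hs0]
      · rw [hσle _ hm]
        have : (r : ℝ) ≤ t := by exact_mod_cast hrt
        linarith
    linarith
  have hrtR : (r : ℝ) < t := by exact_mod_cast hrt'
  have hσt : σ (Fin.last m) < t := by
    have := hgap (Fin.last m)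
    have : (σ (Fin.last m) : ℝ) < t := by linarith
    exact_mod_cast this
  have hcv := h m σ t hσm hσ0 hσt
  set G : MeasurableSpace Ω := ⨆ j, MeasurableSpace.comap (Z (σ j)) inferInstance with hG
  have hGle : G ≤ m₀ := iSup_le fun j => (hZm (σ j)).comap_le
  have hmeas : ∀ j : Fin (m + 1), Measurable[G] (Z (s j.castSucc)) := by
    intro j
    rcases eq_or_ne j 0 with rfl | hj
    · simp only [Fin.castSucc_zero, hs0, hZ0]; exact measurable_const
    · rw [← hσle j hj]
      exact (comap_measurable (Z (σ j))).mono (le_iSup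
        (fun j => MeasurableSpace.comap (Z (σ j)) inferInstance) j) le_rfl
  -- The whole combination is `a * Z t + V` with `V` measurable for the past, that is, `a` times the
  -- distance from `Z t` to `-a⁻¹ * V`.
  set V : Ω → ℝ := fun ω => (∑ j : Fin m, w j.castSucc *
    (Z (s j.castSucc.succ) ω - Z (s j.castSucc.castSucc) ω)) - a * Z r ω with hV
  have hVm : StronglyMeasurable[G] V := by
    suffices Measurable[G] V from this.stronglyMeasurable
    refine Measurable.sub (Finset.measurable_sum _ fun j _ => ?_) ((hmeas _).const_mul a)
    refine Measurable.const_mul (Measurable.sub ?_ (hmeas _)) _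
    rw [Fin.succ_castSucc]
    exact hmeas _
  have hVL : MemLp V 2 μ := by
    refine MemLp.sub (memLp_finsetSum _ fun j _ => ?_) ((hZ _).const_mul a)
    exact ((hZ _).sub (hZ _)).const_mul _
  have key := le_integral_sq_sub_of_le_condVar hGle (hZ t) (V := fun ω => (-a⁻¹) * V ω)
    (c := κ * (1 / 2) ^ (2 * H) * ((t : ℝ) - r) ^ (2 * H))
    (hVL.const_mul _) (hVm.const_mul _) (by
      filter_upwards [hcv] with ω hω
      refine le_trans ?_ hω
      rw [mul_assoc]
      refine mul_le_mul_of_nonneg_left ?_ hκ.le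
      refine le_ciInf fun j => ?_
      rw [← Real.mul_rpow (by norm_num) (by linarith)]
      refine Real.rpow_le_rpow (by nlinarith) ?_ (by positivity)
      refine le_trans ?_ (le_abs_self _)
      linarith [hgap j])
  calc κ * (1 / 2) ^ (2 * H) * (a ^ 2 * ((t : ℝ) - r) ^ (2 * H))
      = a ^ 2 * (κ * (1 / 2) ^ (2 * H) * ((t : ℝ) - r) ^ (2 * H)) := by ring
    _ ≤ a ^ 2 * ∫ ω, (Z t ω - (-a⁻¹) * V ω) ^ 2 ∂μ :=
        mul_le_mul_of_nonneg_left key (sq_nonneg a)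
    _ = ∫ ω, (∑ j, w j * (Z (s j.succ) ω - Z (s j.castSucc) ω)) ^ 2 ∂μ := by
        rw [← integral_const_mul]
        congr 1
        ext ω
        rw [Fin.sum_univ_castSucc, ← mul_pow]
        congr 1
        simp only [hV, ← ha, ← ht, ← hr]
        field_simp
        ring

/-- Strong local nondeterminism and an upper bound on the variances of increments imply local
nondeterminism in the sense of Berman. -/
lemma exists_mul_sum_le_integral_sq {H : ℝ} (hH : 0 < H) {Z : ℝ≥0 → Ω → ℝ}
    (hZm : ∀ s, Measurable (Z s)) (hZ : ∀ s, MemLp (Z s) 2 μ) (hZ0 : Z 0 = 0)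
    (h : StrongLocalNondeterminism μ H Z) {C : ℝ}
    (hC : ∀ r s : ℝ≥0, r ≤ s → ∫ ω, (Z s ω - Z r ω) ^ 2 ∂μ ≤ C * ((s : ℝ) - r) ^ (2 * H))
    (m : ℕ) : ∃ c : ℝ, 0 < c ∧ ∀ (s : Fin (m + 1) → ℝ≥0) (w : Fin m → ℝ),
      s 0 = 0 → Monotone s → (∀ i, i ≠ 0 → 0 < s i) →
      c * ∑ j : Fin m, w j ^ 2 * ((s j.succ : ℝ) - s j.castSucc) ^ (2 * H) ≤
        ∫ ω, (∑ j, w j * (Z (s j.succ) ω - Z (s j.castSucc) ω)) ^ 2 ∂μ := by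
  obtain ⟨κ, hκ, hlow⟩ := h.exists_le_integral_sq hH hZm hZ hZ0
  have hC0 : 0 ≤ C := by
    have := hC 0 1 (by simp)
    have h0 : 0 ≤ ∫ ω, (Z 1 ω - Z 0 ω) ^ 2 ∂μ := integral_nonneg fun _ => sq_nonneg _
    simpa using h0.trans this
  induction m with
  | zero => exact ⟨1, one_pos, fun s w _ _ _ => by simp⟩
  | succ m ih =>
    obtain ⟨c, hc, ih⟩ := ih
    -- Let `U` be the full sum and `W` the sum without its last term `-Y`. The lower bound for the
    -- last term and the upper bound `C` give `E Y² ≤ (C / κ) E U²`, hence `E W² ≤ B E U²`. One half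
    -- of `E U²` then pays for the last term, the other half for the terms given by induction.
    set B := 2 + 2 * (C / κ) with hB
    have hBpos : 0 < B := by positivity
    refine ⟨min (κ / 2) (c / (2 * B)), by positivity, fun s w hs0 hs hpos => ?_⟩
    have hA := hlow m s w hs0 hs (hpos 1 (by simp))
    have hI := ih (fun j => s j.castSucc) (fun j => w j.castSucc) (by simpa using hs0)
      (fun i j hij => hs (by simpa using hij)) (fun i hi => hpos _ (by
        rwa [Ne, Fin.castSucc_eq_zero_iff]))
    set a := w (Fin.last m) with ha
    set D := ((s (Fin.last m).succ : ℝ) - s (Fin.last m).castSucc) ^ (2 * H) with hD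
    set U : Ω → ℝ := fun ω => ∑ j, w j * (Z (s j.succ) ω - Z (s j.castSucc) ω) with hU
    set W : Ω → ℝ := fun ω => ∑ j : Fin m, w j.castSucc *
      (Z (s j.castSucc.succ) ω - Z (s j.castSucc.castSucc) ω) with hW
    set Y : Ω → ℝ := fun ω => -a * (Z (s (Fin.last m).succ) ω - Z (s (Fin.last m).castSucc) ω)
      with hY
    have hUL : MemLp U 2 μ := memLp_finsetSum _ fun j _ => ((hZ _).sub (hZ _)).const_mul _
    have hYL : MemLp Y 2 μ := ((hZ _).sub (hZ _)).const_mul _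
    have hWU : ∀ ω, W ω = U ω + Y ω := by
      intro ω
      simp only [hU, hW, hY, Fin.sum_univ_castSucc, ← ha]; ring
    have hY2 : ∫ ω, Y ω ^ 2 ∂μ ≤ C / κ * ∫ ω, U ω ^ 2 ∂μ := by
      calc ∫ ω, Y ω ^ 2 ∂μ = a ^ 2 * ∫ ω, (Z (s (Fin.last m).succ) ω
              - Z (s (Fin.last m).castSucc) ω) ^ 2 ∂μ := by
            rw [← integral_const_mul]; congr 1; ext ω; simp only [hY]; ring
        _ ≤ a ^ 2 * (C * D) := mul_le_mul_of_nonneg_left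
            (hC _ _ (hs (Fin.castSucc_lt_succ).le)) (sq_nonneg a)
        _ = C / κ * (κ * (a ^ 2 * D)) := by field_simp
        _ ≤ _ := mul_le_mul_of_nonneg_left hA (by positivity)
    have hW2 : ∫ ω, W ω ^ 2 ∂μ ≤ B * ∫ ω, U ω ^ 2 ∂μ := by
      calc ∫ ω, W ω ^ 2 ∂μ ≤ ∫ ω, (2 * U ω ^ 2 + 2 * Y ω ^ 2) ∂μ := by
            refine integral_mono_of_nonneg (ae_of_all _ fun _ => sq_nonneg _)
              ((hUL.integrable_sq.const_mul 2).add (hYL.integrable_sq.const_mul 2))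
              (ae_of_all _ fun ω => ?_)
            simp only [hWU]
            nlinarith [sq_nonneg (U ω - Y ω)]
        _ = 2 * ∫ ω, U ω ^ 2 ∂μ + 2 * ∫ ω, Y ω ^ 2 ∂μ := by
            rw [integral_add (hUL.integrable_sq.const_mul 2) (hYL.integrable_sq.const_mul 2),
              integral_const_mul, integral_const_mul]
        _ ≤ _ := by rw [hB]; linarith
    have hDnn : 0 ≤ a ^ 2 * D := mul_nonneg (sq_nonneg _) (Real.rpow_nonneg (by
      have : s (Fin.last m).castSucc ≤ s (Fin.last m).succ := hs (Fin.castSucc_lt_succ).le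
      have : (s (Fin.last m).castSucc : ℝ) ≤ s (Fin.last m).succ := by exact_mod_cast this
      linarith) _)
    rw [Fin.sum_univ_castSucc, mul_add]
    simp only [← ha, ← hD]
    have hSnn : 0 ≤ ∑ j : Fin m, w j.castSucc ^ 2 *
        ((s j.castSucc.succ : ℝ) - s j.castSucc.castSucc) ^ (2 * H) := by
      refine Finset.sum_nonneg fun j _ => mul_nonneg (sq_nonneg _) (Real.rpow_nonneg ?_ _)
      have : s j.castSucc.castSucc ≤ s j.castSucc.succ := hs (Fin.castSucc_lt_succ).le
      have : (s j.castSucc.castSucc : ℝ) ≤ s j.castSucc.succ := by exact_mod_cast this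
      linarith
    have h1 : min (κ / 2) (c / (2 * B)) * (a ^ 2 * D) ≤ (∫ ω, U ω ^ 2 ∂μ) / 2 :=
      calc _ ≤ κ / 2 * (a ^ 2 * D) := mul_le_mul_of_nonneg_right (min_le_left _ _) hDnn
        _ = (κ * (a ^ 2 * D)) / 2 := by ring
        _ ≤ _ := by linarith [hA]
    have h2 : min (κ / 2) (c / (2 * B)) * (∑ j : Fin m, w j.castSucc ^ 2 *
        ((s j.castSucc.succ : ℝ) - s j.castSucc.castSucc) ^ (2 * H)) ≤ (∫ ω, U ω ^ 2 ∂μ) / 2 :=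
      calc _ ≤ c / (2 * B) * (∑ j : Fin m, w j.castSucc ^ 2 *
        ((s j.castSucc.succ : ℝ) - s j.castSucc.castSucc) ^ (2 * H)) :=
              mul_le_mul_of_nonneg_right (min_le_right _ _) hSnn
        _ = (c * (∑ j : Fin m, w j.castSucc ^ 2 *
        ((s j.castSucc.succ : ℝ) - s j.castSucc.castSucc) ^ (2 * H))) / (2 * B) := by ring
        _ ≤ (B * ∫ ω, U ω ^ 2 ∂μ) / (2 * B) := by
            refine div_le_div_of_nonneg_right (le_trans ?_ hW2) (by positivity)
            simpa only [hW, Fin.succ_castSucc] using hI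
        _ = _ := by field_simp
    linarith

end LocalNondeterminism

/-! ### Second moments and characteristic functions of processes of the class. -/

section ClassG

set_option linter.unusedSectionVars false

variable {Ω : Type*} [MeasurableSpace Ω] {μ : Measure Ω} [IsProbabilityMeasure μ]
  {d : ℕ} [NeZero d] {H : ℝ} {X : ℝ≥0 → Ω → EuclideanSpace ℝ (Fin d)}

namespace IsClassG

lemma measurable_eval (hX : IsClassG μ H X) (s : ℝ≥0) : Measurable (X s) :=
  hX.measurable.comp measurable_prodMk_left

lemma measurable_coord (hX : IsClassG μ H X) (s : ℝ≥0) (i : Fin d) :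
    Measurable (fun ω => X s ω i) := by
  have := hX.measurable_eval s
  fun_prop

lemma memLp_eval (hX : IsClassG μ H X) (s : ℝ≥0) : MemLp (X s) 2 μ :=
  (hX.gaussian.hasGaussianLaw_eval s).memLp_two

lemma memLp_coord (hX : IsClassG μ H X) (s : ℝ≥0) (i : Fin d) :
    MemLp (fun ω => X s ω i) 2 μ :=
  (EuclideanSpace.proj (𝕜 := ℝ) i).comp_memLp' (hX.memLp_eval s)

lemma integral_coord (hX : IsClassG μ H X) (s : ℝ≥0) (i : Fin d) : ∫ ω, X s ω i ∂μ = 0 := by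
  have := (EuclideanSpace.proj (𝕜 := ℝ) i).integral_comp_comm
    ((hX.memLp_eval s).integrable one_le_two)
  rw [hX.centered s] at this
  simpa using this

lemma integral_sq_sub_mul (hX : IsClassG μ H X) (a : ℝ≥0) (ha : 0 < a) (r s : ℝ≥0) :
    ∫ ω, (X (a * s) ω 0 - X (a * r) ω 0) ^ 2 ∂μ =
      (a : ℝ) ^ (2 * H) * ∫ ω, (X s ω 0 - X r ω 0) ^ 2 ∂μ := by
  have hm : Measurable (fun x : ℝ≥0 → EuclideanSpace ℝ (Fin d) => (x s 0 - x r 0) ^ 2) := by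
    fun_prop
  have := ((hX.selfSimilar a ha).comp hm).integral_eq
  simp only [Function.comp_def] at this
  rw [this, ← integral_const_mul]
  congr 1; ext ω
  rw [mul_comm 2 H, Real.rpow_mul (by positivity)]
  simp; ring

lemma integral_sq_mul (hX : IsClassG μ H X) (a : ℝ≥0) (ha : 0 < a) (s : ℝ≥0) :
    ∫ ω, X (a * s) ω 0 ^ 2 ∂μ = (a : ℝ) ^ (2 * H) * ∫ ω, X s ω 0 ^ 2 ∂μ := by
  have hm : Measurable (fun x : ℝ≥0 → EuclideanSpace ℝ (Fin d) => x s 0 ^ 2) := by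
    fun_prop
  have := ((hX.selfSimilar a ha).comp hm).integral_eq
  simp only [Function.comp_def] at this
  rw [this, ← integral_const_mul]
  congr 1; ext ω
  rw [mul_comm 2 H, Real.rpow_mul (by positivity)]
  simp; ring

lemma integral_sq (hX : IsClassG μ H X) (s : ℝ≥0) (hs : 0 < s) :
    ∫ ω, X s ω 0 ^ 2 ∂μ = (s : ℝ) ^ (2 * H) * ∫ ω, X 1 ω 0 ^ 2 ∂μ := by
  simpa using hX.integral_sq_mul s hs 1

/-- The variance of an increment is at most a multiple of the length to the power `2H`. -/
lemma exists_integral_sq_sub_le (hX : IsClassG μ H X) (hH : 0 < H) :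
    ∃ C : ℝ, ∀ r s : ℝ≥0, 0 < r → r ≤ s →
      ∫ ω, (X s ω 0 - X r ω 0) ^ 2 ∂μ ≤ C * ((s : ℝ) - r) ^ (2 * H) := by
  obtain ⟨η, σ, φ, hη, hσ, hφ0, hφm, -, hA⟩ := hX.assumptionA 1 one_pos
  set V := ∫ ω, X 1 ω 0 ^ 2 ∂μ with hV
  have hV0 : 0 ≤ V := integral_nonneg fun _ => sq_nonneg _
  have hη0 : 0 < η := by linarith
  have hηm : 1 / η ∈ Set.Icc (0 : ℝ) (1 / η) := ⟨by positivity, le_rfl⟩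
  have hφη := hφ0 _ hηm
  -- The increment is first taken from time `1`. If `h ≤ 1 / η`, assumption (A) and monotonicity of
  -- `φ` give the first constant; otherwise `1 + h ≤ (η + 1) h` and the crude bound by the two
  -- second moments gives the other. Self-similarity carries the bound to an arbitrary starting time
  -- `r > 0`.
  set C := max (σ + φ (1 / η)) (4 * V * (η + 1) ^ (2 * H)) with hC
  have hunit : ∀ h : ℝ≥0, ∫ ω, (X (1 + h) ω 0 - X 1 ω 0) ^ 2 ∂μ ≤ C * (h : ℝ) ^ (2 * H) := by
    intro h
    rcases le_or_gt (h : ℝ) (1 / η) with hh | hh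
    · have h2 := (hA h (by simpa using hh)).2.2
      have hmean : ∫ ω, (X (1 + h) ω 0 - X 1 ω 0) ∂μ = 0 := by
        rw [integral_sub ((hX.memLp_coord _ _).integrable one_le_two)
          ((hX.memLp_coord _ _).integrable one_le_two), hX.integral_coord, hX.integral_coord,
          sub_zero]
      have hae : AEMeasurable (fun ω => X (1 + h) ω 0 - X 1 ω 0) μ :=
        ((hX.memLp_coord _ _).sub (hX.memLp_coord _ _)).1.aemeasurable
      have h2 : Var[fun ω => X (1 + h) ω 0 - X 1 ω 0; μ] ≤ _ := h2
      rw [variance_of_integral_eq_zero hae hmean] at h2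
      refine h2.trans ?_
      rw [mul_comm]
      refine mul_le_mul_of_nonneg_right ?_ (by positivity)
      refine le_trans ?_ (le_max_left _ _)
      have : φ (h / (1 : ℝ≥0)) ≤ φ (1 / η) :=
        hφm ⟨by positivity, by simpa using hh⟩ hηm (by simpa using hh)
      linarith
    · have hle : (1 + h : ℝ) ≤ (η + 1) * h := by
        have : 1 < h * η := by rwa [div_lt_iff₀ hη0] at hh
        nlinarith
      calc ∫ ω, (X (1 + h) ω 0 - X 1 ω 0) ^ 2 ∂μ
          ≤ ∫ ω, (2 * X (1 + h) ω 0 ^ 2 + 2 * X 1 ω 0 ^ 2) ∂μ := by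
            refine integral_mono_of_nonneg (ae_of_all _ fun _ => sq_nonneg _)
              (((hX.memLp_coord _ _).integrable_sq.const_mul 2).add
              ((hX.memLp_coord _ _).integrable_sq.const_mul 2)) (ae_of_all _ fun ω => ?_)
            simp only
            nlinarith [sq_nonneg (X (1 + h) ω 0 + X 1 ω 0)]
        _ = 2 * ((1 + h : ℝ) ^ (2 * H) * V) + 2 * V := by
            rw [integral_add ((hX.memLp_coord _ _).integrable_sq.const_mul 2)
              ((hX.memLp_coord _ _).integrable_sq.const_mul 2), integral_const_mul,
              integral_const_mul, hX.integral_sq (1 + h) (by positivity)]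
            simp [hV]
        _ ≤ 4 * V * (1 + h : ℝ) ^ (2 * H) := by
            have : (1 : ℝ) ≤ (1 + h : ℝ) ^ (2 * H) :=
              Real.one_le_rpow (by simp) (by positivity)
            nlinarith
        _ ≤ 4 * V * ((η + 1) * h) ^ (2 * H) := by gcongr
        _ = 4 * V * (η + 1) ^ (2 * H) * (h : ℝ) ^ (2 * H) := by
            rw [Real.mul_rpow (by positivity) (by positivity)]; ring
        _ ≤ _ := mul_le_mul_of_nonneg_right (le_max_right _ _) (by positivity)
  refine ⟨C, fun r s hr hrs => ?_⟩
  have e1 : s = r * (1 + (s - r) / r) := by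
    rw [mul_add, mul_div_cancel₀ _ hr.ne', mul_one, add_tsub_cancel_of_le hrs]
  have hsub : (((s - r) / r : ℝ≥0) : ℝ) = ((s : ℝ) - r) / r := by
    rw [NNReal.coe_div, NNReal.coe_sub hrs]
  have hrR : (0 : ℝ) < r := hr
  have hrsR : (r : ℝ) ≤ s := hrs
  have := hX.integral_sq_sub_mul r hr 1 (1 + (s - r) / r)
  rw [← e1, mul_one] at this
  rw [this]
  calc _ ≤ (r : ℝ) ^ (2 * H) * (C * (((s - r) / r : ℝ≥0) : ℝ) ^ (2 * H)) :=
        mul_le_mul_of_nonneg_left (hunit _) (by positivity)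
    _ = C * ((s : ℝ) - r) ^ (2 * H) := by
        rw [hsub, Real.div_rpow (by linarith) hrR.le]
        field_simp

/-- Berman's local nondeterminism for the first component, with the value at time zero replaced
by zero. -/
lemma exists_mul_sum_le (hX : IsClassG μ H X) (hH : 0 < H) (m : ℕ) :
    ∃ c : ℝ, 0 < c ∧ ∀ (s : Fin m → ℝ≥0) (u : Fin m → ℝ), Monotone s → (∀ j, 0 < s j) →
      c * ∑ j : Fin m, (∑ k, if j ≤ k then u k else 0) ^ 2 *
        ((s j : ℝ) - (Fin.cons 0 s : Fin (m + 1) → ℝ≥0) j.castSucc) ^ (2 * H) ≤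
        ∫ ω, (∑ j, u j * X (s j) ω 0) ^ 2 ∂μ := by
  -- Nothing is assumed directly on `X 0`. Nondeterminism and the conclusion concern positive times
  -- only, so the value at `0` may be changed.
  set Z : ℝ≥0 → Ω → ℝ := fun s => if s = 0 then 0 else fun ω => X s ω 0 with hZ
  have hZpos : ∀ s, 0 < s → Z s = fun ω => X s ω 0 := fun s hs => if_neg hs.ne'
  have hZ0 : Z 0 = 0 := if_pos rfl
  have hZm : ∀ s, Measurable (Z s) := fun s => by
    rcases eq_zero_or_pos s with rfl | hs
    · rw [hZ0]; exact measurable_const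
    · rw [hZpos s hs]; exact hX.measurable_coord s 0
  have hZL : ∀ s, MemLp (Z s) 2 μ := fun s => by
    rcases eq_zero_or_pos s with rfl | hs
    · rw [hZ0]; exact MemLp.zero
    · rw [hZpos s hs]; exact hX.memLp_coord s 0
  have hS : StrongLocalNondeterminism μ H Z := by
    obtain ⟨κ, hκ, h⟩ := hX.slnd
    refine ⟨κ, hκ, fun m s t hs h0 ht => ?_⟩
    have e : ∀ j, Z (s j) = fun ω => X (s j) ω 0 :=
      fun j => hZpos _ (h0.trans_le (hs (Fin.zero_le j)))
    have et : Z t = fun ω => X t ω 0 := hZpos _ ((h0.trans_le (hs (Fin.zero_le _))).trans ht)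
    simp only [e, et]
    exact h m s t hs h0 ht
  obtain ⟨C, hC⟩ := hX.exists_integral_sq_sub_le hH
  have hC' : ∀ r s : ℝ≥0, r ≤ s → ∫ ω, (Z s ω - Z r ω) ^ 2 ∂μ ≤
      max C (∫ ω, X 1 ω 0 ^ 2 ∂μ) * ((s : ℝ) - r) ^ (2 * H) := by
    intro r s hrs
    have hrsR : (0 : ℝ) ≤ (s : ℝ) - r := sub_nonneg.2 (by exact_mod_cast hrs)
    rcases eq_zero_or_pos r with rfl | hr
    · rcases eq_zero_or_pos s with rfl | hs
      · simp [Real.zero_rpow (by positivity : 2 * H ≠ 0)]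
      · rw [hZ0, hZpos s hs]
        simp only [Pi.zero_apply, sub_zero, NNReal.coe_zero]
        rw [hX.integral_sq s hs, mul_comm]
        exact mul_le_mul_of_nonneg_right (le_max_right _ _) (by positivity)
    · rw [hZpos r hr, hZpos s (hr.trans_le hrs)]
      exact (hC r s hr hrs).trans
        (mul_le_mul_of_nonneg_right (le_max_left _ _) (Real.rpow_nonneg hrsR _))
  obtain ⟨c, hc, h⟩ := exists_mul_sum_le_integral_sq hH hZm hZL hZ0 hS hC' m
  refine ⟨c, hc, fun s u hs hpos => ?_⟩
  -- Summation by parts: the weight of the `j`-th increment is the tail sum of the `u k`, `k ≥ j`.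
  have abel : ∀ (m : ℕ) (u z : Fin m → ℝ) (y : ℝ),
      ∑ j : Fin m, (∑ k, if j ≤ k then u k else 0) *
        (z j - (Fin.cons y z : Fin (m + 1) → ℝ) j.castSucc) = ∑ j, u j * (z j - y) := by
    intro m
    induction m with
    | zero => intro u z y; simp
    | succ m ih =>
      intro u z y
      have hcons := ih (fun j => u j.succ) (fun j => z j.succ) (z 0)
      have hz : (Fin.cons (z 0) (fun j => z j.succ) : Fin (m + 1) → ℝ) = z :=
        Fin.cons_self_tail z
      rw [hz] at hcons
      rw [Fin.sum_univ_succ, Fin.sum_univ_succ (f := fun j => u j * (z j - y))]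
      have e : ∀ j : Fin m, (∑ k, if j.succ ≤ k then u k else 0) =
          ∑ k : Fin m, if j ≤ k then u k.succ else 0 := by
        intro j
        rw [Fin.sum_univ_succ]
        simp [Fin.succ_le_succ_iff]
      simp only [e, ← Fin.succ_castSucc, Fin.cons_succ, hcons]
      simp only [Fin.zero_le, if_true, Fin.castSucc_zero, Fin.cons_zero, Fin.sum_univ_succ (f := u)]
      rw [add_mul, add_assoc, Finset.sum_mul, ← Finset.sum_add_distrib]
      congr 1
      refine Finset.sum_congr rfl fun j _ => ?_
      ring
  have hmono : Monotone (Fin.cons 0 s : Fin (m + 1) → ℝ≥0) := by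
    intro i j hij
    induction i using Fin.cases with
    | zero => simp
    | succ i =>
      induction j using Fin.cases with
      | zero => simp at hij
      | succ j => simpa using hs (by simpa using hij)
  have := h (Fin.cons 0 s) (fun j => ∑ k, if j ≤ k then u k else 0) (by simp) hmono
    (fun i hi => by
      induction i using Fin.cases with
      | zero => exact absurd rfl hi
      | succ i => simpa using hpos i)
  simp only [Fin.cons_succ] at this
  refine this.trans_eq ?_
  congr 1; ext ω; congr 1
  have hz : ∀ j : Fin m, Z ((Fin.cons 0 s : Fin (m + 1) → ℝ≥0) j.castSucc) ω =
      (Fin.cons 0 (fun j => Z (s j) ω) : Fin (m + 1) → ℝ) j.castSucc := by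
    intro j
    generalize j.castSucc = i
    induction i using Fin.cases with
    | zero => simp [hZ0]
    | succ i => simp
  simp only [hz]
  rw [abel m u (fun j => Z (s j) ω) 0]
  refine Finset.sum_congr rfl fun j _ => ?_
  rw [hZpos _ (hpos j), sub_zero]

/-- Independence and equidistribution of the components split the second moment of a linear
combination of the values of the process. -/
lemma variance_sum_inner (hX : IsClassG μ H X) {m : ℕ} (s : Fin m → ℝ≥0)
    (u : Fin m → EuclideanSpace ℝ (Fin d)) :
    Var[fun ω => ∑ j, inner ℝ (u j) (X (s j) ω); μ] =
      ∑ i, ∫ ω, (∑ j, u j i * X (s j) ω 0) ^ 2 ∂μ := by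
  set Y : Fin d → Ω → ℝ := fun i ω => ∑ j, u j i * X (s j) ω i with hY
  have hYL : ∀ i, MemLp (Y i) 2 μ := fun i =>
    memLp_finsetSum _ fun j _ => (hX.memLp_coord _ _).const_mul _
  have e : (fun ω => ∑ j, inner ℝ (u j) (X (s j) ω)) = ∑ i, Y i := by
    ext ω
    simp only [hY, Finset.sum_apply, PiLp.inner_apply, RCLike.inner_apply, conj_trivial]
    rw [Finset.sum_comm]
    simp only [mul_comm]
  have hφ : ∀ i, Measurable (fun x : ℝ≥0 → ℝ => ∑ j, u j i * x (s j)) := fun i => by fun_prop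
  rw [e, IndepFun.variance_sum (fun i _ => hYL i) (fun i _ k _ hik =>
    (hX.indep.indepFun hik).comp (hφ i) (hφ k))]
  refine Finset.sum_congr rfl fun i _ => ?_
  have hmean : ∫ ω, Y i ω ∂μ = 0 := by
    simp only [hY]
    rw [integral_finsetSum _ fun j _ =>
      ((hX.memLp_coord _ _).const_mul _).integrable one_le_two]
    simp [integral_const_mul, hX.integral_coord]
  rw [variance_of_integral_eq_zero (hYL i).1.aemeasurable hmean]
  exact ((hX.copies i 0).comp ((hφ i).pow_const 2)).integral_eq

lemma hasGaussianLaw_sum_inner (hX : IsClassG μ H X) {m : ℕ} (s : Fin m → ℝ≥0)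
    (u : Fin m → EuclideanSpace ℝ (Fin d)) :
    HasGaussianLaw (fun ω => ∑ j, inner ℝ (u j) (X (s j) ω)) μ := by
  have h := ((hX.gaussian.comp_right s).comp_left (fun j => innerSL ℝ (u j)))
  simpa using h.hasGaussianLaw_fun_sum (I := Finset.univ)

/-- The combination is a real Gaussian variable, so its characteristic function at frequency `2π`
has modulus `exp (-(2π)² Var / 2)`; `variance_sum_inner` gives the variance. -/
lemma norm_integral_cexp_sum_inner (hX : IsClassG μ H X) {m : ℕ} (s : Fin m → ℝ≥0)
    (u : Fin m → EuclideanSpace ℝ (Fin d)) :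
    ‖∫ ω, Complex.exp (↑(2 * Real.pi * ∑ j, inner ℝ (u j) (X (s j) ω)) * Complex.I) ∂μ‖ =
      Real.exp (-(2 * Real.pi ^ 2) * ∑ i, ∫ ω, (∑ j, u j i * X (s j) ω 0) ^ 2 ∂μ) := by
  have h := hX.hasGaussianLaw_sum_inner s u
  have h1 := h.charFun_map_eq (2 * Real.pi)
  rw [charFun_apply_real, integral_map h.aemeasurable (by fun_prop)] at h1
  push_cast at h1 ⊢
  rw [h1]
  have hvar : Var[fun ω => inner ℝ (2 * Real.pi) (∑ j, inner ℝ (u j) (X (s j) ω)); μ] =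
      (2 * Real.pi) ^ 2 * ∑ i, ∫ ω, (∑ j, u j i * X (s j) ω 0) ^ 2 ∂μ := by
    rw [← hX.variance_sum_inner, ← variance_const_mul]
    congr 1; ext ω; simp; ring
  rw [hvar, Complex.norm_exp]
  congr 1
  simp only [Complex.sub_re, Complex.mul_re, Complex.I_re, Complex.I_im, Complex.ofReal_im]
  rw [← Complex.ofReal_ofNat, ← Complex.ofReal_div]
  simp only [Complex.ofReal_re]
  ring

/-- The characteristic function of the values at ordered times is dominated by a product of
Gaussian factors, one for each increment. -/
lemma exists_norm_integral_cexp_le (hX : IsClassG μ H X) (hH : 0 < H) (m : ℕ) :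
    ∃ c : ℝ, 0 < c ∧ ∀ (s : Fin m → ℝ≥0) (u : Fin m → EuclideanSpace ℝ (Fin d)),
      Monotone s → (∀ j, 0 < s j) →
      ‖∫ ω, Complex.exp (↑(2 * Real.pi * ∑ j, inner ℝ (u j) (X (s j) ω)) * Complex.I) ∂μ‖ ≤
        ∏ j : Fin m, Real.exp (-c * ‖∑ k, if j ≤ k then u k else 0‖ ^ 2 *
          ((s j : ℝ) - (Fin.cons 0 s : Fin (m + 1) → ℝ≥0) j.castSucc) ^ (2 * H)) := by
  obtain ⟨c, hc, h⟩ := hX.exists_mul_sum_le hH m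
  refine ⟨2 * Real.pi ^ 2 * c, by positivity, fun s u hs hpos => ?_⟩
  rw [hX.norm_integral_cexp_sum_inner, ← Real.exp_sum, Real.exp_le_exp]
  have h1 := Finset.sum_le_sum fun i (_ : i ∈ (Finset.univ : Finset (Fin d))) =>
    h s (fun j => u j i) hs hpos
  have h2 : ∑ i : Fin d, c * ∑ j : Fin m, (∑ k, if j ≤ k then u k i else 0) ^ 2 *
        ((s j : ℝ) - (Fin.cons 0 s : Fin (m + 1) → ℝ≥0) j.castSucc) ^ (2 * H) =
      c * ∑ j : Fin m, ‖∑ k, if j ≤ k then u k else 0‖ ^ 2 *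
        ((s j : ℝ) - (Fin.cons 0 s : Fin (m + 1) → ℝ≥0) j.castSucc) ^ (2 * H) := by
    rw [← Finset.mul_sum, Finset.sum_comm]
    congr 1
    refine Finset.sum_congr rfl fun j _ => ?_
    rw [← Finset.sum_mul, EuclideanSpace.real_norm_sq_eq]
    congr 1
    refine Finset.sum_congr rfl fun i _ => ?_
    congr 1
    rw [WithLp.ofLp_sum, Finset.sum_apply]
    refine Finset.sum_congr rfl fun k _ => ?_
    split_ifs <;> simp
  rw [h2] at h1
  calc _ ≤ -(2 * Real.pi ^ 2) * (c * ∑ j : Fin m, ‖∑ k, if j ≤ k then u k else 0‖ ^ 2 *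
        ((s j : ℝ) - (Fin.cons 0 s : Fin (m + 1) → ℝ≥0) j.castSucc) ^ (2 * H)) :=
        mul_le_mul_of_nonpos_left h1 (by have := Real.pi_pos; nlinarith)
    _ = _ := by
        rw [Finset.mul_sum, Finset.mul_sum]
        refine Finset.sum_congr rfl fun j _ => ?_
        ring

end IsClassG

end ClassG

/-! ### Integrals of products over time increments and over tail sums of frequencies. -/

section ProductIntegrals

lemma lintegral_fin_succ {G : Type*} [MeasurableSpace G] (ν : Measure G) [SigmaFinite ν] (m : ℕ)
    {F : (Fin (m + 1) → G) → ℝ≥0∞} (hF : Measurable F) :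
    ∫⁻ x, F x ∂(Measure.pi fun _ => ν) =
      ∫⁻ y, ∫⁻ x, F (Fin.cons y x) ∂(Measure.pi fun _ => ν) ∂ν := by
  have h := (measurePreserving_piFinSuccAbove (fun _ : Fin (m + 1) => ν) 0).symm
  rw [← h.lintegral_comp hF]
  refine (lintegral_prod _ (hF.comp h.measurable).aemeasurable).trans ?_
  simp [MeasurableEquiv.piFinSuccAbove_symm_apply, Fin.consEquiv]

lemma lintegral_fin_succ_symm {G : Type*} [MeasurableSpace G] (ν : Measure G) [SigmaFinite ν]
    (m : ℕ) {F : (Fin (m + 1) → G) → ℝ≥0∞} (hF : Measurable F) :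
    ∫⁻ x, F x ∂(Measure.pi fun _ => ν) =
      ∫⁻ x, ∫⁻ y, F (Fin.cons y x) ∂ν ∂(Measure.pi fun _ => ν) := by
  have h := (measurePreserving_piFinSuccAbove (fun _ : Fin (m + 1) => ν) 0).symm
  rw [← h.lintegral_comp hF]
  refine (lintegral_prod_symm _ (hF.comp h.measurable).aemeasurable).trans ?_
  simp [MeasurableEquiv.piFinSuccAbove_symm_apply, Fin.consEquiv]

/-- Integral of a product of functions of the increments. -/
lemma lintegral_prod_sub {G : Type*} [AddCommGroup G] [MeasurableSpace G] [MeasurableAdd₂ G]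
    [MeasurableSub₂ G] (ν : Measure G) [SigmaFinite ν] [ν.IsAddRightInvariant] (m : ℕ)
    {a : Fin m → G → ℝ≥0∞} (ha : ∀ j, Measurable (a j)) (y : G) :
    ∫⁻ x, ∏ j : Fin m, a j (x j - (Fin.cons y x : Fin (m + 1) → G) j.castSucc)
      ∂(Measure.pi fun _ => ν) = ∏ j, ∫⁻ x, a j x ∂ν := by
  have hm : ∀ (m : ℕ) (y : G) (i : Fin (m + 1)),
      Measurable fun x : Fin m → G => (Fin.cons y x : Fin (m + 1) → G) i := by
    intro m y i
    induction i using Fin.cases with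
    | zero => simp
    | succ i => simpa using measurable_pi_apply i
  induction m generalizing y with
  | zero => simp
  | succ m ih =>
    rw [lintegral_fin_succ ν m]
    · simp only [Fin.prod_univ_succ, Fin.cons_zero, Fin.cons_succ, Fin.castSucc_zero,
        ← Fin.succ_castSucc]
      -- Once the first variable is fixed at `z`, the remaining increments form a chain starting
      -- from `z`. By induction their integral does not depend on `z`.
      have : ∀ z : G, ∫⁻ x : Fin m → G, a 0 (z - y) *
          ∏ j : Fin m, a j.succ (x j - (Fin.cons z x : Fin (m + 1) → G) j.castSucc)
          ∂(Measure.pi fun _ => ν) = a 0 (z - y) * ∏ j : Fin m, ∫⁻ x, a j.succ x ∂ν := by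
        intro z
        rw [lintegral_const_mul, ih (fun j => ha j.succ) z]
        exact Finset.measurable_prod _ fun j _ =>
          (ha j.succ).comp ((measurable_pi_apply j).sub (hm _ _ _))
      simp only [this]
      have hy : Measurable fun z => a 0 (z - y) := (ha 0).comp (measurable_id.sub_const y)
      rw [lintegral_mul_const _ hy,
        lintegral_sub_right_eq_self (μ := ν) (fun x => a 0 x) y]
    · exact Finset.measurable_prod _ fun j _ =>
          (ha j).comp ((measurable_pi_apply j).sub (hm _ _ _))

lemma measurable_sum_ite_le {G : Type*} [AddCommMonoid G] [MeasurableSpace G] [MeasurableAdd₂ G]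
    (m : ℕ) (j : Fin m) : Measurable fun x : Fin m → G => ∑ k, if j ≤ k then x k else 0 :=
  Finset.measurable_sum _ fun k _ => by
    split_ifs
    · exact measurable_pi_apply k
    · exact measurable_const

lemma sum_ite_succ_le {G : Type*} [AddCommMonoid G] {m : ℕ} (x : Fin (m + 1) → G) (j : Fin m) :
    (∑ k, if j.succ ≤ k then x k else 0) = ∑ k : Fin m, if j ≤ k then x k.succ else 0 := by
  rw [Fin.sum_univ_succ]
  simp [Fin.succ_le_succ_iff]

/-- Integral of a product of functions of the partial sums. -/
lemma lintegral_prod_partial_sum {G : Type*} [AddCommGroup G] [MeasurableSpace G]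
    [MeasurableAdd₂ G] (ν : Measure G) [SigmaFinite ν] [ν.IsAddRightInvariant] (m : ℕ)
    {a : Fin m → G → ℝ≥0∞} (ha : ∀ j, Measurable (a j)) :
    ∫⁻ x, ∏ j : Fin m, a j (∑ k, if j ≤ k then x k else 0) ∂(Measure.pi fun _ => ν) =
      ∏ j, ∫⁻ x, a j x ∂ν := by
  induction m with
  | zero => simp
  | succ m ih =>
    have hmeas : ∀ j, Measurable fun x : Fin (m + 1) → G =>
        a j (∑ k, if j ≤ k then x k else 0) := fun j => (ha j).comp (measurable_sum_ite_le _ j)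
    rw [lintegral_fin_succ_symm ν m (Finset.measurable_prod Finset.univ fun j _ => hmeas j)]
    simp only [Fin.prod_univ_succ, sum_ite_succ_le, Fin.zero_le, if_true,
      Fin.sum_cons, Fin.cons_succ]
    -- The first variable occurs only in the first partial sum, so it is integrated innermost and
    -- translation invariance removes the other variables from that factor.
    have : ∀ x : Fin m → G, ∫⁻ y, a 0 (y + ∑ k, x k) *
        ∏ j : Fin m, a j.succ (∑ k, if j ≤ k then x k else 0) ∂ν =
        (∫⁻ y, a 0 y ∂ν) * ∏ j : Fin m, a j.succ (∑ k, if j ≤ k then x k else 0) := by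
      intro x
      have hy : Measurable fun y => a 0 (y + ∑ k, x k) :=
        (ha 0).comp (measurable_id.add_const _)
      rw [lintegral_mul_const _ hy,
        lintegral_add_right_eq_self (μ := ν) (fun x => a 0 x)]
    simp only [this]
    rw [lintegral_const_mul, ih fun j => ha j.succ]
    exact Finset.measurable_prod _ fun j _ => (ha j.succ).comp (measurable_sum_ite_le _ j)

/-- The product of the weights of the variables is at most the squared product of the weights
of the partial sums. -/
lemma prod_one_add_norm_le {G : Type*} [NormedAddCommGroup G] (m : ℕ) (u : Fin m → G) :
    ∏ j, (1 + ‖u j‖) ≤ ∏ j, (1 + ‖∑ k, if j ≤ k then u k else 0‖) ^ 2 := by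
  -- The statement is strengthened for the induction: the extra factor for the remaining sum `S`
  -- absorbs the `1 + ‖S‖` produced by `u 0 = (u 0 + S) - S`.
  suffices h : (1 + ‖∑ k, u k‖) * ∏ j, (1 + ‖u j‖) ≤
      ∏ j, (1 + ‖∑ k, if j ≤ k then u k else 0‖) ^ 2 by
    refine le_trans ?_ h
    exact le_mul_of_one_le_left (Finset.prod_nonneg fun j _ => by positivity)
      (by linarith [norm_nonneg (∑ k, u k)])
  induction m with
  | zero => simp
  | succ m ih =>
    simp only [Fin.prod_univ_succ, sum_ite_succ_le, Fin.zero_le, if_true]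
    have h := ih fun j => u j.succ
    rw [Fin.sum_univ_succ]
    set S := ∑ k : Fin m, u k.succ with hS
    have h1 : 1 + ‖u 0‖ ≤ (1 + ‖u 0 + S‖) * (1 + ‖S‖) := by
      have : ‖u 0‖ ≤ ‖u 0 + S‖ + ‖S‖ := by simpa using norm_sub_le (u 0 + S) S
      nlinarith [norm_nonneg (u 0 + S), norm_nonneg S]
    calc (1 + ‖u 0 + S‖) * ((1 + ‖u 0‖) * ∏ j : Fin m, (1 + ‖u j.succ‖))
        ≤ (1 + ‖u 0 + S‖) * (((1 + ‖u 0 + S‖) * (1 + ‖S‖)) * ∏ j : Fin m, (1 + ‖u j.succ‖)) := by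
          gcongr
      _ = (1 + ‖u 0 + S‖) ^ 2 * ((1 + ‖S‖) * ∏ j : Fin m, (1 + ‖u j.succ‖)) := by ring
      _ ≤ _ := by gcongr

end ProductIntegrals

/-! ### Reduction to ordered times. -/

section Symmetrization

lemma measurePreserving_comp_perm {α : Type*} [MeasurableSpace α] (ρ : Measure α) [SigmaFinite ρ]
    {m : ℕ} (σ : Equiv.Perm (Fin m)) : MeasurePreserving (fun x : Fin m → α => x ∘ σ)
      (Measure.pi fun _ => ρ) (Measure.pi fun _ => ρ) := by
  have := measurePreserving_piCongrLeft (fun _ : Fin m => ρ) σ.symm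
  convert! this using 1
  ext x i
  simp [MeasurableEquiv.coe_piCongrLeft, Equiv.piCongrLeft_apply]

lemma measurableSet_monotone_fst {G : Type*} [MeasurableSpace G] (m : ℕ) :
    MeasurableSet {q : (Fin m → ℝ) × (Fin m → G) | Monotone q.1} := by
  have : {q : (Fin m → ℝ) × (Fin m → G) | Monotone q.1} =
      ⋂ (i : Fin m) (j : Fin m) (_ : i ≤ j), {q | q.1 i ≤ q.1 j} := by
    ext q; simp [Monotone]
  rw [this]
  exact MeasurableSet.iInter fun i => MeasurableSet.iInter fun j => MeasurableSet.iInter fun _ =>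
    measurableSet_le (by fun_prop) (by fun_prop)

/-- Integrals of symmetric functions are bounded by the integral over ordered first arguments. -/
lemma lintegral_symm_le {G : Type*} [MeasurableSpace G] (τ : Measure ℝ) [SigmaFinite τ]
    (ν : Measure G) [SigmaFinite ν] (m : ℕ) {Φ : (Fin m → ℝ) × (Fin m → G) → ℝ≥0∞}
    (hΦ : Measurable Φ)
    (hsymm : ∀ (σ : Equiv.Perm (Fin m)) s u, Φ (s ∘ σ, u ∘ σ) = Φ (s, u)) :
    ∫⁻ p, Φ p ∂((Measure.pi fun _ => τ).prod (Measure.pi fun _ => ν)) ≤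
      (Nat.factorial m : ℝ≥0∞) * ∫⁻ p, {q : (Fin m → ℝ) × (Fin m → G) | Monotone q.1}.indicator Φ p
        ∂((Measure.pi fun _ => τ).prod (Measure.pi fun _ => ν)) := by
  set S := {q : (Fin m → ℝ) × (Fin m → G) | Monotone q.1} with hS
  have hSm : MeasurableSet S := measurableSet_monotone_fst m
  have hmp : ∀ σ : Equiv.Perm (Fin m), MeasurePreserving
      (Prod.map (fun x : Fin m → ℝ => x ∘ σ) (fun x : Fin m → G => x ∘ σ))
      ((Measure.pi fun _ => τ).prod (Measure.pi fun _ => ν))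
      ((Measure.pi fun _ => τ).prod (Measure.pi fun _ => ν)) := fun σ =>
    (measurePreserving_comp_perm τ σ).prod (measurePreserving_comp_perm ν σ)
  calc ∫⁻ p, Φ p ∂((Measure.pi fun _ => τ).prod (Measure.pi fun _ => ν))
      ≤ ∫⁻ p, ∑ σ : Equiv.Perm (Fin m), S.indicator Φ
          (Prod.map (fun x : Fin m → ℝ => x ∘ σ) (fun x : Fin m → G => x ∘ σ) p)
          ∂((Measure.pi fun _ => τ).prod (Measure.pi fun _ => ν)) := by
        refine lintegral_mono fun p => ?_
        -- Among the `m!` permuted copies, the one that sorts the times lies in `S`, and by symmetry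
        -- it has the value `Φ p`.
        have hmem : Prod.map (fun x : Fin m → ℝ => x ∘ Tuple.sort p.1)
            (fun x : Fin m → G => x ∘ Tuple.sort p.1) p ∈ S := Tuple.monotone_sort p.1
        refine le_trans ?_ (Finset.single_le_sum (fun _ _ => zero_le)
          (Finset.mem_univ (Tuple.sort p.1)))
        rw [Set.indicator_of_mem hmem]
        exact (hsymm _ p.1 p.2).ge
    _ = ∑ σ : Equiv.Perm (Fin m), ∫⁻ p, S.indicator Φ p
          ∂((Measure.pi fun _ => τ).prod (Measure.pi fun _ => ν)) := by
        rw [lintegral_finsetSum]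
        · refine Finset.sum_congr rfl fun σ _ => ?_
          exact (hmp σ).lintegral_comp (hΦ.indicator hSm)
        · intro σ _
          exact (hΦ.indicator hSm).comp (hmp σ).measurable
    _ = _ := by
        rw [Finset.sum_const, nsmul_eq_mul, Finset.card_univ, Fintype.card_perm, Fintype.card_fin]

end Symmetrization

/-! ### Weighted Gaussian integrals and their integrability in time. -/

section GaussianWeight

/-- The polynomial weight is paid for by half of the Gaussian exponent: `(1 + x)² ≤ 2 + 2 x²`, where
`2 ≤ 2 A / a` and `x²` is at most `2β / a` times `exp (a x² / (2β))`; then raise to the power `β`.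
The bound `A` makes the loss a pure power `a ^ (-β)` with a constant independent of `a`. -/
lemma one_add_pow_mul_exp_le {β : ℕ} (hβ : 1 ≤ β) {a A x : ℝ} (ha : 0 < a) (haA : a ≤ A)
    (hx : 0 ≤ x) :
    (1 + x) ^ (2 * β) * Real.exp (-a * x ^ 2) ≤
      ((2 * A + 4 * β) / a) ^ β * Real.exp (-(a / 2) * x ^ 2) := by
  have hβ0 : (0 : ℝ) < β := by exact_mod_cast hβ
  set E := Real.exp (a / (2 * β) * x ^ 2) with hE
  have hE1 : 1 + a / (2 * β) * x ^ 2 ≤ E := by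
    rw [add_comm]; exact Real.add_one_le_exp _
  have hE0 : 1 ≤ E := le_trans (by simpa using by positivity) hE1
  have h1 : (1 + x) ^ 2 ≤ (2 * A + 4 * β) / a * E := by
    have h2 : (2 * A + 4 * β) / a * E = 2 * (A / a) * E + 4 * β / a * E := by field_simp
    have h3 : 1 ≤ A / a := (one_le_div ha).2 haA
    have h4 : 2 * x ^ 2 ≤ 4 * β / a * E := by
      calc 2 * x ^ 2 = 4 * β / a * (a / (2 * β) * x ^ 2) := by field_simp; ring
        _ ≤ _ := mul_le_mul_of_nonneg_left (by linarith) (by positivity)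
    nlinarith [sq_nonneg (1 - x)]
  have h2 : (1 + x) ^ (2 * β) ≤ ((2 * A + 4 * β) / a) ^ β * Real.exp (a / 2 * x ^ 2) := by
    calc (1 + x) ^ (2 * β) = ((1 + x) ^ 2) ^ β := pow_mul _ _ _
      _ ≤ ((2 * A + 4 * β) / a * E) ^ β := pow_le_pow_left₀ (by positivity) h1 _
      _ = _ := by
        rw [mul_pow, hE, ← Real.exp_nat_mul]
        congr 2; field_simp
  calc _ ≤ ((2 * A + 4 * β) / a) ^ β * Real.exp (a / 2 * x ^ 2) * Real.exp (-a * x ^ 2) := by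
        gcongr
    _ = _ := by
        rw [mul_assoc, ← Real.exp_add]; congr 2; ring

variable {d : ℕ}

/-- Integral of a polynomially weighted Gaussian function of parameter `c Δ^{2H}`. -/
def weightedGaussianIntegral (d β : ℕ) (H c Δ : ℝ) : ℝ≥0∞ :=
  ∫⁻ w : EuclideanSpace ℝ (Fin d),
    ENNReal.ofReal ((1 + ‖w‖) ^ (2 * β) * Real.exp (-c * ‖w‖ ^ 2 * Δ ^ (2 * H)))

lemma measurable_weightedGaussianIntegral (d β : ℕ) (H c : ℝ) :
    Measurable (weightedGaussianIntegral d β H c) := by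
  refine Measurable.lintegral_prod_right' (f := fun p : ℝ × EuclideanSpace ℝ (Fin d) =>
    ENNReal.ofReal ((1 + ‖p.2‖) ^ (2 * β) * Real.exp (-c * ‖p.2‖ ^ 2 * p.1 ^ (2 * H)))) ?_
  fun_prop

/-- With `a = c Δ^{2H}` the weight costs `a ^ (-β)` and the Gaussian integral gives `a ^ (-d / 2)`.
Together they are of order `Δ ^ (-H (2β + d))`, and this is where the restriction on `H` is needed.
-/
lemma setLIntegral_weightedGaussianIntegral_lt_top {β : ℕ} (hβ : 1 ≤ β) {H c T : ℝ} (hH : 0 < H)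
    (hc : 0 < c) (hT : 0 < T) (h : H * (2 * β + d) < 1) :
    ∫⁻ Δ in Set.Icc 0 T, weightedGaussianIntegral d β H c Δ < ∞ := by
  rw [setLIntegral_congr Ioc_ae_eq_Icc.symm]
  set A := c * T ^ (2 * H) with hA
  set M := ((2 * A + 4 * β) / c) ^ β * (2 * Real.pi / c) ^ ((d : ℝ) / 2) with hM
  have hbound : ∀ Δ ∈ Set.Ioc 0 T, weightedGaussianIntegral d β H c Δ ≤
      ENNReal.ofReal (M * Δ ^ (-(H * (2 * β + d)))) := by
    intro Δ hΔ
    have hΔ0 : 0 < Δ := hΔ.1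
    set a := c * Δ ^ (2 * H) with ha
    have ha0 : 0 < a := by positivity
    have haA : a ≤ A := by
      exact mul_le_mul_of_nonneg_left (Real.rpow_le_rpow hΔ0.le hΔ.2 (by positivity)) hc.le
    have hint : Integrable (fun w : EuclideanSpace ℝ (Fin d) =>
        Real.exp (-(a / 2) * ‖w‖ ^ 2)) := by
      have := (GaussianFourier.integrable_cexp_neg_mul_sq_norm_add (V := EuclideanSpace ℝ (Fin d))
        (b := ((a / 2 : ℝ) : ℂ)) (by simpa using ha0) 0 0).norm
      refine this.congr (ae_of_all _ fun w => ?_)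
      simp only [Complex.norm_exp, zero_mul, add_zero]
      congr 1
      rw [← Complex.ofReal_neg, ← Complex.ofReal_pow, ← Complex.ofReal_mul, Complex.ofReal_re]
    calc weightedGaussianIntegral d β H c Δ
        ≤ ∫⁻ w : EuclideanSpace ℝ (Fin d), ENNReal.ofReal
            (((2 * A + 4 * β) / a) ^ β * Real.exp (-(a / 2) * ‖w‖ ^ 2)) := by
          refine lintegral_mono fun w => ENNReal.ofReal_le_ofReal ?_
          have := one_add_pow_mul_exp_le hβ ha0 haA (norm_nonneg w)
          convert this using 3
          rw [ha]; ring
      _ = ENNReal.ofReal (((2 * A + 4 * β) / a) ^ β * (Real.pi / (a / 2)) ^ ((d : ℝ) / 2)) := by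
          rw [← ofReal_integral_eq_lintegral_ofReal (hint.const_mul _)
            (ae_of_all _ fun w => by positivity), integral_const_mul,
            GaussianFourier.integral_rexp_neg_mul_sq_norm (by positivity)]
          simp
      _ = ENNReal.ofReal (M * Δ ^ (-(H * (2 * β + d)))) := by
          congr 1
          have e1 : (2 * A + 4 * β) / a = (2 * A + 4 * β) / c * Δ ^ (-(2 * H)) := by
            rw [ha, Real.rpow_neg hΔ0.le]; field_simp
          have e2 : Real.pi / (a / 2) = 2 * Real.pi / c * Δ ^ (-(2 * H)) := by
            rw [ha, Real.rpow_neg hΔ0.le]; field_simp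
          rw [e1, e2, mul_pow, Real.mul_rpow (by positivity) (by positivity), ← Real.rpow_natCast
            (Δ ^ (-(2 * H))), ← Real.rpow_mul hΔ0.le, ← Real.rpow_mul hΔ0.le, hM]
          have e3 : Δ ^ (-(H * (2 * β + d))) =
              Δ ^ (-(2 * H) * (β : ℝ)) * Δ ^ (-(2 * H) * ((d : ℝ) / 2)) := by
            rw [← Real.rpow_add hΔ0]; congr 1; ring
          rw [e3]; ring
  have hInt : IntegrableOn (fun Δ : ℝ => M * Δ ^ (-(H * (2 * β + d)))) (Set.Ioc 0 T) := by
    refine Integrable.const_mul ?_ M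
    have := intervalIntegral.intervalIntegrable_rpow' (a := 0) (b := T)
      (r := -(H * (2 * β + d))) (by linarith)
    rwa [intervalIntegrable_iff_integrableOn_Ioc_of_le hT.le] at this
  refine lt_of_le_of_lt (setLIntegral_mono' measurableSet_Ioc hbound) ?_
  exact hInt.lintegral_lt_top

end GaussianWeight

/-! ### Integrability of the weighted joint characteristic function. -/

section JointCharacteristicFunction

variable {Ω : Type*} [MeasurableSpace Ω] {d : ℕ}

/-- The joint characteristic function of the values of the process at the times `s`. -/
def jointCharFun (μ : Measure Ω) (X : ℝ≥0 → Ω → EuclideanSpace ℝ (Fin d)) {m : ℕ}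
    (s : Fin m → ℝ) (u : Fin m → EuclideanSpace ℝ (Fin d)) : ℂ :=
  ∫ ω, Complex.exp (↑(2 * Real.pi * ∑ j, inner ℝ (u j) (X (s j).toNNReal ω)) * Complex.I) ∂μ

variable {μ : Measure Ω} {X : ℝ≥0 → Ω → EuclideanSpace ℝ (Fin d)}

lemma jointCharFun_comp_perm {m : ℕ} (σ : Equiv.Perm (Fin m)) (s : Fin m → ℝ)
    (u : Fin m → EuclideanSpace ℝ (Fin d)) :
    jointCharFun μ X (s ∘ σ) (u ∘ σ) = jointCharFun μ X s u := by
  unfold jointCharFun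
  congr 1; ext ω
  rw [← Equiv.sum_comp σ fun j => inner ℝ (u j) (X (s j).toNNReal ω)]
  rfl

lemma measurable_cexp_sum_inner (hX : Measurable (Function.uncurry X)) (m : ℕ) :
    Measurable fun q : ((Fin m → ℝ) × (Fin m → EuclideanSpace ℝ (Fin d))) × Ω =>
      Complex.exp (↑(2 * Real.pi * ∑ j, inner ℝ (q.1.2 j) (X (q.1.1 j).toNNReal q.2)) *
        Complex.I) := by
  have : ∀ j, Measurable fun q : ((Fin m → ℝ) × (Fin m → EuclideanSpace ℝ (Fin d))) × Ω =>
      X (q.1.1 j).toNNReal q.2 := fun j =>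
    hX.comp ((measurable_real_toNNReal.comp (by fun_prop)).prodMk (by fun_prop))
  fun_prop

lemma measurable_jointCharFun [SFinite μ] (hX : Measurable (Function.uncurry X)) (m : ℕ) :
    Measurable fun p : (Fin m → ℝ) × (Fin m → EuclideanSpace ℝ (Fin d)) =>
      jointCharFun μ X p.1 p.2 :=
  (measurable_cexp_sum_inner hX m).stronglyMeasurable.integral_prod_right'.measurable

variable [IsProbabilityMeasure μ] [NeZero d] {H : ℝ}

/-- The weight `∏ (1 + |u_j|)^β` is integrable against the joint characteristic function at
times in `(0, T]`. -/
theorem IsClassG.lintegral_weight_jointCharFun_lt_top (hX : IsClassG μ H X) (hH : 0 < H) {β : ℕ}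
    (hβ : 1 ≤ β) (h : H * (2 * β + d) < 1) {T : ℝ} (hT : 0 < T) (m : ℕ) :
    ∫⁻ p : (Fin m → ℝ) × (Fin m → EuclideanSpace ℝ (Fin d)),
      (∏ j, ENNReal.ofReal ((1 + ‖p.2 j‖) ^ β)) * ‖jointCharFun μ X p.1 p.2‖ₑ
      ∂((Measure.pi fun _ => volume.restrict (Set.Ioc 0 T)).prod (Measure.pi fun _ => volume)) <
      ∞ := by
  obtain ⟨c, hc, hK⟩ := hX.exists_norm_integral_cexp_le hH m
  set Φ : (Fin m → ℝ) × (Fin m → EuclideanSpace ℝ (Fin d)) → ℝ≥0∞ := fun p =>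
    (∏ j, ENNReal.ofReal ((1 + ‖p.2 j‖) ^ β)) * ‖jointCharFun μ X p.1 p.2‖ₑ with hΦ
  have hΦm : Measurable Φ := by
    refine Measurable.mul ?_ (measurable_jointCharFun hX.measurable m).enorm
    fun_prop
  set S := {q : (Fin m → ℝ) × (Fin m → EuclideanSpace ℝ (Fin d)) | Monotone q.1} with hS
  refine lt_of_le_of_lt (lintegral_symm_le _ _ m hΦm fun σ s u => ?_) ?_
  · simp only [jointCharFun_comp_perm, Function.comp_apply]
    rw [Equiv.prod_comp σ fun j => ENNReal.ofReal ((1 + ‖u j‖) ^ β)]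
  refine ENNReal.mul_lt_top (ENNReal.natCast_lt_top _) ?_
  -- The cutoff makes `B` integrable on all of `ℝ`. The times may then range over the whole line,
  -- where translation invariance factorizes the integral over increments.
  set B : ℝ → ℝ≥0∞ := (Set.Icc 0 T).indicator (weightedGaussianIntegral d β H c) with hB
  have hBm : Measurable B := (measurable_weightedGaussianIntegral d β H c).indicator
    measurableSet_Icc
  have hinner : ∀ s ∈ Set.univ.pi fun _ : Fin m => Set.Ioc 0 T,
      ∫⁻ u, S.indicator Φ (s, u) ∂(Measure.pi fun _ => volume) ≤
        ∏ j, B (s j - (Fin.cons 0 s : Fin (m + 1) → ℝ) j.castSucc) := by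
    intro s hs
    simp only [Set.mem_univ_pi] at hs
    by_cases hmono : Monotone s
    · have hΔ : ∀ j : Fin m, s j - (Fin.cons 0 s : Fin (m + 1) → ℝ) j.castSucc ∈ Set.Icc 0 T := by
        intro j
        have : (Fin.cons 0 s : Fin (m + 1) → ℝ) j.castSucc ∈ Set.Icc 0 (s j) := by
          rcases eq_or_ne j.castSucc 0 with h0 | h0
          · rw [h0]; simpa using (hs j).1.le
          · obtain ⟨i, hi⟩ := Fin.exists_succ_eq.2 h0
            rw [← hi, Fin.cons_succ]
            refine ⟨(hs i).1.le, hmono ?_⟩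
            have := congrArg Fin.val hi
            simp only [Fin.val_succ, Fin.val_castSucc] at this
            exact Fin.le_def.2 (by omega)
        exact ⟨by linarith [this.2], by linarith [this.1, (hs j).2]⟩
      have hcast : ∀ j : Fin m, (((s j).toNNReal : ℝ) -
          (Fin.cons 0 (fun j => (s j).toNNReal) : Fin (m + 1) → ℝ≥0) j.castSucc) =
          s j - (Fin.cons 0 s : Fin (m + 1) → ℝ) j.castSucc := by
        intro j
        rw [Real.coe_toNNReal _ (hs j).1.le]
        congr 1
        generalize j.castSucc = i
        induction i using Fin.cases with
        | zero => simp
        | succ i => simp [(hs i).1.le]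
      calc ∫⁻ u, S.indicator Φ (s, u) ∂(Measure.pi fun _ => volume)
          ≤ ∫⁻ u : Fin m → EuclideanSpace ℝ (Fin d), ∏ j, (fun w : EuclideanSpace ℝ (Fin d) =>
              ENNReal.ofReal ((1 + ‖w‖) ^ (2 * β) * Real.exp (-c * ‖w‖ ^ 2 *
              (s j - (Fin.cons 0 s : Fin (m + 1) → ℝ) j.castSucc) ^ (2 * H))))
              (∑ k, if j ≤ k then u k else 0) ∂(Measure.pi fun _ => volume) := by
            refine lintegral_mono fun u => ?_
            rw [Set.indicator_of_mem (show (s, u) ∈ S from hmono)]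
            simp only [hΦ]
            have h1 := hK (fun j => (s j).toNNReal) u
              (fun i j hij => Real.toNNReal_le_toNNReal (hmono hij))
              (fun j => Real.toNNReal_pos.2 (hs j).1)
            simp only [hcast] at h1
            rw [← ENNReal.ofReal_prod_of_nonneg (fun j _ => by positivity),
              ← ENNReal.ofReal_prod_of_nonneg (fun j _ => by positivity), ← ofReal_norm,
              ← ENNReal.ofReal_mul (Finset.prod_nonneg fun j _ => by positivity)]
            refine ENNReal.ofReal_le_ofReal ?_
            rw [Finset.prod_mul_distrib, Finset.prod_pow]
            refine mul_le_mul ?_ h1 (norm_nonneg _)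
              (Finset.prod_nonneg fun j _ => by positivity)
            calc (∏ j, (1 + ‖u j‖)) ^ β
                ≤ (∏ j, (1 + ‖∑ k, if j ≤ k then u k else 0‖) ^ 2) ^ β :=
                  pow_le_pow_left₀ (Finset.prod_nonneg fun j _ => by positivity)
                    (prod_one_add_norm_le m u) _
              _ = _ := by simp only [← Finset.prod_pow, ← pow_mul]
        _ = ∏ j, weightedGaussianIntegral d β H c
              (s j - (Fin.cons 0 s : Fin (m + 1) → ℝ) j.castSucc) :=
            lintegral_prod_partial_sum volume m (a := fun j w => ENNReal.ofReal ((1 + ‖w‖) ^ (2 * β) *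
              Real.exp (-c * ‖w‖ ^ 2 *
              (s j - (Fin.cons 0 s : Fin (m + 1) → ℝ) j.castSucc) ^ (2 * H)))) fun j => by fun_prop
        _ = _ := Finset.prod_congr rfl fun j _ => by rw [hB, Set.indicator_of_mem (hΔ j)]
    · have : ∀ u, S.indicator Φ (s, u) = 0 := fun u => Set.indicator_of_notMem hmono _
      simp [this]
  have hSΦ : AEMeasurable (S.indicator Φ) ((Measure.pi fun _ => volume.restrict (Set.Ioc 0 T)).prod
      (Measure.pi fun _ => volume)) := by
    exact (hΦm.indicator (measurableSet_monotone_fst m)).aemeasurable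
  rw [lintegral_prod _ hSΦ, ← Measure.restrict_pi_pi]
  refine lt_of_le_of_lt (setLIntegral_mono' (MeasurableSet.univ_pi fun _ => measurableSet_Ioc)
    hinner) ?_
  refine lt_of_le_of_lt (setLIntegral_le_lintegral _ _) ?_
  rw [lintegral_prod_sub volume m (a := fun _ => B) (fun _ => hBm) 0]
  refine ENNReal.prod_lt_top fun j _ => ?_
  rw [hB, lintegral_indicator measurableSet_Icc]
  exact setLIntegral_weightedGaussianIntegral_lt_top hβ hH hc hT h

end JointCharacteristicFunction

/-! ### The heat kernel and its Fourier transform. -/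

section HeatKernel

variable {d : ℕ}

lemma heatKernel_nonneg {ε : ℝ} (hε : 0 < ε) (y : EuclideanSpace ℝ (Fin d)) :
    0 ≤ heatKernel ε y := by
  unfold heatKernel; positivity

lemma heatKernel_le {ε : ℝ} (hε : 0 < ε) (y : EuclideanSpace ℝ (Fin d)) :
    heatKernel ε y ≤ (2 * Real.pi * ε) ^ (-(d : ℝ) / 2) := by
  unfold heatKernel
  refine mul_le_of_le_one_right (by positivity) (Real.exp_le_one_iff.2 ?_)
  rw [neg_div]
  exact neg_nonpos.2 (by positivity)

lemma ofReal_heatKernel (ε : ℝ) (y : EuclideanSpace ℝ (Fin d)) :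
    (heatKernel ε y : ℂ) = ((2 * Real.pi * ε) ^ (-(d : ℝ) / 2) : ℝ) •
      Complex.exp (-((1 / (2 * ε) : ℝ) : ℂ) * ‖y‖ ^ 2) := by
  unfold heatKernel
  rw [Complex.real_smul]
  push_cast
  congr 2
  ring

lemma integrable_heatKernel {ε : ℝ} (hε : 0 < ε) :
    Integrable (heatKernel ε : EuclideanSpace ℝ (Fin d) → ℝ) := by
  have := (GaussianFourier.integrable_cexp_neg_mul_sq_norm_add (V := EuclideanSpace ℝ (Fin d))
    (b := ((1 / (2 * ε) : ℝ) : ℂ)) (by rw [Complex.ofReal_re]; positivity) 0 0).smul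
    ((2 * Real.pi * ε) ^ (-(d : ℝ) / 2) : ℝ)
  simp only [zero_mul, add_zero] at this
  refine this.re.congr (ae_of_all _ fun y => ?_)
  simp only [Pi.smul_apply]
  rw [← ofReal_heatKernel]
  simp

lemma fourier_heatKernel {ε : ℝ} (hε : 0 < ε) (u : EuclideanSpace ℝ (Fin d)) :
    𝓕 (fun y : EuclideanSpace ℝ (Fin d) => (heatKernel ε y : ℂ)) u =
      Complex.exp (-(2 * Real.pi ^ 2 * ε * ‖u‖ ^ 2 : ℝ)) := by
  simp only [ofReal_heatKernel]
  have h := fourier_gaussian_innerProductSpace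
    (V := EuclideanSpace ℝ (Fin d)) (b := ((1 / (2 * ε) : ℝ) : ℂ))
    (by rw [Complex.ofReal_re]; positivity) u
  rw [Real.fourier_eq'] at h ⊢
  simp only [smul_comm _ ((2 * Real.pi * ε) ^ (-(d : ℝ) / 2) : ℝ)]
  rw [integral_smul, h, finrank_euclideanSpace_fin, Complex.real_smul, ← mul_assoc]
  have e1 : ((Real.pi : ℂ) / ((1 / (2 * ε) : ℝ) : ℂ)) ^ ((d : ℂ) / 2) =
      (((2 * Real.pi * ε) ^ ((d : ℝ) / 2) : ℝ) : ℂ) := by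
    rw [Complex.ofReal_cpow (by positivity)]
    push_cast
    congr 1
    have : (ε : ℂ) ≠ 0 := by exact_mod_cast hε.ne'
    field_simp
  rw [e1, ← Complex.ofReal_mul, ← Real.rpow_add (by positivity), neg_div, neg_add_cancel,
    Real.rpow_zero, Complex.ofReal_one, one_mul]
  congr 1
  push_cast
  have : (ε : ℂ) ≠ 0 := by exact_mod_cast hε.ne'
  field_simp

end HeatKernel

/-! ### One-dimensional marginals in time and the mean occupation measure. -/

section Occupation

variable {Ω : Type*} [MeasurableSpace Ω] {μ : Measure Ω} [IsProbabilityMeasure μ]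
  {d : ℕ} [NeZero d] {H : ℝ} {X : ℝ≥0 → Ω → EuclideanSpace ℝ (Fin d)}

namespace IsClassG

lemma integral_sq_one_pos (hX : IsClassG μ H X) (hH : 0 < H) : 0 < ∫ ω, X 1 ω 0 ^ 2 ∂μ := by
  obtain ⟨c, hc, h⟩ := hX.exists_mul_sum_le hH 1
  have := h (fun _ => 1) (fun _ => 1) (fun _ _ _ => le_rfl) (fun _ => one_pos)
  simp at this
  exact hc.trans_le this

/-- The law of `X_s` is the centered Gaussian law with density the heat kernel at time
`E (X_s^1)^2`. -/
lemma map_eval_eq_withDensity (hX : IsClassG μ H X) (hH : 0 < H) {s : ℝ≥0} (hs : 0 < s) :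
    μ.map (X s) = volume.withDensity fun y =>
      ENNReal.ofReal (heatKernel (∫ ω, X s ω 0 ^ 2 ∂μ) y) := by
  set v := ∫ ω, X s ω 0 ^ 2 ∂μ with hv
  have hv0 : 0 < v := by
    rw [hv, hX.integral_sq s hs]
    have := hX.integral_sq_one_pos hH
    have : (0 : ℝ) < s := hs
    positivity
  have hfin : IsFiniteMeasure ((volume : Measure (EuclideanSpace ℝ (Fin d))).withDensity fun y =>
      ENNReal.ofReal (heatKernel v y)) :=
    isFiniteMeasure_withDensity_ofReal (integrable_heatKernel hv0).2
  have hprob : IsProbabilityMeasure (μ.map (X s)) :=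
    Measure.isProbabilityMeasure_map (hX.measurable_eval s).aemeasurable
  refine Measure.ext_of_charFun (funext fun y => ?_)
  have hvar : Var[fun ω => inner ℝ y (X s ω); μ] = ‖y‖ ^ 2 * v := by
    have := hX.variance_sum_inner (fun _ : Fin 1 => s) (fun _ => y)
    simp only [Finset.univ_unique, Finset.sum_singleton] at this
    rw [this, EuclideanSpace.real_norm_sq_eq, Finset.sum_mul]
    refine Finset.sum_congr rfl fun i _ => ?_
    rw [hv, ← integral_const_mul]
    simp only [mul_pow]
  have hmean : ∫ ω, inner ℝ y (X s ω) ∂μ = 0 := by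
    rw [integral_inner ((hX.memLp_eval s).integrable one_le_two), hX.centered, inner_zero_right]
  rw [(hX.gaussian.hasGaussianLaw_eval s).charFun_map_eq, hvar, hmean, charFun_apply,
    integral_withDensity_eq_integral_toReal_smul
      (by unfold heatKernel; fun_prop) (ae_of_all _ fun _ => ENNReal.ofReal_lt_top)]
  -- `charFun` integrates `exp (i x·y)` and `𝓕` integrates `exp (-2πi x·u)`, whence `u = -y / (2π)`.
  have h := fourier_heatKernel hv0 (-(1 / (2 * Real.pi)) • y)
  rw [Real.fourier_eq'] at h
  have e : ∀ x : EuclideanSpace ℝ (Fin d), (ENNReal.ofReal (heatKernel v x)).toReal •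
      Complex.exp (↑(inner ℝ x y) * Complex.I) = Complex.exp (↑(-2 * Real.pi *
      inner ℝ x (-(1 / (2 * Real.pi)) • y)) * Complex.I) • (heatKernel v x : ℂ) := by
    intro x
    rw [ENNReal.toReal_ofReal (heatKernel_nonneg hv0 x), Complex.real_smul, smul_eq_mul, mul_comm,
      inner_smul_right]
    congr 4
    have := Real.pi_ne_zero
    field_simp
  simp only [e]
  rw [h, norm_smul]
  congr 1
  push_cast
  simp only [zero_mul, zero_sub, Real.norm_eq_abs, mul_pow, ← Complex.ofReal_pow, sq_abs]
  push_cast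
  have : (Real.pi : ℂ) ≠ 0 := by exact_mod_cast Real.pi_ne_zero
  field_simp

/-- The mean occupation measure of the process over `(0, T]` is dominated by Lebesgue measure. -/
lemma exists_map_le_smul_volume (hX : IsClassG μ H X) (hH : 0 < H) (hHd : H * d < 1) {T : ℝ}
    (hT : 0 ≤ T) : ∃ C : ℝ≥0, ((volume.restrict (Set.Ioc 0 T)).prod μ).map
      (fun p : ℝ × Ω => X p.1.toNNReal p.2) ≤ C • volume := by
  set V := ∫ ω, X 1 ω 0 ^ 2 ∂μ with hV
  have hV0 : 0 < V := hX.integral_sq_one_pos hH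
  have hm : Measurable (fun p : ℝ × Ω => X p.1.toNNReal p.2) :=
    hX.measurable.comp ((measurable_real_toNNReal.comp measurable_fst).prodMk measurable_snd)
  -- The variance at time `s` is `s^{2H} V`, so this is the maximum of the density of `X_s`. It is
  -- integrable in `s` because `H d < 1`.
  have hInt : IntegrableOn (fun s : ℝ => (2 * Real.pi * V) ^ (-(d : ℝ) / 2) * s ^ (-(H * d)))
      (Set.Ioc 0 T) := by
    refine Integrable.const_mul ?_ _
    have := intervalIntegral.intervalIntegrable_rpow' (a := 0) (b := T)
      (r := -(H * d)) (by linarith)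
    rwa [intervalIntegrable_iff_integrableOn_Ioc_of_le hT] at this
  have hfin := hInt.lintegral_lt_top
  refine ⟨(∫⁻ s in Set.Ioc 0 T, ENNReal.ofReal
    ((2 * Real.pi * V) ^ (-(d : ℝ) / 2) * s ^ (-(H * d)))).toNNReal, Measure.le_iff.2 fun A hA => ?_⟩
  rw [Measure.map_apply hm hA, Measure.prod_apply (hm hA), Measure.smul_apply,
    ENNReal.smul_def, ENNReal.coe_toNNReal hfin.ne, smul_eq_mul, ← lintegral_mul_const _
      (by fun_prop)]
  refine setLIntegral_mono' measurableSet_Ioc fun s hs => ?_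
  have hs0 : 0 < s.toNNReal := Real.toNNReal_pos.2 hs.1
  have h1 : μ (Prod.mk s ⁻¹' ((fun p : ℝ × Ω => X p.1.toNNReal p.2) ⁻¹' A)) =
      μ.map (X s.toNNReal) A := by
    rw [Measure.map_apply (hX.measurable_eval _) hA]; rfl
  rw [h1, hX.map_eval_eq_withDensity hH hs0, withDensity_apply _ hA]
  have hvs := hX.integral_sq s.toNNReal hs0
  rw [Real.coe_toNNReal _ hs.1.le] at hvs
  calc _ ≤ ∫⁻ _ in A, ENNReal.ofReal ((2 * Real.pi * V) ^ (-(d : ℝ) / 2) * s ^ (-(H * d))) := by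
        refine lintegral_mono fun y => ENNReal.ofReal_le_ofReal ?_
        have hsp := hs.1
        rw [hvs]
        refine (heatKernel_le (by positivity) y).trans_eq ?_
        rw [← hV, show 2 * Real.pi * (s ^ (2 * H) * V) = (2 * Real.pi * V) * s ^ (2 * H) by ring,
          Real.mul_rpow (by positivity) (by positivity), ← Real.rpow_mul hsp.le]
        congr 2; ring
    _ = _ := by rw [setLIntegral_const]

end IsClassG

end Occupation

/-! ### Fourier transforms of real functions. -/

section RealFourier

variable {d : ℕ}

/-- The Fourier transform of a real function. -/
def realFourier (g : EuclideanSpace ℝ (Fin d) → ℝ) (u : EuclideanSpace ℝ (Fin d)) : ℂ :=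
  𝓕 (fun x => (g x : ℂ)) u

lemma realFourier_eq (g : EuclideanSpace ℝ (Fin d) → ℝ) (u : EuclideanSpace ℝ (Fin d)) :
    realFourier g u = ∫ x, Complex.exp (↑(-2 * Real.pi * inner ℝ x u) * Complex.I) * g x := by
  rw [realFourier, Real.fourier_eq']; rfl

lemma continuous_realFourier {g : EuclideanSpace ℝ (Fin d) → ℝ} (hg : Integrable g) :
    Continuous (realFourier g) :=
  VectorFourier.fourierIntegral_continuous Real.continuous_fourierChar
    (L := innerₗ (EuclideanSpace ℝ (Fin d))) continuous_inner hg.ofReal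

lemma norm_realFourier_le (g : EuclideanSpace ℝ (Fin d) → ℝ) (u : EuclideanSpace ℝ (Fin d)) :
    ‖realFourier g u‖ ≤ ∫ x, |g x| := by
  rw [realFourier_eq]
  refine (norm_integral_le_integral_norm _).trans_eq ?_
  congr 1; ext x
  rw [norm_mul, Complex.norm_exp_ofReal_mul_I, one_mul, Complex.norm_real, Real.norm_eq_abs]

lemma integrable_cexp_mul {g : EuclideanSpace ℝ (Fin d) → ℝ} (hg : Integrable g)
    (u : EuclideanSpace ℝ (Fin d)) :
    Integrable fun x => Complex.exp (↑(-2 * Real.pi * inner ℝ x u) * Complex.I) * g x := by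
  refine hg.ofReal.bdd_mul (c := 1) (by fun_prop) (ae_of_all _ fun x => ?_)
  rw [Complex.norm_exp_ofReal_mul_I]

lemma realFourier_sub {g h : EuclideanSpace ℝ (Fin d) → ℝ} (hg : Integrable g)
    (hh : Integrable h) (u : EuclideanSpace ℝ (Fin d)) :
    realFourier (fun x => g x - h x) u = realFourier g u - realFourier h u := by
  simp only [realFourier_eq]
  rw [← integral_sub (integrable_cexp_mul hg u) (integrable_cexp_mul hh u)]
  congr 1; ext x; push_cast; ring

lemma realFourier_const_mul (c : ℝ) (g : EuclideanSpace ℝ (Fin d) → ℝ)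
    (u : EuclideanSpace ℝ (Fin d)) :
    realFourier (fun x => c * g x) u = c * realFourier g u := by
  simp only [realFourier_eq]
  rw [← integral_const_mul]
  congr 1; ext x; push_cast; ring

lemma realFourier_sum {ι : Type*} (s : Finset ι) {g : ι → EuclideanSpace ℝ (Fin d) → ℝ}
    (hg : ∀ i ∈ s, Integrable (g i)) (u : EuclideanSpace ℝ (Fin d)) :
    realFourier (fun x => ∑ i ∈ s, g i x) u = ∑ i ∈ s, realFourier (g i) u := by
  simp only [realFourier_eq]
  rw [← integral_finsetSum _ fun i hi => integrable_cexp_mul (hg i hi) u]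
  congr 1; ext x; push_cast; rw [Finset.mul_sum]

end RealFourier

/-! ### Time integrals along the path and their even moments. -/

section TimeIntegral

set_option linter.unusedSectionVars false

variable {Ω : Type*} [MeasurableSpace Ω] {μ : Measure Ω} [IsProbabilityMeasure μ]
  {d : ℕ} [NeZero d] {H : ℝ} {X : ℝ≥0 → Ω → EuclideanSpace ℝ (Fin d)}

/-- The integral of `g` along the path of the process up to time `T`. -/
def timeIntegral (X : ℝ≥0 → Ω → EuclideanSpace ℝ (Fin d)) (T : ℝ)
    (g : EuclideanSpace ℝ (Fin d) → ℝ) (ω : Ω) : ℝ :=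
  ∫ s in (0 : ℝ)..T, g (X s.toNNReal ω)

/-- The integral that dominates the moment of order `m` of a time integral. -/
def momentIntegral (μ : Measure Ω) (X : ℝ≥0 → Ω → EuclideanSpace ℝ (Fin d)) (T : ℝ) (m : ℕ)
    (h : EuclideanSpace ℝ (Fin d) → ℂ) : ℝ≥0∞ :=
  ∫⁻ p : (Fin m → ℝ) × (Fin m → EuclideanSpace ℝ (Fin d)),
    (∏ j, ‖h (p.2 j)‖ₑ) * ‖jointCharFun μ X p.1 p.2‖ₑ
    ∂((Measure.pi fun _ => volume.restrict (Set.Ioc 0 T)).prod (Measure.pi fun _ => volume))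

namespace IsClassG

lemma measurable_time (hX : IsClassG μ H X) :
    Measurable (fun p : ℝ × Ω => X p.1.toNNReal p.2) :=
  hX.measurable.comp ((measurable_real_toNNReal.comp measurable_fst).prodMk measurable_snd)

/-- Domination of the mean occupation measure by Lebesgue measure allows the composition with the
process of a function `g` that is only almost everywhere measurable. -/
lemma integrable_comp (hX : IsClassG μ H X) (hH : 0 < H) (hHd : H * d < 1) {T : ℝ}
    (hT : 0 ≤ T) {g : EuclideanSpace ℝ (Fin d) → ℝ} (hg : Integrable g) :
    Integrable (fun p : ℝ × Ω => g (X p.1.toNNReal p.2))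
      ((volume.restrict (Set.Ioc 0 T)).prod μ) := by
  obtain ⟨C, hC⟩ := hX.exists_map_le_smul_volume hH hHd hT
  exact (((hg.smul_measure_nnreal (c := C)).mono_measure hC).comp_measurable hX.measurable_time)

lemma ae_intervalIntegrable (hX : IsClassG μ H X) (hH : 0 < H) (hHd : H * d < 1) {T : ℝ}
    (hT : 0 ≤ T) {g : EuclideanSpace ℝ (Fin d) → ℝ} (hg : Integrable g) :
    ∀ᵐ ω ∂μ, IntervalIntegrable (fun s : ℝ => g (X s.toNNReal ω)) volume 0 T := by
  filter_upwards [(hX.integrable_comp hH hHd hT hg).prod_left_ae] with ω hω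
  rwa [intervalIntegrable_iff_integrableOn_Ioc_of_le hT]

lemma integrable_timeIntegral (hX : IsClassG μ H X) (hH : 0 < H) (hHd : H * d < 1) {T : ℝ}
    (hT : 0 ≤ T) {g : EuclideanSpace ℝ (Fin d) → ℝ} (hg : Integrable g) :
    Integrable (timeIntegral X T g) μ := by
  have := (hX.integrable_comp hH hHd hT hg).integral_prod_right
  refine this.congr (ae_of_all _ fun ω => ?_)
  simp only [timeIntegral]
  rw [intervalIntegral.integral_of_le hT]

lemma timeIntegral_sub (hX : IsClassG μ H X) (hH : 0 < H) (hHd : H * d < 1) {T : ℝ}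
    (hT : 0 ≤ T) {g h : EuclideanSpace ℝ (Fin d) → ℝ} (hg : Integrable g) (hh : Integrable h) :
    timeIntegral X T (fun x => g x - h x) =ᵐ[μ] timeIntegral X T g - timeIntegral X T h := by
  filter_upwards [hX.ae_intervalIntegrable hH hHd hT hg, hX.ae_intervalIntegrable hH hHd hT hh]
    with ω h1 h2
  exact intervalIntegral.integral_sub h1 h2

lemma timeIntegral_sum (hX : IsClassG μ H X) (hH : 0 < H) (hHd : H * d < 1) {T : ℝ}
    (hT : 0 ≤ T) {ι : Type*} (s : Finset ι) {g : ι → EuclideanSpace ℝ (Fin d) → ℝ}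
    (hg : ∀ i ∈ s, Integrable (g i)) :
    timeIntegral X T (fun x => ∑ i ∈ s, g i x) =ᵐ[μ] fun ω => ∑ i ∈ s, timeIntegral X T (g i) ω := by
  have : ∀ᵐ ω ∂μ, ∀ i ∈ s, IntervalIntegrable (fun s : ℝ => g i (X s.toNNReal ω)) volume 0 T :=
    (Finset.eventually_all s).2 fun i hi => hX.ae_intervalIntegrable hH hHd hT (hg i hi)
  filter_upwards [this] with ω hω
  exact intervalIntegral.integral_finsetSum hω

lemma timeIntegral_const_mul {T : ℝ} (c : ℝ) (g : EuclideanSpace ℝ (Fin d) → ℝ) (ω : Ω) :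
    timeIntegral X T (fun x => c * g x) ω = c * timeIntegral X T g ω :=
  intervalIntegral.integral_const_mul _ _

/-- Continuity in `L¹`, from the domination of the occupation measure. It carries the moment bound
from smooth functions to integrable ones. -/
lemma exists_eLpNorm_one_timeIntegral_le (hX : IsClassG μ H X) (hH : 0 < H) (hHd : H * d < 1)
    {T : ℝ} (hT : 0 ≤ T) : ∃ C : ℝ≥0, ∀ g : EuclideanSpace ℝ (Fin d) → ℝ, Integrable g →
      eLpNorm (timeIntegral X T g) 1 μ ≤ C * eLpNorm g 1 volume := by
  obtain ⟨C, hC⟩ := hX.exists_map_le_smul_volume hH hHd hT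
  refine ⟨C, fun g hg => ?_⟩
  have hgm : AEMeasurable (fun x => ‖g x‖ₑ) (((volume.restrict (Set.Ioc 0 T)).prod μ).map
      (fun p : ℝ × Ω => X p.1.toNNReal p.2)) :=
    ((hg.smul_measure_nnreal (c := C)).mono_measure hC).1.enorm
  have hint := hX.integrable_comp hH hHd hT hg
  rw [eLpNorm_one_eq_lintegral_enorm, eLpNorm_one_eq_lintegral_enorm]
  calc ∫⁻ ω, ‖timeIntegral X T g ω‖ₑ ∂μ
      ≤ ∫⁻ ω, (∫⁻ s in Set.Ioc 0 T, ‖g (X s.toNNReal ω)‖ₑ) ∂μ := by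
        refine lintegral_mono fun ω => ?_
        rw [timeIntegral, intervalIntegral.integral_of_le hT]
        exact enorm_integral_le_lintegral_enorm _
    _ = ∫⁻ p, ‖g (X p.1.toNNReal p.2)‖ₑ ∂((volume.restrict (Set.Ioc 0 T)).prod μ) :=
        (lintegral_prod_symm _ hint.1.enorm).symm
    _ = ∫⁻ x, ‖g x‖ₑ ∂(((volume.restrict (Set.Ioc 0 T)).prod μ).map
      (fun p : ℝ × Ω => X p.1.toNNReal p.2)) :=
        (lintegral_map' hgm hX.measurable_time.aemeasurable).symm
    _ ≤ ∫⁻ x, ‖g x‖ₑ ∂(C • volume) := lintegral_mono' hC le_rfl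
    _ = C * ∫⁻ x, ‖g x‖ₑ := by rw [lintegral_smul_measure]; rfl

/-- The moment bound for functions to which Fourier inversion applies. -/
lemma lintegral_timeIntegral_pow_le_of_continuous (hX : IsClassG μ H X) {T : ℝ} (hT : 0 ≤ T)
    {g : EuclideanSpace ℝ (Fin d) → ℝ} (hg : Integrable g) (hgc : Continuous g)
    (hgF : Integrable (realFourier g)) {m : ℕ} (hm : Even m) :
    ∫⁻ ω, ‖timeIntegral X T g ω‖ₑ ^ m ∂μ ≤ momentIntegral μ X T m (realFourier g) := by
  set τ := volume.restrict (Set.Ioc 0 T) with hτ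
  set π := (Measure.pi fun _ : Fin m => τ).prod
    (Measure.pi fun _ : Fin m => (volume : Measure (EuclideanSpace ℝ (Fin d)))) with hπ
  have hinv : ∀ x, (g x : ℂ) =
      ∫ u, Complex.exp (↑(2 * Real.pi * inner ℝ u x) * Complex.I) * realFourier g u := by
    intro x
    have := hg.ofReal.fourierInv_fourier_eq hgF
      (Complex.continuous_ofReal.comp hgc).continuousAt (v := x)
    rw [Real.fourierInv_eq'] at this
    exact this.symm
  set P : ((Fin m → ℝ) × (Fin m → EuclideanSpace ℝ (Fin d))) × Ω → ℂ := fun q =>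
    (∏ j, realFourier g (q.1.2 j)) * Complex.exp
      (↑(2 * Real.pi * ∑ j, inner ℝ (q.1.2 j) (X (q.1.1 j).toNNReal q.2)) * Complex.I) with hP
  have hexp := measurable_cexp_sum_inner hX.measurable m
  have hprod : Integrable (fun p : (Fin m → ℝ) × (Fin m → EuclideanSpace ℝ (Fin d)) =>
      ∏ j, realFourier g (p.2 j)) π :=
    (Integrable.fintype_prod (f := fun (_ : Fin m) => realFourier g) fun _ => hgF).comp_snd _
  have hPint : Integrable P (π.prod μ) := by
    refine (hprod.comp_fst μ).mul_bdd (c := 1) hexp.aestronglyMeasurable (ae_of_all _ fun q => ?_)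
    rw [Complex.norm_exp_ofReal_mul_I]
  have hPω : ∀ ω, Integrable (fun p => P (p, ω)) π := by
    intro ω
    refine hprod.mul_bdd (c := 1) (hexp.comp measurable_prodMk_right).aestronglyMeasurable
      (ae_of_all _ fun q => ?_)
    exact (Complex.norm_exp_ofReal_mul_I _).le
  -- Insert Fourier inversion and write the `m`-th power as an integral over `m` independent copies
  -- of the time and frequency variables.
  have hpow : ∀ ω, (timeIntegral X T g ω : ℂ) ^ m = ∫ p, P (p, ω) ∂π := by
    intro ω
    rw [timeIntegral, intervalIntegral.integral_of_le hT, ← integral_complex_ofReal]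
    simp only [hinv]
    have h1 := integral_fintype_prod_eq_pow (ι := Fin m) (μ := τ) fun s : ℝ =>
      ∫ u, Complex.exp (↑(2 * Real.pi * inner ℝ u (X s.toNNReal ω)) * Complex.I) * realFourier g u
    rw [Fintype.card_fin] at h1
    rw [← h1, hπ, integral_prod _ (hPω ω)]
    congr 1; ext s
    rw [← integral_fintype_prod_eq_prod (μ := fun _ : Fin m => volume) (fun (j : Fin m) u =>
      Complex.exp (↑(2 * Real.pi * inner ℝ u (X (s j).toNNReal ω)) * Complex.I) * realFourier g u)]
    congr 1; ext u
    simp only [hP]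
    rw [Finset.prod_mul_distrib, mul_comm, ← Complex.exp_sum]
    congr 2
    rw [← Finset.sum_mul, Finset.mul_sum, Complex.ofReal_sum]
  have hPr := hPint.integral_prod_right
  have hreal : Integrable (fun ω => timeIntegral X T g ω ^ m) μ := by
    refine hPr.re.congr (ae_of_all _ fun ω => ?_)
    simp only [← hpow]
    norm_cast
  -- As `m` is even, the absolute moment is a moment without absolute values. Fubini can then put
  -- the expectation on the exponential alone, before any modulus is taken.
  have hnorm : ∫⁻ ω, ‖timeIntegral X T g ω‖ₑ ^ m ∂μ =
      ‖∫ ω, ((timeIntegral X T g ω : ℂ)) ^ m ∂μ‖ₑ := by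
    have h0 : ∀ ω, 0 ≤ timeIntegral X T g ω ^ m := fun ω => hm.pow_nonneg _
    have h1 : ∀ ω, ‖timeIntegral X T g ω‖ₑ ^ m = ENNReal.ofReal (timeIntegral X T g ω ^ m) := by
      intro ω
      rw [← enorm_pow, Real.enorm_of_nonneg (h0 ω)]
    simp only [h1]
    rw [← ofReal_integral_eq_lintegral_ofReal hreal (ae_of_all _ h0),
      ← Real.enorm_of_nonneg (integral_nonneg h0)]
    simp only [← Complex.ofReal_pow]
    rw [integral_complex_ofReal, enorm_eq_nnnorm, enorm_eq_nnnorm, Complex.nnnorm_real]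
  rw [hnorm]
  simp only [hpow]
  rw [integral_integral_swap (f := fun ω p => P (p, ω)) hPint.swap]
  refine (enorm_integral_le_lintegral_enorm _).trans_eq ?_
  refine lintegral_congr fun p => ?_
  simp only [hP]
  rw [integral_const_mul, enorm_mul]
  congr 1
  simp only [enorm_eq_nnnorm, nnnorm_prod, ENNReal.ofNNReal_finsetProd]

end IsClassG

end TimeIntegral

/-! ### Moment bounds and the convergence criterion in `L^p`. -/

section Moments

set_option linter.unusedSectionVars false

variable {Ω : Type*} [MeasurableSpace Ω] {μ : Measure Ω} [IsProbabilityMeasure μ]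
  {d : ℕ} [NeZero d] {H : ℝ} {X : ℝ≥0 → Ω → EuclideanSpace ℝ (Fin d)}

namespace IsClassG

/-- Dominated convergence for the integrals that dominate moments. -/
lemma tendsto_momentIntegral (hX : IsClassG μ H X) (hH : 0 < H) {β : ℕ} (hβ : 1 ≤ β)
    (hHβ : H * (2 * β + d) < 1) {T : ℝ} (hT : 0 < T) (m : ℕ) {ι : Type*} {l : Filter ι}
    [l.IsCountablyGenerated] {h : ι → EuclideanSpace ℝ (Fin d) → ℂ}
    {h₀ : EuclideanSpace ℝ (Fin d) → ℂ} {C : ℝ} (hm : ∀ᶠ a in l, Measurable (h a))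
    (hC : ∀ᶠ a in l, ∀ u, ‖h a u‖ ≤ C * (1 + ‖u‖) ^ β)
    (hlim : ∀ u, Tendsto (fun a => h a u) l (𝓝 (h₀ u))) :
    Tendsto (fun a => momentIntegral μ X T m (h a)) l (𝓝 (momentIntegral μ X T m h₀)) := by
  have hK := measurable_jointCharFun (μ := μ) hX.measurable m
  refine tendsto_lintegral_filter_of_dominated_convergence
    (fun p => ENNReal.ofReal C ^ m * ((∏ j, ENNReal.ofReal ((1 + ‖p.2 j‖) ^ β)) *
      ‖jointCharFun μ X p.1 p.2‖ₑ)) ?_ ?_ ?_ ?_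
  · filter_upwards [hm] with a ha
    refine Measurable.mul (Finset.measurable_prod _ fun j _ => ?_) hK.enorm
    exact (ha.comp ((measurable_pi_apply j).comp measurable_snd)).enorm
  · filter_upwards [hC] with a ha
    refine ae_of_all _ fun p => ?_
    rw [← mul_assoc]
    refine mul_le_mul_left ?_ _
    calc ∏ j, ‖h a (p.2 j)‖ₑ ≤ ∏ j, (ENNReal.ofReal C * ENNReal.ofReal ((1 + ‖p.2 j‖) ^ β)) := by
          refine Finset.prod_le_prod' fun j _ => ?_
          rw [← ENNReal.ofReal_mul' (by positivity), ← ofReal_norm]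
          exact ENNReal.ofReal_le_ofReal (ha _)
      _ = _ := by rw [Finset.prod_mul_distrib]; simp
  · rw [lintegral_const_mul]
    · exact ENNReal.mul_ne_top (by finiteness)
        (hX.lintegral_weight_jointCharFun_lt_top hH hβ hHβ hT m).ne
    · exact Measurable.mul (by fun_prop) hK.enorm
  · refine ae_of_all _ fun p => ?_
    refine ENNReal.Tendsto.mul_const ?_ (Or.inr enorm_ne_top)
    refine ENNReal.tendsto_finsetProd_of_ne_top _ (fun j _ => (hlim _).enorm)
      (fun j _ => enorm_ne_top)

lemma momentIntegral_lt_top (hX : IsClassG μ H X) (hH : 0 < H) {β : ℕ} (hβ : 1 ≤ β)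
    (hHβ : H * (2 * β + d) < 1) {T : ℝ} (hT : 0 < T) (m : ℕ)
    {h : EuclideanSpace ℝ (Fin d) → ℂ} {C : ℝ} (hC : ∀ u, ‖h u‖ ≤ C) :
    momentIntegral μ X T m h < ∞ := by
  have hK := measurable_jointCharFun (μ := μ) hX.measurable m
  refine lt_of_le_of_lt (lintegral_mono (g := fun p => ENNReal.ofReal C ^ m *
    ((∏ j, ENNReal.ofReal ((1 + ‖p.2 j‖) ^ β)) * ‖jointCharFun μ X p.1 p.2‖ₑ)) fun p => ?_) ?_
  · simp only
    rw [← mul_assoc]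
    refine mul_le_mul_left ?_ _
    calc ∏ j, ‖h (p.2 j)‖ₑ ≤ ∏ j, (ENNReal.ofReal C * ENNReal.ofReal ((1 + ‖p.2 j‖) ^ β)) := by
          refine Finset.prod_le_prod' fun j _ => ?_
          rw [← ENNReal.ofReal_mul' (by positivity), ← ofReal_norm]
          refine ENNReal.ofReal_le_ofReal ((hC _).trans (le_mul_of_one_le_right
            ((norm_nonneg _).trans (hC (p.2 j))) (one_le_pow₀ (by simp))))
      _ = _ := by rw [Finset.prod_mul_distrib]; simp
  · rw [lintegral_const_mul]
    · exact ENNReal.mul_lt_top (by finiteness)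
        (hX.lintegral_weight_jointCharFun_lt_top hH hβ hHβ hT m)
    · exact Measurable.mul (by fun_prop) hK.enorm

lemma mul_lt_one_of_mul_add_lt_one {H : ℝ} (hH : 0 < H) {β d : ℕ} (h : H * (2 * β + d) < 1) :
    H * d < 1 := by
  have : (0 : ℝ) ≤ H * (2 * β) := by positivity
  linarith [mul_add H (2 * β) d]

lemma eLpNorm_natCast_eq {f : Ω → ℝ} {m : ℕ} (hm : m ≠ 0) :
    eLpNorm f m μ = (∫⁻ ω, ‖f ω‖ₑ ^ m ∂μ) ^ (1 / (m : ℝ)) := by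
  rw [eLpNorm_eq_lintegral_rpow_enorm_toReal (by exact_mod_cast hm) (by simp)]
  simp

/-- The moment bound: the moment of even order `m` of a time integral is dominated by an integral
of the Fourier transform against the joint characteristic functions of the process. -/
theorem eLpNorm_timeIntegral_le (hX : IsClassG μ H X) (hH : 0 < H) {β : ℕ} (hβ : 1 ≤ β)
    (hHβ : H * (2 * β + d) < 1) {T : ℝ} (hT : 0 < T) {m : ℕ} (hm : Even m) (hm0 : m ≠ 0)
    {g : EuclideanSpace ℝ (Fin d) → ℝ} (hg : Integrable g) :
    eLpNorm (timeIntegral X T g) m μ ≤ momentIntegral μ X T m (realFourier g) ^ (1 / (m : ℝ)) := by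
  have hHd := mul_lt_one_of_mul_add_lt_one hH hHβ
  -- Fourier inversion needs a continuous function with integrable transform. Smooth compactly
  -- supported functions have Schwartz transforms and approximate `g` in `L¹`.
  have hex : ∀ k : ℕ, ∃ f : EuclideanSpace ℝ (Fin d) → ℝ, HasCompactSupport f ∧
      ContDiff ℝ ((⊤ : ℕ∞) : WithTop ℕ∞) f ∧
      eLpNorm (g - f) 1 volume ≤ ENNReal.ofReal (1 / ((k : ℝ) + 1)) := fun k =>
    (memLp_one_iff_integrable.2 hg).exist_eLpNorm_sub_le (by simp) le_rfl (by positivity)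
  choose f hfc hfs hfg using hex
  have hf : ∀ k, Integrable (f k) := fun k =>
    (hfs k).continuous.integrable_of_hasCompactSupport (hfc k)
  have hfF : ∀ k, Integrable (realFourier (f k)) := by
    intro k
    have hc : HasCompactSupport (fun x => (f k x : ℂ)) := (hfc k).comp_left (g := Complex.ofReal) rfl
    have := (𝓕 (hc.toSchwartzMap (Complex.ofRealCLM.contDiff.comp (hfs k)))).integrable (μ := volume)
    exact this
  have hlim0 : Tendsto (fun k : ℕ => ENNReal.ofReal (1 / ((k : ℝ) + 1))) atTop (𝓝 0) := by
    simpa using (ENNReal.tendsto_ofReal tendsto_one_div_add_atTop_nhds_zero_nat)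
  obtain ⟨C, hC⟩ := hX.exists_eLpNorm_one_timeIntegral_le hH hHd hT.le
  have hL1 : Tendsto (fun k => eLpNorm (timeIntegral X T (f k) - timeIntegral X T g) 1 μ) atTop
      (𝓝 0) := by
    have hb : ∀ k, eLpNorm (timeIntegral X T (f k) - timeIntegral X T g) 1 μ ≤
        C * ENNReal.ofReal (1 / ((k : ℝ) + 1)) := by
      intro k
      rw [← eLpNorm_congr_ae (hX.timeIntegral_sub hH hHd hT.le (hf k) hg)]
      refine (hC _ ((hf k).sub hg)).trans ?_
      gcongr
      refine le_trans (le_of_eq ?_) (hfg k)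
      exact eLpNorm_sub_comm _ _ _ _
    refine tendsto_of_tendsto_of_tendsto_of_le_of_le tendsto_const_nhds ?_ (fun _ => zero_le) hb
    simpa using ENNReal.Tendsto.const_mul hlim0 (Or.inr ENNReal.coe_ne_top)
  have hmeas := tendstoInMeasure_of_tendsto_eLpNorm one_ne_zero
    (fun k => (hX.integrable_timeIntegral hH hHd hT.le (hf k)).1)
    (hX.integrable_timeIntegral hH hHd hT.le hg).1 hL1
  obtain ⟨ns, hns, hae⟩ := hmeas.exists_seq_tendsto_ae
  -- Closeness in `L¹` makes the transforms uniformly close, so the right sides of the moment bounds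
  -- converge; the left sides pass to the limit by Fatou along an almost surely convergent
  -- subsequence.
  have hFu : ∀ k u, ‖realFourier (f k) u - realFourier g u‖ ≤ 1 / ((k : ℝ) + 1) := by
    intro k u
    rw [← realFourier_sub (hf k) hg]
    refine (norm_realFourier_le _ _).trans ?_
    have h1 := hfg k
    rw [eLpNorm_sub_comm, eLpNorm_one_eq_lintegral_enorm] at h1
    simp only [← Real.norm_eq_abs]
    have hfg1 : AEStronglyMeasurable (fun x => f k x - g x) volume := ((hf k).sub hg).1
    rw [integral_norm_eq_lintegral_enorm hfg1]
    exact ENNReal.toReal_le_of_le_ofReal (by positivity) h1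
  have hM : Tendsto (fun k => momentIntegral μ X T m (realFourier (f (ns k)))) atTop
      (𝓝 (momentIntegral μ X T m (realFourier g))) := by
    refine hX.tendsto_momentIntegral hH hβ hHβ hT m (C := (∫ x, |g x|) + 1)
      (Eventually.of_forall fun k => (continuous_realFourier (hf _)).measurable)
      (Eventually.of_forall fun k u => ?_) fun u => ?_
    · have h1 : ‖realFourier (f (ns k)) u‖ ≤ (∫ x, |g x|) + 1 := by
        have h2 := hFu (ns k) u
        have h3 : (1 : ℝ) / ((ns k : ℝ) + 1) ≤ 1 := by
          rw [div_le_one (by positivity)]; simp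
        have h4 := norm_realFourier_le g u
        have h5 := norm_add_le (realFourier (f (ns k)) u - realFourier g u) (realFourier g u)
        rw [sub_add_cancel] at h5
        linarith
      exact h1.trans (le_mul_of_one_le_right ((norm_nonneg _).trans h1) (one_le_pow₀ (by simp)))
    · rw [tendsto_iff_norm_sub_tendsto_zero]
      refine squeeze_zero (fun _ => norm_nonneg _) (fun k => hFu (ns k) u) ?_
      exact tendsto_one_div_add_atTop_nhds_zero_nat.comp hns.tendsto_atTop
  refine (Lp.eLpNorm_lim_le_liminf_eLpNorm
    (fun k => (hX.integrable_timeIntegral hH hHd hT.le (hf (ns k))).1) _ hae).trans ?_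
  have hM' := (ENNReal.continuous_rpow_const (y := 1 / (m : ℝ))).continuousAt.tendsto.comp hM
  rw [← Tendsto.liminf_eq hM']
  refine liminf_le_liminf (Eventually.of_forall fun k => ?_)
  rw [eLpNorm_natCast_eq hm0]
  exact ENNReal.rpow_le_rpow (hX.lintegral_timeIntegral_pow_le_of_continuous hT.le (hf _)
    (hfs _).continuous (hfF _) hm) (by positivity)

lemma exists_even_le {p : ℝ≥0∞} (hp : p ≠ ∞) : ∃ m : ℕ, Even m ∧ m ≠ 0 ∧ p ≤ m := by
  obtain ⟨n, hn⟩ := ENNReal.exists_nat_gt hp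
  refine ⟨2 * (n + 1), even_two_mul _, by omega, hn.le.trans ?_⟩
  exact_mod_cast (by omega : n ≤ 2 * (n + 1))

/-- Time integrals of integrable functions have finite moments of all orders. -/
theorem memLp_timeIntegral (hX : IsClassG μ H X) (hH : 0 < H) {β : ℕ} (hβ : 1 ≤ β)
    (hHβ : H * (2 * β + d) < 1) {T : ℝ} (hT : 0 < T) {p : ℝ≥0∞} (hp : p ≠ ∞)
    {g : EuclideanSpace ℝ (Fin d) → ℝ} (hg : Integrable g) :
    MemLp (timeIntegral X T g) p μ := by
  obtain ⟨m, hm, hm0, hpm⟩ := exists_even_le hp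
  have hHd := mul_lt_one_of_mul_add_lt_one hH hHβ
  refine MemLp.mono_exponent ⟨(hX.integrable_timeIntegral hH hHd hT.le hg).1, ?_⟩ hpm
  refine (hX.eLpNorm_timeIntegral_le hH hβ hHβ hT hm hm0 hg).trans_lt ?_
  exact ENNReal.rpow_lt_top_of_nonneg (by positivity)
    (hX.momentIntegral_lt_top hH hβ hHβ hT m (norm_realFourier_le g)).ne

/-- Time integrals tend to zero in every `L^p` if the Fourier transforms tend to zero pointwise
and are dominated by a multiple of `(1 + |u|)^β`. -/
theorem tendsto_eLpNorm_timeIntegral (hX : IsClassG μ H X) (hH : 0 < H) {β : ℕ} (hβ : 1 ≤ β)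
    (hHβ : H * (2 * β + d) < 1) {T : ℝ} (hT : 0 < T) {p : ℝ≥0∞} (hp : p ≠ ∞)
    {ι : Type*} {l : Filter ι} [l.IsCountablyGenerated] {g : ι → EuclideanSpace ℝ (Fin d) → ℝ}
    (hg : ∀ᶠ a in l, Integrable (g a)) {C : ℝ}
    (hC : ∀ᶠ a in l, ∀ u, ‖realFourier (g a) u‖ ≤ C * (1 + ‖u‖) ^ β)
    (hlim : ∀ u, Tendsto (fun a => realFourier (g a) u) l (𝓝 0)) :
    Tendsto (fun a => eLpNorm (timeIntegral X T (g a)) p μ) l (𝓝 0) := by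
  -- On a probability space the `L^p` norms increase with `p`, so even integer exponents suffice.
  obtain ⟨m, hm, hm0, hpm⟩ := exists_even_le hp
  have hHd := mul_lt_one_of_mul_add_lt_one hH hHβ
  have hM := hX.tendsto_momentIntegral hH hβ hHβ hT m (l := l) (h := fun a => realFourier (g a))
    (h₀ := fun _ => 0) (hg.mono fun a ha => (continuous_realFourier ha).measurable) hC hlim
  have h0 : momentIntegral μ X T m (fun _ => 0) = 0 := by
    simp [momentIntegral, zero_pow hm0]
  have hM' := (ENNReal.continuous_rpow_const (y := 1 / (m : ℝ))).continuousAt.tendsto.comp hM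
  rw [h0, ENNReal.zero_rpow_of_pos (by positivity)] at hM'
  refine tendsto_of_tendsto_of_tendsto_of_le_of_le' tendsto_const_nhds hM'
    (Eventually.of_forall fun _ => zero_le) ?_
  filter_upwards [hg] with a ha
  exact (eLpNorm_le_eLpNorm_of_exponent_le hpm
    (hX.integrable_timeIntegral hH hHd hT.le ha).1).trans
    (hX.eLpNorm_timeIntegral_le hH hβ hHβ hT hm hm0 ha)

end IsClassG

end Moments

/-! ### Derivatives of the heat kernel and their Fourier transforms. -/

section HeatKernelDerivatives

variable {d : ℕ}

lemma contDiff_heatKernel (ε : ℝ) (n : WithTop ℕ∞) :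
    ContDiff ℝ n (heatKernel ε : EuclideanSpace ℝ (Fin d) → ℝ) := by
  unfold heatKernel
  exact contDiff_const.mul (((contDiff_norm_sq ℝ).neg.div_const _).exp)

lemma integrable_one_add_norm_pow_mul_exp {a : ℝ} (ha : 0 < a) (n : ℕ) :
    Integrable fun x : EuclideanSpace ℝ (Fin d) => (1 + ‖x‖) ^ n * Real.exp (-a * ‖x‖ ^ 2) := by
  have hint : Integrable (fun w : EuclideanSpace ℝ (Fin d) =>
      ((2 * a + 4 * (n + 1 : ℕ)) / a) ^ (n + 1) * Real.exp (-(a / 2) * ‖w‖ ^ 2)) := by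
    have := (GaussianFourier.integrable_cexp_neg_mul_sq_norm_add (V := EuclideanSpace ℝ (Fin d))
      (b := ((a / 2 : ℝ) : ℂ)) (by simpa using ha) 0 0).norm
    refine (this.congr (ae_of_all _ fun w => ?_)).const_mul _
    simp only [Complex.norm_exp, zero_mul, add_zero]
    congr 1
    rw [← Complex.ofReal_neg, ← Complex.ofReal_pow, ← Complex.ofReal_mul, Complex.ofReal_re]
  refine hint.mono' (by fun_prop) (ae_of_all _ fun x => ?_)
  rw [Real.norm_of_nonneg (by positivity)]
  refine le_trans ?_ (one_add_pow_mul_exp_le (Nat.succ_le_succ (Nat.zero_le n)) ha le_rfl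
    (norm_nonneg x))
  gcongr
  · linarith [norm_nonneg x]
  · omega

/-- The exponent is quadratic, hence of temperate growth, and every derivative of `exp` is `exp`.
The bound for iterated derivatives of a composition thus gives a polynomial times the same Gaussian.
-/
lemma integrable_iteratedFDeriv_heatKernel {ε : ℝ} (hε : 0 < ε) (n : ℕ) :
    Integrable (iteratedFDeriv ℝ n (heatKernel ε : EuclideanSpace ℝ (Fin d) → ℝ)) := by
  set f : EuclideanSpace ℝ (Fin d) → ℝ := fun x => -‖x‖ ^ 2 / (2 * ε) with hf
  have hfg : Function.HasTemperateGrowth f := by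
    have : f = fun x => (-1 / (2 * ε)) * ‖x‖ ^ 2 := by ext x; simp only [hf]; ring
    rw [this]
    exact (Function.HasTemperateGrowth.const _).mul (Function.hasTemperateGrowth_norm_sq _)
  obtain ⟨k, C, hC, hbound⟩ := hfg.norm_iteratedFDeriv_le_uniform n
  set A := (2 * Real.pi * ε) ^ (-(d : ℝ) / 2) with hA
  have hh : (heatKernel ε : EuclideanSpace ℝ (Fin d) → ℝ) = A • (Real.exp ∘ f) := rfl
  have hfc : ContDiff ℝ (n : WithTop ℕ∞) f := (contDiff_norm_sq ℝ).neg.div_const _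
  have hcd : ContDiff ℝ (n : WithTop ℕ∞) (Real.exp ∘ f) := Real.contDiff_exp.comp hfc
  have hle : ∀ x : EuclideanSpace ℝ (Fin d), ‖iteratedFDeriv ℝ n (heatKernel ε) x‖ ≤
      A * (n.factorial * (1 + C) ^ n) * ((1 + ‖x‖) ^ (k * n) * Real.exp (-(1 / (2 * ε)) * ‖x‖ ^ 2)) := by
    intro x
    rw [hh, iteratedFDeriv_const_smul_apply hcd.contDiffAt, norm_smul,
      Real.norm_of_nonneg (by positivity)]
    have h1 := norm_iteratedFDeriv_comp_le (n := n) (N := n) (g := Real.exp) (f := f)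
      Real.contDiff_exp hfc le_rfl x
      (C := Real.exp (f x)) (D := (1 + C) * (1 + ‖x‖) ^ k) (fun i _ => by
        rw [norm_iteratedFDeriv_eq_norm_iteratedDeriv, iteratedDeriv_eq_iterate, Real.iter_deriv_exp,
          Real.norm_of_nonneg (Real.exp_pos _).le]) (fun i hi hin => by
        refine (hbound i hin x).trans ?_
        have h1 : C * (1 + ‖x‖) ^ k ≤ (1 + C) * (1 + ‖x‖) ^ k := by gcongr; linarith
        refine h1.trans (le_self_pow₀ ?_ (by omega))
        have : (1 : ℝ) ≤ (1 + ‖x‖) ^ k := one_le_pow₀ (by simp)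
        nlinarith)
    have h2 : f x = -(1 / (2 * ε)) * ‖x‖ ^ 2 := by simp only [hf]; ring
    rw [h2] at h1
    calc _ ≤ A * (n.factorial * Real.exp (-(1 / (2 * ε)) * ‖x‖ ^ 2) *
          ((1 + C) * (1 + ‖x‖) ^ k) ^ n) := by gcongr
      _ = _ := by rw [mul_pow, ← pow_mul]; ring
  refine ((integrable_one_add_norm_pow_mul_exp (by positivity) (k * n)).const_mul _).mono'
    ?_ (ae_of_all _ hle)
  exact ((contDiff_heatKernel ε n).continuous_iteratedFDeriv le_rfl).aestronglyMeasurable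

/-- The function of `X_s` that is integrated in the smoothed derivative of the local time. -/
def heatKernelDeriv {k : ℕ} (i : Fin k → Fin d) (z : EuclideanSpace ℝ (Fin d)) (ε : ℝ)
    (y : EuclideanSpace ℝ (Fin d)) : ℝ :=
  iteratedFDeriv ℝ k (fun x => heatKernel ε (y - x)) z fun j => EuclideanSpace.single (i j) 1

/-- The kernel is even, so it may be differentiated as a function of `x - y`, and no sign appears.
-/
lemma heatKernelDeriv_eq {k : ℕ} (i : Fin k → Fin d) (z : EuclideanSpace ℝ (Fin d)) (ε : ℝ)
    (y : EuclideanSpace ℝ (Fin d)) :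
    heatKernelDeriv i z ε y = iteratedFDeriv ℝ k (heatKernel ε) (z - y)
      fun j => EuclideanSpace.single (i j) 1 := by
  have : (fun x => heatKernel ε (y - x)) = fun x : EuclideanSpace ℝ (Fin d) => heatKernel ε (x - y) := by
    ext x; simp only [heatKernel, norm_sub_rev]
  rw [heatKernelDeriv, this, iteratedFDeriv_comp_sub]

lemma integrable_iteratedFDeriv_heatKernel_apply {ε : ℝ} (hε : 0 < ε) {k : ℕ}
    (m : Fin k → EuclideanSpace ℝ (Fin d)) :
    Integrable fun x => iteratedFDeriv ℝ k (heatKernel ε : EuclideanSpace ℝ (Fin d) → ℝ) x m :=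
  (ContinuousMultilinearMap.apply ℝ (fun _ : Fin k => EuclideanSpace ℝ (Fin d)) ℝ m).integrable_comp
    (integrable_iteratedFDeriv_heatKernel hε k)

lemma integrable_heatKernelDeriv {ε : ℝ} (hε : 0 < ε) {k : ℕ} (i : Fin k → Fin d)
    (z : EuclideanSpace ℝ (Fin d)) : Integrable (heatKernelDeriv i z ε) := by
  have := (integrable_iteratedFDeriv_heatKernel_apply hε
    fun j => EuclideanSpace.single (i j) (1 : ℝ)).comp_sub_left z
  simpa only [← heatKernelDeriv_eq] using this

lemma realFourier_comp_sub_left (g : EuclideanSpace ℝ (Fin d) → ℝ)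
    (z u : EuclideanSpace ℝ (Fin d)) :
    realFourier (fun y => g (z - y)) u =
      Complex.exp (↑(-2 * Real.pi * inner ℝ z u) * Complex.I) * realFourier g (-u) := by
  rw [realFourier_eq, realFourier_eq, ← integral_const_mul,
    ← integral_sub_left_eq_self (fun x => Complex.exp (↑(-2 * Real.pi * inner ℝ z u) * Complex.I) *
      (Complex.exp (↑(-2 * Real.pi * inner ℝ x (-u)) * Complex.I) * (g x : ℂ))) volume z]
  congr 1; ext y
  rw [← mul_assoc, ← Complex.exp_add]
  congr 2
  rw [inner_neg_right, inner_sub_left]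
  push_cast; ring

lemma realFourier_iteratedFDeriv_heatKernel {ε : ℝ} (hε : 0 < ε) {k : ℕ}
    (m : Fin k → EuclideanSpace ℝ (Fin d)) (u : EuclideanSpace ℝ (Fin d)) :
    realFourier (fun x => iteratedFDeriv ℝ k (heatKernel ε) x m) u =
      (∏ j, (2 * Real.pi * Complex.I * (inner ℝ u (m j) : ℝ))) *
        Complex.exp (-(2 * Real.pi ^ 2 * ε * ‖u‖ ^ 2 : ℝ)) := by
  set h : EuclideanSpace ℝ (Fin d) → ℂ := fun y => (heatKernel ε y : ℂ) with hh
  have hcd : ContDiff ℝ k h := Complex.ofRealCLM.contDiff.comp (contDiff_heatKernel ε k)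
  have hcomp : ∀ n : ℕ, iteratedFDeriv ℝ n h = fun x =>
      Complex.ofRealCLM.compContinuousMultilinearMap (iteratedFDeriv ℝ n (heatKernel ε) x) := by
    intro n; ext1 x
    exact Complex.ofRealCLM.iteratedFDeriv_comp_left (f := heatKernel ε)
      (contDiff_heatKernel ε n).contDiffAt le_rfl
  have hint : ∀ n : ℕ, Integrable (iteratedFDeriv ℝ n h) := by
    intro n
    rw [hcomp n]
    exact (ContinuousLinearMap.compContinuousMultilinearMapL ℝ
      (fun _ : Fin n => EuclideanSpace ℝ (Fin d)) ℝ ℂ Complex.ofRealCLM).integrable_comp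
      (integrable_iteratedFDeriv_heatKernel hε n)
  have hF := Real.fourier_iteratedFDeriv (N := k) (by exact_mod_cast hcd) (fun n _ => hint n)
    (n := k) le_rfl
  have h1 := congrArg (fun F => F u m) hF
  simp only [VectorFourier.fourierPowSMulRight_apply] at h1
  rw [Real.fourier_continuousMultilinearMap_apply (hint k)] at h1
  have h2 : realFourier (fun x => iteratedFDeriv ℝ k (heatKernel ε) x m) u =
      𝓕 (fun x => iteratedFDeriv ℝ k h x m) u := by
    rw [hcomp k]; rfl
  rw [h2, h1, fourier_heatKernel hε, smul_eq_mul, Complex.real_smul, ← mul_assoc]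
  congr 1
  have h3 : (-(2 * Real.pi * Complex.I : ℂ)) ^ k = ∏ _j : Fin k, -(2 * Real.pi * Complex.I) := by
    simp
  rw [Complex.ofReal_prod, h3, ← Finset.prod_mul_distrib]
  refine Finset.prod_congr rfl fun j _ => ?_
  simp [innerSL_apply_apply ℝ]

/-- The reflection `y ↦ z - y` turns `u` into `-u`, whence the minus signs. As `ε ↓ 0` the Gaussian
factor tends to `1`, leaving the symbol of the derivative of the delta mass at `z`. -/
lemma realFourier_heatKernelDeriv {ε : ℝ} (hε : 0 < ε) {k : ℕ} (i : Fin k → Fin d)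
    (z u : EuclideanSpace ℝ (Fin d)) :
    realFourier (heatKernelDeriv i z ε) u =
      Complex.exp (↑(-2 * Real.pi * inner ℝ z u) * Complex.I) *
        ((∏ j, (-(2 * Real.pi * Complex.I) * (u (i j) : ℂ))) *
        Complex.exp (-(2 * Real.pi ^ 2 * ε * ‖u‖ ^ 2 : ℝ))) := by
  have : heatKernelDeriv i z ε = fun y => (fun x => iteratedFDeriv ℝ k (heatKernel ε) x
      fun j => EuclideanSpace.single (i j) 1) (z - y) := by
    ext y; exact heatKernelDeriv_eq i z ε y
  rw [this, realFourier_comp_sub_left (fun x => iteratedFDeriv ℝ k (heatKernel ε) x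
      fun j => EuclideanSpace.single (i j) 1), realFourier_iteratedFDeriv_heatKernel hε]
  congr 2
  · refine Finset.prod_congr rfl fun j _ => ?_
    rw [EuclideanSpace.inner_single_right]
    simp
  · rw [norm_neg]

end HeatKernelDerivatives

/-! ### Fourier transforms of rescaled functions. -/

section Scaling

variable {d : ℕ}

lemma integrable_scaled {f : EuclideanSpace ℝ (Fin d) → ℝ} (hf : Integrable f) {r : ℝ}
    (hr : 0 < r) (z : EuclideanSpace ℝ (Fin d)) : Integrable fun x => f (r • (x - z)) :=
  (hf.comp_smul hr.ne').comp_sub_right z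

lemma realFourier_scaled (f : EuclideanSpace ℝ (Fin d) → ℝ) {r : ℝ} (hr : 0 < r)
    (z u : EuclideanSpace ℝ (Fin d)) :
    realFourier (fun x => r ^ d * f (r • (x - z))) u =
      Complex.exp (↑(-2 * Real.pi * inner ℝ z u) * Complex.I) * realFourier f (r⁻¹ • u) := by
  rw [realFourier_const_mul, realFourier_eq, realFourier_eq]
  have h1 := integral_sub_right_eq_self (μ := volume) (fun x : EuclideanSpace ℝ (Fin d) =>
    Complex.exp (↑(-2 * Real.pi * inner ℝ (x + z) u) * Complex.I) * f (r • x)) z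
  have h2 := Measure.integral_comp_smul volume (fun x : EuclideanSpace ℝ (Fin d) =>
    Complex.exp (↑(-2 * Real.pi * inner ℝ (r⁻¹ • x + z) u) * Complex.I) * f x) r
  simp only [sub_add_cancel] at h1
  simp only [inv_smul_smul₀ hr.ne'] at h2
  rw [h1, h2, finrank_euclideanSpace_fin, Complex.real_smul, ← mul_assoc,
    abs_of_pos (by positivity)]
  have h3 : ((r ^ d : ℝ) : ℂ) * (((r ^ d)⁻¹ : ℝ) : ℂ) = 1 := by
    rw [← Complex.ofReal_mul, mul_inv_cancel₀ (by positivity), Complex.ofReal_one]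
  rw [h3, one_mul, ← integral_const_mul]
  congr 1; ext x
  rw [← mul_assoc, ← Complex.exp_add]
  congr 2
  rw [inner_add_left, inner_smul_left, inner_smul_right]
  simp only [conj_trivial]
  push_cast; ring

end Scaling

/-! ### Taylor expansion of the Fourier transform at the origin. -/

section Taylor

/-- The remainder of the Taylor polynomial of degree `β - 1` of `θ ↦ exp (iθ)`. -/
def expRemainder (β : ℕ) (θ : ℝ) : ℂ :=
  Complex.exp (θ * Complex.I) - ∑ m ∈ Finset.range β, (θ * Complex.I) ^ m / m.factorial

lemma expRemainder_eq_add (β : ℕ) (θ : ℝ) :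
    expRemainder β θ = (θ * Complex.I) ^ β / β.factorial + expRemainder (β + 1) θ := by
  simp only [expRemainder, Finset.sum_range_succ]; ring

/-- For `|θ| ≤ 1` this is the usual remainder estimate. For `|θ| > 1` the exponential and each of
the `β` Taylor terms are at most `|θ| ^ β`. -/
lemma norm_expRemainder_le {β : ℕ} (hβ : 1 ≤ β) (θ : ℝ) :
    ‖expRemainder β θ‖ ≤ (β + 2) * |θ| ^ β := by
  have hn : ‖(θ : ℂ) * Complex.I‖ = |θ| := by simp
  rcases le_or_gt |θ| 1 with h | h
  · have h1 := Complex.exp_bound (x := (θ : ℂ) * Complex.I) (by rwa [hn]) hβ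
    rw [hn] at h1
    refine h1.trans ?_
    rw [mul_comm]
    refine mul_le_mul_of_nonneg_right ?_ (by positivity)
    have hβ0 : (1 : ℝ) ≤ β := by exact_mod_cast hβ
    have hf : (1 : ℝ) ≤ β.factorial := by exact_mod_cast Nat.factorial_pos β
    have h2 : ((β.factorial : ℝ) * β)⁻¹ ≤ 1 := inv_le_one_of_one_le₀ (by nlinarith)
    calc ((β.succ : ℕ) : ℝ) * ((β.factorial : ℝ) * β)⁻¹ ≤ ((β.succ : ℕ) : ℝ) * 1 := by gcongr
      _ ≤ _ := by push_cast; linarith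
  · refine (norm_sub_le _ _).trans ?_
    have h1 : ‖Complex.exp (θ * Complex.I)‖ ≤ |θ| ^ β := by
      rw [Complex.norm_exp_ofReal_mul_I]; exact one_le_pow₀ h.le
    have h2 : ‖∑ m ∈ Finset.range β, ((θ : ℂ) * Complex.I) ^ m / m.factorial‖ ≤ β * |θ| ^ β := by
      refine (norm_sum_le _ _).trans ?_
      calc _ ≤ ∑ m ∈ Finset.range β, |θ| ^ β := by
            refine Finset.sum_le_sum fun m hm => ?_
            rw [norm_div, norm_pow, hn, Complex.norm_natCast]
            have hf : (1 : ℝ) ≤ m.factorial := by exact_mod_cast Nat.factorial_pos m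
            exact (div_le_self (by positivity) hf).trans
              (pow_le_pow_right₀ h.le (Finset.mem_range.1 hm).le)
        _ = _ := by simp
    have h3 : 0 ≤ |θ| ^ β := by positivity
    linarith

/-- Splitting off the term of degree `β` leaves `r ^ β` times a remainder of order `β + 1` at `θ /
r`, which is `O(1 / r)`. -/
lemma tendsto_pow_mul_expRemainder {β : ℕ} (θ : ℝ) :
    Tendsto (fun r : ℝ => (r : ℂ) ^ β * expRemainder β (θ / r)) atTop
      (𝓝 ((θ * Complex.I) ^ β / β.factorial)) := by
  rw [tendsto_iff_norm_sub_tendsto_zero]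
  have hlim : Tendsto (fun r : ℝ => ((β : ℝ) + 3) * |θ| ^ (β + 1) / r) atTop (𝓝 0) :=
    tendsto_const_nhds.div_atTop tendsto_id
  refine squeeze_zero' (Eventually.of_forall fun _ => norm_nonneg _) ?_ hlim
  filter_upwards [eventually_gt_atTop 0] with r hr
  have hrc : (r : ℂ) ≠ 0 := by exact_mod_cast hr.ne'
  have e : (r : ℂ) ^ β * expRemainder β (θ / r) - (θ * Complex.I) ^ β / β.factorial =
      (r : ℂ) ^ β * expRemainder (β + 1) (θ / r) := by
    rw [expRemainder_eq_add β]
    push_cast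
    rw [mul_add, div_mul_eq_mul_div, div_pow]
    field_simp
    ring
  rw [e, norm_mul, norm_pow, Complex.norm_real, Real.norm_of_nonneg hr.le]
  calc _ ≤ r ^ β * (((β + 1 : ℕ) + 2) * |θ / r| ^ (β + 1)) := by
        gcongr; exact norm_expRemainder_le (by omega) _
    _ = _ := by
        rw [abs_div, abs_of_pos hr, div_pow]
        push_cast
        field_simp
        ring

variable {d : ℕ} {f : EuclideanSpace ℝ (Fin d) → ℝ} {β : ℕ}

lemma integrable_norm_pow_mul (hf : Integrable f) (hmom : Integrable fun x => |f x| * ‖x‖ ^ β)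
    {m : ℕ} (hm : m ≤ β) : Integrable fun x => |f x| * ‖x‖ ^ m := by
  refine (hf.abs.add hmom).mono' (hf.abs.1.mul (by fun_prop)) (ae_of_all _ fun x => ?_)
  rw [Real.norm_of_nonneg (by positivity), Pi.add_apply]
  have : ‖x‖ ^ m ≤ 1 + ‖x‖ ^ β := by
    rcases le_or_gt ‖x‖ 1 with h | h
    · have h1 : ‖x‖ ^ m ≤ 1 := pow_le_one₀ (norm_nonneg x) h
      have h2 : 0 ≤ ‖x‖ ^ β := by positivity
      linarith
    · have h1 := pow_le_pow_right₀ h.le hm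
      linarith
  nlinarith [abs_nonneg (f x)]

lemma integrable_inner_pow_mul (hf : Integrable f)
    (hmom : Integrable fun x => |f x| * ‖x‖ ^ β) {m : ℕ} (hm : m ≤ β)
    (u : EuclideanSpace ℝ (Fin d)) : Integrable fun x => inner ℝ x u ^ m * f x := by
  refine ((integrable_norm_pow_mul hf hmom hm).const_mul (‖u‖ ^ m)).mono'
    (AEStronglyMeasurable.mul (by fun_prop) hf.1) (ae_of_all _ fun x => ?_)
  rw [norm_mul, norm_pow, Real.norm_eq_abs (f x)]
  calc ‖(inner ℝ x u : ℝ)‖ ^ m * |f x| ≤ (‖x‖ * ‖u‖) ^ m * |f x| := by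
        gcongr; exact norm_inner_le_norm x u
    _ = _ := by rw [mul_pow]; ring

lemma integrable_prod_coord_mul (hf : Integrable f)
    (hmom : Integrable fun x => |f x| * ‖x‖ ^ β) (J : Fin β → Fin d) :
    Integrable fun x => (∏ j, x (J j)) * f x := by
  refine hmom.mono' (AEStronglyMeasurable.mul (by fun_prop) hf.1) (ae_of_all _ fun x => ?_)
  rw [norm_mul, norm_prod, Real.norm_eq_abs (f x), mul_comm]
  gcongr
  calc ∏ j, ‖x (J j)‖ ≤ ∏ _j : Fin β, ‖x‖ :=
        Finset.prod_le_prod (fun _ _ => norm_nonneg _) fun j _ => PiLp.norm_apply_le x (J j)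
    _ = _ := by simp

/-- Taylor expansion of the Fourier transform under vanishing of the intermediate moments. -/
lemma realFourier_inv_smul_sub (hβ : 1 ≤ β) (hf : Integrable f)
    (hmom : Integrable fun x => |f x| * ‖x‖ ^ β) (u : EuclideanSpace ℝ (Fin d))
    (h0 : ∀ m, 1 ≤ m → m < β → ∫ x, inner ℝ x u ^ m * f x = 0) (r : ℝ) :
    realFourier f (r⁻¹ • u) - ((∫ x, f x : ℝ) : ℂ) =
      ∫ x, expRemainder β (-2 * Real.pi * inner ℝ x u / r) * f x := by
  obtain ⟨b, rfl⟩ : ∃ b, β = b + 1 := ⟨β - 1, by omega⟩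
  have hI : ∀ m, m < b + 1 → Integrable fun x => (((inner ℝ x u ^ m * f x : ℝ)) : ℂ) :=
    fun m hm => (integrable_inner_pow_mul hf hmom hm.le u).ofReal
  have e : ∀ x, expRemainder (b + 1) (-2 * Real.pi * inner ℝ x u / r) * f x =
      Complex.exp (↑(-2 * Real.pi * inner ℝ x (r⁻¹ • u)) * Complex.I) * f x -
      ∑ m ∈ Finset.range (b + 1), ((-2 * Real.pi / r : ℝ) * Complex.I) ^ m / m.factorial *
        ((inner ℝ x u ^ m * f x : ℝ) : ℂ) := by
    intro x
    rw [expRemainder, sub_mul, Finset.sum_mul, inner_smul_right]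
    congr 1
    · congr 3; push_cast; ring
    · refine Finset.sum_congr rfl fun m _ => ?_
      push_cast
      rw [show (-2 * (Real.pi : ℂ) * (inner ℝ x u : ℝ) / r * Complex.I) =
        (-2 * Real.pi / r * Complex.I) * (inner ℝ x u : ℝ) by ring, mul_pow]
      ring
  simp only [e]
  rw [integral_sub (integrable_cexp_mul hf _) (integrable_finsetSum _ fun m hm =>
    (hI m (Finset.mem_range.1 hm)).const_mul _), ← realFourier_eq,
    integral_finsetSum _ fun m hm => (hI m (Finset.mem_range.1 hm)).const_mul _]
  congr 1
  -- Of the Taylor polynomial only the term of degree zero survives, by the vanishing moments.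
  rw [Finset.sum_range_succ', Finset.sum_eq_zero, zero_add, integral_const_mul,
    integral_complex_ofReal]
  · simp
  · intro m hm
    rw [integral_const_mul, integral_complex_ofReal,
      h0 (m + 1) (by omega) (by have := Finset.mem_range.1 hm; omega)]
    simp

/-- The powers of `r` cancel. This gives an integrable majorant in `x` independent of `r`, and
growth in `u` of degree exactly `β`. -/
lemma norm_pow_mul_expRemainder_mul_le (hβ : 1 ≤ β) {r : ℝ} (hr : 0 < r)
    (u x : EuclideanSpace ℝ (Fin d)) :
    ‖(r : ℂ) ^ β * (expRemainder β (-2 * Real.pi * inner ℝ x u / r) * f x)‖ ≤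
      ((β : ℝ) + 2) * (2 * Real.pi) ^ β * ‖u‖ ^ β * (|f x| * ‖x‖ ^ β) := by
  rw [norm_mul, norm_mul, norm_pow, Complex.norm_real, Complex.norm_real,
    Real.norm_of_nonneg hr.le, Real.norm_eq_abs]
  have h1 : |-2 * Real.pi * inner ℝ x u / r| ≤ 2 * Real.pi * (‖x‖ * ‖u‖) / r := by
    rw [abs_div, abs_mul, abs_mul, abs_of_pos hr, abs_of_pos Real.pi_pos, abs_neg, abs_two]
    have := Real.pi_pos
    gcongr
    exact abs_real_inner_le_norm x u
  calc r ^ β * (‖expRemainder β (-2 * Real.pi * inner ℝ x u / r)‖ * |f x|)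
      ≤ r ^ β * (((β + 2) * (2 * Real.pi * (‖x‖ * ‖u‖) / r) ^ β) * |f x|) := by
        gcongr
        refine (norm_expRemainder_le hβ _).trans ?_
        gcongr
    _ = _ := by
        rw [div_pow, mul_pow, mul_pow ‖x‖]
        field_simp

lemma norm_pow_mul_realFourier_sub_le (hβ : 1 ≤ β) (hf : Integrable f)
    (hmom : Integrable fun x => |f x| * ‖x‖ ^ β) (u : EuclideanSpace ℝ (Fin d))
    (h0 : ∀ m, 1 ≤ m → m < β → ∫ x, inner ℝ x u ^ m * f x = 0) {r : ℝ} (hr : 0 < r) :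
    ‖(r : ℂ) ^ β * (realFourier f (r⁻¹ • u) - ((∫ x, f x : ℝ) : ℂ))‖ ≤
      (β + 2) * (2 * Real.pi) ^ β * (∫ x, |f x| * ‖x‖ ^ β) * ‖u‖ ^ β := by
  rw [realFourier_inv_smul_sub hβ hf hmom u h0, ← integral_const_mul]
  refine (norm_integral_le_of_norm_le (hmom.const_mul
    (((β : ℝ) + 2) * (2 * Real.pi) ^ β * ‖u‖ ^ β)) (ae_of_all _ fun x => ?_)).trans_eq ?_
  · exact norm_pow_mul_expRemainder_mul_le hβ hr u x
  · rw [integral_const_mul]; ring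

/-- Dominated convergence gives the integral of `(-2πi x·u)^β f(x) / β!`. Expanding the power over
all `J : Fin β → Fin d` separates the moments of `f` from the symbols of the derivatives `∂_J`. -/
lemma tendsto_pow_mul_realFourier_sub (hβ : 1 ≤ β) (hf : Integrable f)
    (hmom : Integrable fun x => |f x| * ‖x‖ ^ β) (u : EuclideanSpace ℝ (Fin d))
    (h0 : ∀ m, 1 ≤ m → m < β → ∫ x, inner ℝ x u ^ m * f x = 0) :
    Tendsto (fun r : ℝ => (r : ℂ) ^ β * (realFourier f (r⁻¹ • u) - ((∫ x, f x : ℝ) : ℂ))) atTop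
      (𝓝 (∑ J : Fin β → Fin d, ((1 / β.factorial * ∫ x, (∏ j, x (J j)) * f x : ℝ) : ℂ) *
        ∏ j, (-(2 * Real.pi * Complex.I) * (u (J j) : ℂ)))) := by
  have hlim : ∑ J : Fin β → Fin d, ((1 / β.factorial * ∫ x, (∏ j, x (J j)) * f x : ℝ) : ℂ) *
        ∏ j, (-(2 * Real.pi * Complex.I) * (u (J j) : ℂ)) =
      ∫ x, ((-2 * Real.pi * inner ℝ x u : ℝ) * Complex.I) ^ β / β.factorial * f x := by
    have e : ∀ x, ((-2 * Real.pi * inner ℝ x u : ℝ) * Complex.I) ^ β / β.factorial * f x =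
        ∑ J : Fin β → Fin d, (1 / (β.factorial : ℂ) *
          ∏ j, (-(2 * Real.pi * Complex.I) * (u (J j) : ℂ))) *
          (((∏ j, x (J j)) * f x : ℝ) : ℂ) := by
      intro x
      have e1 : ((-2 * Real.pi * inner ℝ x u : ℝ) : ℂ) * Complex.I =
          ∑ i, (-(2 * Real.pi * Complex.I) * (u i : ℂ)) * (x i : ℂ) := by
        rw [PiLp.inner_apply]
        simp only [RCLike.inner_apply, conj_trivial]
        push_cast
        rw [Finset.mul_sum, Finset.sum_mul]
        refine Finset.sum_congr rfl fun i _ => ?_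
        ring
      rw [e1, Fintype.sum_pow, Finset.sum_div, Finset.sum_mul]
      refine Finset.sum_congr rfl fun J _ => ?_
      rw [Finset.prod_mul_distrib]
      push_cast
      ring
    simp only [e]
    rw [integral_finsetSum _ fun J _ =>
      (integrable_prod_coord_mul hf hmom J).ofReal.const_mul _]
    refine Finset.sum_congr rfl fun J _ => ?_
    rw [integral_const_mul, integral_complex_ofReal]
    push_cast
    ring
  rw [hlim]
  simp only [realFourier_inv_smul_sub hβ hf hmom u h0, ← integral_const_mul]
  refine tendsto_integral_filter_of_dominated_convergence
    (fun x => ((β : ℝ) + 2) * (2 * Real.pi) ^ β * ‖u‖ ^ β * (|f x| * ‖x‖ ^ β)) ?_ ?_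
    (hmom.const_mul _) (ae_of_all _ fun x => ?_)
  · refine Eventually.of_forall fun r => ?_
    unfold expRemainder
    refine AEStronglyMeasurable.const_mul (AEStronglyMeasurable.mul ?_ hf.ofReal.1) _
    refine Continuous.aestronglyMeasurable ?_
    fun_prop
  · filter_upwards [eventually_gt_atTop 0] with r hr
    exact ae_of_all _ fun x => norm_pow_mul_expRemainder_mul_le hβ hr u x
  · simp only [← mul_assoc]
    exact (tendsto_pow_mul_expRemainder _).mul_const _

end Taylor

/-! ### Existence of the local time and its derivatives. -/

section LocalTime

set_option linter.unusedSectionVars false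

variable {Ω : Type*} [MeasurableSpace Ω] {μ : Measure Ω} [IsProbabilityMeasure μ]
  {d : ℕ} [NeZero d] {H : ℝ} {X : ℝ≥0 → Ω → EuclideanSpace ℝ (Fin d)}

lemma smoothedLocalTimeDeriv_eq (t : ℝ≥0) (z : EuclideanSpace ℝ (Fin d)) {k : ℕ}
    (i : Fin k → Fin d) (ε : ℝ) :
    smoothedLocalTimeDeriv X t z i ε = timeIntegral X t (heatKernelDeriv i z ε) := rfl

lemma norm_prod_neg_mul_coord_le {k β : ℕ} (hk : k ≤ β) (i : Fin k → Fin d)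
    (u : EuclideanSpace ℝ (Fin d)) :
    ‖∏ j, (-(2 * Real.pi * Complex.I) * (u (i j) : ℂ))‖ ≤
      (2 * Real.pi) ^ k * (1 + ‖u‖) ^ β := by
  rw [norm_prod]
  have h2 : ∀ j, ‖-(2 * Real.pi * Complex.I) * (u (i j) : ℂ)‖ ≤ 2 * Real.pi * (1 + ‖u‖) := by
    intro j
    have h := PiLp.norm_apply_le u (i j)
    have e : ‖-(2 * Real.pi * Complex.I) * (u (i j) : ℂ)‖ = 2 * Real.pi * ‖u (i j)‖ := by
      rw [norm_mul, norm_neg, norm_mul, norm_mul, Complex.norm_I, Complex.norm_real,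
        Complex.norm_real, Real.norm_of_nonneg Real.pi_pos.le]
      simp
    rw [e]
    have := Real.pi_pos
    gcongr
    linarith
  calc _ ≤ ∏ _j : Fin k, (2 * Real.pi * (1 + ‖u‖)) :=
        Finset.prod_le_prod (fun _ _ => norm_nonneg _) fun j _ => h2 j
    _ = (2 * Real.pi) ^ k * (1 + ‖u‖) ^ k := by simp [mul_pow]
    _ ≤ _ := by
        have := Real.pi_pos
        gcongr
        simp

lemma norm_cexp_neg_le_one {a : ℝ} (ha : 0 ≤ a) : ‖Complex.exp (-(a : ℝ))‖ ≤ 1 := by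
  rw [← Complex.ofReal_neg, Complex.norm_exp_ofReal]
  exact Real.exp_le_one_iff.2 (by linarith)

lemma tendsto_cexp_neg_heat {ι : Type*} {l : Filter ι} {ε : ι → ℝ} (hε : Tendsto ε l (𝓝 0))
    (u : EuclideanSpace ℝ (Fin d)) :
    Tendsto (fun a => Complex.exp (-(2 * Real.pi ^ 2 * ε a * ‖u‖ ^ 2 : ℝ))) l (𝓝 1) := by
  have hc : Continuous fun e : ℝ => Complex.exp (-(2 * Real.pi ^ 2 * e * ‖u‖ ^ 2 : ℝ)) := by
    fun_prop
  have := (hc.tendsto 0).comp hε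
  simpa [Function.comp_def] using this

namespace IsClassG

/-- The Cauchy property as both scales tend to `0`. The transform of the difference is a symbol of
degree `k ≤ β` times a difference of Gaussian factors, bounded by `2` and tending to `0`. -/
lemma tendsto_eLpNorm_smoothed_sub (hX : IsClassG μ H X) (hH : 0 < H) {β : ℕ} (hβ : 1 ≤ β)
    (hHβ : H * (2 * β + d) < 1) {t : ℝ≥0} (ht : 0 < t) (z : EuclideanSpace ℝ (Fin d)) {k : ℕ}
    (hk : k ≤ β) (i : Fin k → Fin d) {p : ℝ≥0∞} (hp : p ≠ ∞) :
    Tendsto (fun e : ℝ × ℝ => eLpNorm (smoothedLocalTimeDeriv X t z i e.1 -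
      smoothedLocalTimeDeriv X t z i e.2) p μ) (𝓝[>] 0 ×ˢ 𝓝[>] 0) (𝓝 0) := by
  have htR : (0 : ℝ) < t := ht
  have hHd := mul_lt_one_of_mul_add_lt_one hH hHβ
  have hpos : ∀ᶠ e : ℝ × ℝ in 𝓝[>] 0 ×ˢ 𝓝[>] 0, 0 < e.1 ∧ 0 < e.2 :=
    (eventually_mem_nhdsWithin (a := (0 : ℝ)) (s := Set.Ioi 0)).prod_mk
      (eventually_mem_nhdsWithin (a := (0 : ℝ)) (s := Set.Ioi 0))
  have hF : ∀ e : ℝ × ℝ, 0 < e.1 ∧ 0 < e.2 → ∀ u,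
      realFourier (fun y => heatKernelDeriv i z e.1 y - heatKernelDeriv i z e.2 y) u =
      Complex.exp (↑(-2 * Real.pi * inner ℝ z u) * Complex.I) *
        ((∏ j, (-(2 * Real.pi * Complex.I) * (u (i j) : ℂ))) *
        (Complex.exp (-(2 * Real.pi ^ 2 * e.1 * ‖u‖ ^ 2 : ℝ)) -
          Complex.exp (-(2 * Real.pi ^ 2 * e.2 * ‖u‖ ^ 2 : ℝ)))) := by
    intro e he u
    rw [realFourier_sub (integrable_heatKernelDeriv he.1 i z)
      (integrable_heatKernelDeriv he.2 i z), realFourier_heatKernelDeriv he.1,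
      realFourier_heatKernelDeriv he.2]
    ring
  have h := hX.tendsto_eLpNorm_timeIntegral hH hβ hHβ htR hp
    (l := 𝓝[>] (0 : ℝ) ×ˢ 𝓝[>] (0 : ℝ))
    (g := fun e y => heatKernelDeriv i z e.1 y - heatKernelDeriv i z e.2 y)
    (C := (2 * Real.pi) ^ k * 2) (hpos.mono fun e he =>
      (integrable_heatKernelDeriv he.1 i z).sub (integrable_heatKernelDeriv he.2 i z))
    (hpos.mono fun e he u => ?_) (fun u => ?_)
  · refine h.congr' (hpos.mono fun e he => ?_)
    rw [eLpNorm_congr_ae (hX.timeIntegral_sub hH hHd htR.le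
      (integrable_heatKernelDeriv he.1 i z) (integrable_heatKernelDeriv he.2 i z))]
    rfl
  · rw [hF e he, norm_mul, Complex.norm_exp_ofReal_mul_I, one_mul, norm_mul]
    have h1 := norm_prod_neg_mul_coord_le hk i u
    have h2 : ‖Complex.exp (-(2 * Real.pi ^ 2 * e.1 * ‖u‖ ^ 2 : ℝ)) -
          Complex.exp (-(2 * Real.pi ^ 2 * e.2 * ‖u‖ ^ 2 : ℝ))‖ ≤ 2 := by
      have h3 := norm_cexp_neg_le_one (a := 2 * Real.pi ^ 2 * e.1 * ‖u‖ ^ 2)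
        (by have := he.1; positivity)
      have h4 := norm_cexp_neg_le_one (a := 2 * Real.pi ^ 2 * e.2 * ‖u‖ ^ 2)
        (by have := he.2; positivity)
      exact (norm_sub_le _ _).trans (by linarith)
    calc _ ≤ (2 * Real.pi) ^ k * (1 + ‖u‖) ^ β * 2 :=
          mul_le_mul h1 h2 (norm_nonneg _) (by have := Real.pi_pos; positivity)
      _ = _ := by ring
  · have h0 : Tendsto (fun ε : ℝ => ε) (𝓝[>] 0) (𝓝 0) := tendsto_id.mono_left nhdsWithin_le_nhds
    have h1 := tendsto_cexp_neg_heat (h0.comp (tendsto_fst (f := 𝓝[>] (0 : ℝ))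
      (g := 𝓝[>] (0 : ℝ)))) u
    have h2 := tendsto_cexp_neg_heat (h0.comp (tendsto_snd (f := 𝓝[>] (0 : ℝ))
      (g := 𝓝[>] (0 : ℝ)))) u
    have h3 := ((h1.sub h2).const_mul
      (∏ j, (-(2 * Real.pi * Complex.I) * (u (i j) : ℂ)))).const_mul
      (Complex.exp (↑(-2 * Real.pi * inner ℝ z u) * Complex.I))
    rw [sub_self, mul_zero, mul_zero] at h3
    exact h3.congr' (hpos.mono fun e he => (hF e he u).symm)

lemma memLp_smoothed (hX : IsClassG μ H X) (hH : 0 < H) {β : ℕ} (hβ : 1 ≤ β)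
    (hHβ : H * (2 * β + d) < 1) {t : ℝ≥0} (ht : 0 < t) (z : EuclideanSpace ℝ (Fin d)) {k : ℕ}
    (i : Fin k → Fin d) {p : ℝ≥0∞} (hp : p ≠ ∞) {ε : ℝ} (hε : 0 < ε) :
    MemLp (smoothedLocalTimeDeriv X t z i ε) p μ :=
  hX.memLp_timeIntegral hH hβ hHβ (T := t) (by exact_mod_cast ht) hp
    (integrable_heatKernelDeriv hε i z)

/-- Existence of the derivatives of the local time of order at most `β`. -/
theorem exists_isLocalTimeDeriv (hX : IsClassG μ H X) (hH : 0 < H) {β : ℕ} (hβ : 1 ≤ β)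
    (hHβ : H * (2 * β + d) < 1) {t : ℝ≥0} (ht : 0 < t) (z : EuclideanSpace ℝ (Fin d)) {k : ℕ}
    (hk : k ≤ β) (i : Fin k → Fin d) : ∃ Y, IsLocalTimeDeriv μ X t z i Y := by
  set F : ℝ → Ω → ℝ := fun ε => smoothedLocalTimeDeriv X t z i ε with hF
  have hcauchy : ∀ p : ℝ≥0∞, p ≠ ∞ → ∀ δ : ℝ≥0∞, 0 < δ → ∃ η : ℝ, 0 < η ∧ ∀ a b : ℝ,
      0 < a → a < η → 0 < b → b < η → eLpNorm (F a - F b) p μ < δ := by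
    intro p hp δ hδ
    have h := (hX.tendsto_eLpNorm_smoothed_sub hH hβ hHβ ht z hk i hp).eventually_lt_const hδ
    obtain ⟨S, hS, hS'⟩ := (Filter.eventually_prod_self_iff
      (r := fun a b => eLpNorm (F a - F b) p μ < δ)).1 h
    obtain ⟨η, hη, hη'⟩ := mem_nhdsGT_iff_exists_Ioo_subset.1 hS
    exact ⟨η, hη, fun a b ha ha' hb hb' => hS' a (hη' ⟨ha, ha'⟩) b (hη' ⟨hb, hb'⟩)⟩
  have hmem : ∀ p : ℝ≥0∞, p ≠ ∞ → ∀ ε : ℝ, 0 < ε → MemLp (F ε) p μ := fun p hp ε hε =>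
    hX.memLp_smoothed hH hβ hHβ ht z i hp hε
  have hex : ∀ n : ℕ, ∃ η : ℝ, 0 < η ∧ ∀ a b : ℝ,
      0 < a → a < η → 0 < b → b < η → eLpNorm (F a - F b) 1 μ < (1 / 2 : ℝ≥0∞) ^ n := fun n =>
    hcauchy 1 (by simp) _ (ENNReal.pow_pos (by simp) n)
  choose η hη hηlt using hex
  -- a decreasing sequence of times along which the limit is defined
  set e : ℕ → ℝ := fun n => min ((Finset.range (n + 1)).inf' (by simp) η) (1 / ((n : ℝ) + 1)) / 2
    with he
  have hinf : ∀ n, 0 < (Finset.range (n + 1)).inf' (by simp) η := fun n =>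
    (Finset.lt_inf'_iff _).2 fun m _ => hη m
  have hepos : ∀ n, 0 < e n := fun n => by
    have := hinf n
    simp only [he]; positivity
  have helt : ∀ N n, N ≤ n → e n < η N := fun N n hn => by
    have h1 : (Finset.range (n + 1)).inf' (by simp) η ≤ η N :=
      Finset.inf'_le _ (Finset.mem_range.2 (by omega))
    have h2 := min_le_left ((Finset.range (n + 1)).inf' (by simp) η) (1 / ((n : ℝ) + 1))
    have h3 := hη N
    simp only [he]; linarith
  have hetend : Tendsto e atTop (𝓝 0) := by
    refine squeeze_zero (fun n => (hepos n).le) (fun n => ?_) tendsto_one_div_add_atTop_nhds_zero_nat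
    have h2 := min_le_right ((Finset.range (n + 1)).inf' (by simp) η) (1 / ((n : ℝ) + 1))
    have h3 : 0 < 1 / ((n : ℝ) + 1) := by positivity
    simp only [he]; linarith
  -- The limit is built once, in `L¹`, so that the same `Y` serves for every `p`.
  obtain ⟨Y, hYp, hY⟩ := Lp.cauchy_complete_eLpNorm (E := ℝ) (p := 1) le_rfl
    (f := fun n => F (e n)) (fun n => hmem 1 (by simp) _ (hepos n))
    (B := fun n => (1 / 2 : ℝ≥0∞) ^ n)
    (by rw [ENNReal.tsum_geometric]; simp) (fun N n m hn hm =>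
      hηlt N _ _ (hepos n) (helt N n hn) (hepos m) (helt N m hm))
  have hYm : TendstoInMeasure μ (fun n => F (e n)) atTop Y :=
    tendstoInMeasure_of_tendsto_eLpNorm one_ne_zero
      (fun n => (hmem 1 (by simp) _ (hepos n)).1) hYp.1 hY
  obtain ⟨ns, hns, hae⟩ := hYm.exists_seq_tendsto_ae
  refine ⟨Y, fun p hp => ?_⟩
  have hP : ENNReal.ofReal p ≠ ∞ := ENNReal.ofReal_ne_top
  -- Fatou along the almost surely convergent subsequence turns the Cauchy bound in `L^p` into a
  -- bound for the distance to `Y`.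
  have hclose : ∀ δ : ℝ≥0∞, 0 < δ → ∃ η' : ℝ, 0 < η' ∧ ∀ a : ℝ, 0 < a → a < η' →
      eLpNorm (F a - Y) (ENNReal.ofReal p) μ ≤ δ := by
    intro δ hδ
    obtain ⟨η', hη', hlt⟩ := hcauchy _ hP δ hδ
    refine ⟨η', hη', fun a ha ha' => ?_⟩
    refine (Lp.eLpNorm_lim_le_liminf_eLpNorm (f := fun k => F a - F (e (ns k)))
      (fun k => ((hmem 1 (by simp) a ha).sub (hmem 1 (by simp) _ (hepos (ns k)))).1) _ ?_).trans ?_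
    · filter_upwards [hae] with ω hω
      exact tendsto_const_nhds.sub hω
    · refine liminf_le_of_frequently_le' (Eventually.frequently ?_)
      have h1 : ∀ᶠ k in atTop, e (ns k) < η' :=
        (hetend.comp hns.tendsto_atTop).eventually_lt_const hη'
      filter_upwards [h1] with k hk
      exact (hlt _ _ ha ha' (hepos _) hk).le
  refine ⟨?_, ?_, ?_⟩
  · filter_upwards [self_mem_nhdsWithin] with ε hε
    exact hmem _ hP ε hε
  · obtain ⟨η', hη', hlt⟩ := hclose 1 one_pos
    have h1 : MemLp (F (η' / 2) - Y) (ENNReal.ofReal p) μ :=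
      ⟨(hmem _ hP _ (half_pos hη')).1.sub hYp.1,
        (hlt _ (half_pos hη') (half_lt_self hη')).trans_lt ENNReal.one_lt_top⟩
    have := (hmem _ hP _ (half_pos hη')).sub h1
    rwa [sub_sub_cancel] at this
  · rw [ENNReal.tendsto_nhds_zero]
    intro δ hδ
    obtain ⟨η', hη', hlt⟩ := hclose δ hδ
    filter_upwards [Ioo_mem_nhdsGT hη'] with ε hε
    exact hlt ε hε.1 hε.2

end IsClassG

end LocalTime

/-! ### The limit theorem for the normalized error. -/

section SecondOrder

set_option linter.unusedSectionVars false

variable {Ω : Type*} [MeasurableSpace Ω] {μ : Measure Ω} [IsProbabilityMeasure μ]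
  {d : ℕ} [NeZero d] {H : ℝ} {X : ℝ≥0 → Ω → EuclideanSpace ℝ (Fin d)}

/-- A linear rather than quadratic bound: the smoothing error then grows like `‖u‖`, which `(1 +
‖u‖) ^ β` dominates even for `β = 1`. -/
lemma one_sub_exp_neg_sq_le {y : ℝ} (hy : 0 ≤ y) : 1 - Real.exp (-y ^ 2) ≤ y := by
  rcases le_or_gt 1 y with h | h
  · have := Real.exp_pos (-y ^ 2)
    linarith
  · have := Real.add_one_le_exp (-y ^ 2)
    nlinarith

/-- The coefficient of `∂_J L_t(z)` in the limit of the normalized error. -/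
def momentCoeff {d : ℕ} (f : EuclideanSpace ℝ (Fin d) → ℝ) {β : ℕ} (J : Fin β → Fin d) : ℝ :=
  1 / β.factorial * ∫ x, (∏ j, x (J j)) * f x

/-- The function whose time integral is the normalized error at scale `r`, with the local time and
its derivatives smoothed at scale `ε`. -/
def smoothedError {d : ℕ} (f : EuclideanSpace ℝ (Fin d) → ℝ) (β : ℕ)
    (z : EuclideanSpace ℝ (Fin d)) (r ε : ℝ) (y : EuclideanSpace ℝ (Fin d)) : ℝ :=
  (r ^ β * (r ^ d * f (r • (y - z))) - (r ^ β * ∫ x, f x) * heatKernelDeriv ![] z ε y) -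
    ∑ J : Fin β → Fin d, momentCoeff f J * heatKernelDeriv J z ε y

section Fourier

variable {f : EuclideanSpace ℝ (Fin d) → ℝ} {β : ℕ} (z : EuclideanSpace ℝ (Fin d)) {r ε : ℝ}

lemma integrable_smoothedError (hf : Integrable f) (hr : 0 < r) (hε : 0 < ε) :
    Integrable (smoothedError f β z r ε) :=
  ((((integrable_scaled hf hr z).const_mul _).const_mul _).sub
    ((integrable_heatKernelDeriv hε _ z).const_mul _)).sub
    (integrable_finsetSum _ fun J _ => (integrable_heatKernelDeriv hε J z).const_mul _)

/-- The three terms are the Taylor increment, the cost of smoothing the local time, and the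
candidate limit. The first and the last cancel asymptotically; the middle one vanishes if `r ^ β *
√ε → 0`. -/
lemma realFourier_smoothedError (hf : Integrable f) (hr : 0 < r) (hε : 0 < ε)
    (u : EuclideanSpace ℝ (Fin d)) :
    realFourier (smoothedError f β z r ε) u =
      Complex.exp (↑(-2 * Real.pi * inner ℝ z u) * Complex.I) *
        ((r : ℂ) ^ β * (realFourier f (r⁻¹ • u) - ((∫ x, f x : ℝ) : ℂ)) +
          (r : ℂ) ^ β * ((∫ x, f x : ℝ) : ℂ) *
            (1 - Complex.exp (-(2 * Real.pi ^ 2 * ε * ‖u‖ ^ 2 : ℝ))) -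
          (∑ J : Fin β → Fin d, (momentCoeff f J : ℂ) *
            ∏ j, (-(2 * Real.pi * Complex.I) * (u (J j) : ℂ))) *
            Complex.exp (-(2 * Real.pi ^ 2 * ε * ‖u‖ ^ 2 : ℝ))) := by
  have i1 : Integrable fun y => r ^ β * (r ^ d * f (r • (y - z))) :=
    ((integrable_scaled hf hr z).const_mul _).const_mul _
  have i2 : Integrable fun y => (r ^ β * ∫ x, f x) * heatKernelDeriv (![] : Fin 0 → Fin d) z ε y :=
    (integrable_heatKernelDeriv hε _ z).const_mul _
  have i3 : ∀ J ∈ (Finset.univ : Finset (Fin β → Fin d)), Integrable fun y =>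
      momentCoeff f J * heatKernelDeriv J z ε y :=
    fun J _ => (integrable_heatKernelDeriv hε J z).const_mul _
  unfold smoothedError
  have i12 : Integrable fun y => r ^ β * (r ^ d * f (r • (y - z))) -
      (r ^ β * ∫ x, f x) * heatKernelDeriv (![] : Fin 0 → Fin d) z ε y := i1.sub i2
  rw [realFourier_sub i12 (integrable_finsetSum _ i3), realFourier_sub i1 i2,
    realFourier_sum _ i3, realFourier_const_mul, realFourier_scaled f hr, realFourier_const_mul,
    realFourier_heatKernelDeriv hε]
  simp only [realFourier_const_mul, realFourier_heatKernelDeriv hε]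
  have e : ∀ J : Fin β → Fin d, (momentCoeff f J : ℂ) *
      (Complex.exp (↑(-2 * Real.pi * inner ℝ z u) * Complex.I) *
        ((∏ j, (-(2 * Real.pi * Complex.I) * (u (J j) : ℂ))) *
        Complex.exp (-(2 * Real.pi ^ 2 * ε * ‖u‖ ^ 2 : ℝ)))) =
      (Complex.exp (↑(-2 * Real.pi * inner ℝ z u) * Complex.I) *
        Complex.exp (-(2 * Real.pi ^ 2 * ε * ‖u‖ ^ 2 : ℝ))) * ((momentCoeff f J : ℂ) *
        ∏ j, (-(2 * Real.pi * Complex.I) * (u (J j) : ℂ))) := fun J => by ring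
  rw [Finset.sum_congr rfl fun J _ => e J, ← Finset.mul_sum]
  simp only [Finset.univ_eq_empty, Finset.prod_empty, Complex.ofReal_mul, Complex.ofReal_pow]
  ring

lemma norm_pow_mul_one_sub_cexp_le {δ : ℝ} (hr : 0 < r)
    (hδ : r ^ β * √(2 * Real.pi ^ 2 * ε) ≤ δ) (hε : 0 < ε) (F : ℝ)
    (u : EuclideanSpace ℝ (Fin d)) :
    ‖(r : ℂ) ^ β * (F : ℂ) * (1 - Complex.exp (-(2 * Real.pi ^ 2 * ε * ‖u‖ ^ 2 : ℝ)))‖ ≤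
      |F| * δ * ‖u‖ := by
  have hy : 2 * Real.pi ^ 2 * ε * ‖u‖ ^ 2 = (√(2 * Real.pi ^ 2 * ε) * ‖u‖) ^ 2 := by
    rw [mul_pow, Real.sq_sqrt (by positivity)]
  have h1 := one_sub_exp_neg_sq_le (y := √(2 * Real.pi ^ 2 * ε) * ‖u‖) (by positivity)
  have h2 : Real.exp (-(√(2 * Real.pi ^ 2 * ε) * ‖u‖) ^ 2) ≤ 1 :=
    Real.exp_le_one_iff.2 (by nlinarith [sq_nonneg (√(2 * Real.pi ^ 2 * ε) * ‖u‖)])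
  rw [hy, ← Complex.ofReal_neg, ← Complex.ofReal_exp, ← Complex.ofReal_one, ← Complex.ofReal_sub,
    norm_mul, norm_mul, norm_pow, Complex.norm_real, Complex.norm_real, Complex.norm_real,
    Real.norm_of_nonneg hr.le, Real.norm_eq_abs, Real.norm_of_nonneg (by linarith)]
  calc r ^ β * |F| * (1 - Real.exp (-(√(2 * Real.pi ^ 2 * ε) * ‖u‖) ^ 2))
      ≤ r ^ β * |F| * (√(2 * Real.pi ^ 2 * ε) * ‖u‖) := by gcongr
    _ = |F| * (r ^ β * √(2 * Real.pi ^ 2 * ε)) * ‖u‖ := by ring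
    _ ≤ _ := by gcongr

lemma norm_realFourier_smoothedError_le (hβ : 1 ≤ β) (hf : Integrable f)
    (hmom : Integrable fun x => |f x| * ‖x‖ ^ β) (u : EuclideanSpace ℝ (Fin d))
    (h0 : ∀ m, 1 ≤ m → m < β → ∫ x, inner ℝ x u ^ m * f x = 0) (hr : 0 < r) (hε : 0 < ε)
    (hδ : r ^ β * √(2 * Real.pi ^ 2 * ε) ≤ 1) :
    ‖realFourier (smoothedError f β z r ε) u‖ ≤
      ((β + 2) * (2 * Real.pi) ^ β * (∫ x, |f x| * ‖x‖ ^ β) + |∫ x, f x| +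
        ∑ J : Fin β → Fin d, |momentCoeff f J| * (2 * Real.pi) ^ β) * (1 + ‖u‖) ^ β := by
  rw [realFourier_smoothedError z hf hr hε, norm_mul, Complex.norm_exp_ofReal_mul_I, one_mul]
  have h1 := norm_pow_mul_realFourier_sub_le hβ hf hmom u h0 hr
  have h2 := norm_pow_mul_one_sub_cexp_le hr hδ hε (∫ x, f x) u
  have h3 : ‖(∑ J : Fin β → Fin d, (momentCoeff f J : ℂ) *
      ∏ j, (-(2 * Real.pi * Complex.I) * (u (J j) : ℂ))) *
      Complex.exp (-(2 * Real.pi ^ 2 * ε * ‖u‖ ^ 2 : ℝ))‖ ≤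
      (∑ J : Fin β → Fin d, |momentCoeff f J| * (2 * Real.pi) ^ β) * (1 + ‖u‖) ^ β := by
    rw [norm_mul, Finset.sum_mul]
    refine (mul_le_of_le_one_right (norm_nonneg _)
      (norm_cexp_neg_le_one (by positivity))).trans ((norm_sum_le _ _).trans ?_)
    refine Finset.sum_le_sum fun J _ => ?_
    rw [norm_mul, Complex.norm_real, Real.norm_eq_abs, mul_assoc |momentCoeff f J|]
    exact mul_le_mul_of_nonneg_left (norm_prod_neg_mul_coord_le le_rfl J u) (abs_nonneg _)
  have hu : ‖u‖ ^ β ≤ (1 + ‖u‖) ^ β := by gcongr; simp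
  have hu1 : ‖u‖ ≤ (1 + ‖u‖) ^ β :=
    (by linarith : ‖u‖ ≤ 1 + ‖u‖).trans (le_self_pow₀ (by simp) (by omega))
  have hI : 0 ≤ ∫ x, |f x| * ‖x‖ ^ β := integral_nonneg fun x => by positivity
  refine (norm_sub_le _ _).trans ((add_le_add (norm_add_le _ _) le_rfl).trans ?_)
  rw [add_mul, add_mul]
  refine add_le_add (add_le_add (h1.trans ?_) (h2.trans ?_)) h3
  · have := Real.pi_pos
    gcongr
  · rw [mul_one]
    gcongr

lemma tendsto_realFourier_smoothedError (hβ : 1 ≤ β) (hf : Integrable f)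
    (hmom : Integrable fun x => |f x| * ‖x‖ ^ β) (u : EuclideanSpace ℝ (Fin d))
    (h0 : ∀ m, 1 ≤ m → m < β → ∫ x, inner ℝ x u ^ m * f x = 0)
    {ι : Type*} {l : Filter ι} {r ε δ : ι → ℝ} (hr : Tendsto r l atTop) (hε : ∀ a, 0 < ε a)
    (hε0 : Tendsto ε l (𝓝 0)) (hδ : Tendsto δ l (𝓝 0))
    (hrε : ∀ a, r a ^ β * √(2 * Real.pi ^ 2 * ε a) ≤ δ a) :
    Tendsto (fun a => realFourier (smoothedError f β z (r a) (ε a)) u) l (𝓝 0) := by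
  have h1 := (tendsto_pow_mul_realFourier_sub hβ hf hmom u h0).comp hr
  have h2 : Tendsto (fun a => (r a : ℂ) ^ β * ((∫ x, f x : ℝ) : ℂ) *
      (1 - Complex.exp (-(2 * Real.pi ^ 2 * ε a * ‖u‖ ^ 2 : ℝ)))) l (𝓝 0) := by
    have hl : Tendsto (fun a => |∫ x, f x| * δ a * ‖u‖) l (𝓝 0) := by
      simpa using (hδ.const_mul |∫ x, f x|).mul_const ‖u‖
    refine squeeze_zero_norm' ?_ hl
    filter_upwards [hr.eventually_gt_atTop 0] with a ha
    exact norm_pow_mul_one_sub_cexp_le ha (hrε a) (hε a) _ u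
  have h3 := (tendsto_cexp_neg_heat hε0 u).const_mul (∑ J : Fin β → Fin d,
    (momentCoeff f J : ℂ) * ∏ j, (-(2 * Real.pi * Complex.I) * (u (J j) : ℂ)))
  have h4 := ((h1.add h2).sub h3).const_mul
    (Complex.exp (↑(-2 * Real.pi * inner ℝ z u) * Complex.I))
  simp only [momentCoeff, add_zero, mul_one, sub_self, mul_zero] at h4
  refine h4.congr' ?_
  filter_upwards [hr.eventually_gt_atTop 0] with a ha
  rw [realFourier_smoothedError z hf ha (hε a)]
  rfl

end Fourier

namespace IsClassG

lemma timeIntegral_smoothedError (hX : IsClassG μ H X) (hH : 0 < H) (hHd : H * d < 1)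
    (t : ℝ≥0) (z : EuclideanSpace ℝ (Fin d)) {f : EuclideanSpace ℝ (Fin d) → ℝ}
    (hf : Integrable f) (β : ℕ) {r ε : ℝ} (hr : 0 < r) (hε : 0 < ε) :
    timeIntegral X t (smoothedError f β z r ε) =ᵐ[μ] fun ω =>
      r ^ β * (r ^ d * timeIntegral X t (fun y => f (r • (y - z))) ω) -
        (r ^ β * ∫ x, f x) * smoothedLocalTimeDeriv X t z ![] ε ω -
        ∑ J : Fin β → Fin d, momentCoeff f J * smoothedLocalTimeDeriv X t z J ε ω := by
  have i1 : Integrable fun y => r ^ β * (r ^ d * f (r • (y - z))) :=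
    ((integrable_scaled hf hr z).const_mul _).const_mul _
  have i2 : Integrable fun y => (r ^ β * ∫ x, f x) * heatKernelDeriv (![] : Fin 0 → Fin d) z ε y :=
    (integrable_heatKernelDeriv hε _ z).const_mul _
  have i3 : ∀ J ∈ (Finset.univ : Finset (Fin β → Fin d)), Integrable fun y =>
      momentCoeff f J * heatKernelDeriv J z ε y :=
    fun J _ => (integrable_heatKernelDeriv hε J z).const_mul _
  have ht : (0 : ℝ) ≤ t := t.2
  filter_upwards [hX.timeIntegral_sub hH hHd ht (i1.sub i2) (integrable_finsetSum _ i3),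
    hX.timeIntegral_sub hH hHd ht i1 i2, hX.timeIntegral_sum hH hHd ht _ i3] with ω h1 h2 h3
  have e1 : timeIntegral X t (smoothedError f β z r ε) ω = _ := h1
  rw [e1, Pi.sub_apply, h3]
  have e2 : timeIntegral X t ((fun y => r ^ β * (r ^ d * f (r • (y - z)))) -
    fun y => (r ^ β * ∫ x, f x) * heatKernelDeriv (![] : Fin 0 → Fin d) z ε y) ω = _ := h2
  rw [e2]
  simp only [Pi.sub_apply, timeIntegral_const_mul, smoothedLocalTimeDeriv_eq]

/-- The second order limit theorem, for any integer order `β` of vanishing moments. -/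
theorem tendstoInLp_normalizedError (hX : IsClassG μ H X) (hH : 0 < H) {β : ℕ} (hβ : 1 ≤ β)
    (hHβ : H * (2 * β + d) < 1) {t : ℝ≥0} (ht : 0 < t) (z : EuclideanSpace ℝ (Fin d))
    {f : EuclideanSpace ℝ (Fin d) → ℝ} (hf : Integrable f)
    (hmom : Integrable fun x => |f x| * ‖x‖ ^ β)
    (h0 : ∀ u : EuclideanSpace ℝ (Fin d), ∀ m, 1 ≤ m → m < β → ∫ x, inner ℝ x u ^ m * f x = 0)
    {L : Ω → ℝ} {D : (Fin β → Fin d) → Ω → ℝ} (hL : IsLocalTime μ X t z L)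
    (hD : ∀ J, IsLocalTimeDeriv μ X t z J (D J)) {p : ℝ} (hp : 1 ≤ p) :
    TendstoInLp μ (ENNReal.ofReal p) (normalizedError X H β f t z L) atTop
      (fun ω => ∑ J, momentCoeff f J * D J ω) := by
  have htR : (0 : ℝ) < t := ht
  have hHd := mul_lt_one_of_mul_add_lt_one hH hHβ
  set P := ENNReal.ofReal p with hP
  have hPtop : P ≠ ∞ := ENNReal.ofReal_ne_top
  have hP1 : 1 ≤ P := by rw [hP, ← ENNReal.ofReal_one]; exact ENNReal.ofReal_le_ofReal hp
  set r : ℕ → ℝ := fun n => (n : ℝ) ^ H with hr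
  have hrtop : Tendsto r atTop atTop := (tendsto_rpow_atTop hH).comp tendsto_natCast_atTop_atTop
  have hrpos : ∀ n, 1 ≤ n → 0 < r n := fun n hn =>
    Real.rpow_pos_of_pos (by exact_mod_cast hn) _
  have herr : ∀ n ω, normalizedError X H β f t z L n ω =
      r n ^ β * (r n ^ d * timeIntegral X t (fun y => f (r n • (y - z))) ω) -
        (r n ^ β * ∫ x, f x) * L ω := by
    intro n ω
    have hn : (0 : ℝ) ≤ n := n.cast_nonneg
    simp only [normalizedError, timeIntegral, hr, Real.rpow_mul hn, Real.rpow_natCast]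
    ring
  set δ : ℕ → ℝ := fun n => 1 / ((n : ℝ) + 1) with hδ
  have hδpos : ∀ n, 0 < δ n := fun n => by simp only [hδ]; positivity
  have hδ0 : Tendsto δ atTop (𝓝 0) := tendsto_one_div_add_atTop_nhds_zero_nat
  -- The scale is chosen after `n`, since the error of smoothing `L` is multiplied by the growing
  -- factor `r n ^ β`. No rate of convergence of the smoothed local time is needed.
  have hex : ∀ n, ∃ ε : ℝ, 0 < ε ∧ ε < δ n ∧ r n ^ β * √(2 * Real.pi ^ 2 * ε) < δ n ∧
      ENNReal.ofReal (|r n ^ β * ∫ x, f x|) *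
        eLpNorm (smoothedLocalTimeDeriv X t z ![] ε - L) P μ < ENNReal.ofReal (δ n) := by
    intro n
    have e1 : ∀ᶠ ε : ℝ in 𝓝[>] 0, 0 < ε := self_mem_nhdsWithin
    have e2 : ∀ᶠ ε : ℝ in 𝓝[>] 0, ε < δ n :=
      (tendsto_id.mono_left nhdsWithin_le_nhds).eventually_lt_const (hδpos n)
    have e3 : ∀ᶠ ε : ℝ in 𝓝[>] 0, r n ^ β * √(2 * Real.pi ^ 2 * ε) < δ n := by
      have hc : Continuous fun ε : ℝ => r n ^ β * √(2 * Real.pi ^ 2 * ε) := by fun_prop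
      have := (hc.tendsto 0).mono_left (nhdsWithin_le_nhds (s := Set.Ioi 0))
      simp only [mul_zero, Real.sqrt_zero] at this
      exact this.eventually_lt_const (hδpos n)
    have e4 := ENNReal.Tendsto.const_mul (a := ENNReal.ofReal (|r n ^ β * ∫ x, f x|))
      (hL p hp).2.2 (Or.inr ENNReal.ofReal_ne_top)
    rw [mul_zero] at e4
    obtain ⟨ε, h1, h2, h3, h4⟩ := (e1.and (e2.and (e3.and
      (e4.eventually_lt_const (ENNReal.ofReal_pos.2 (hδpos n)))))).exists
    exact ⟨ε, h1, h2, h3, h4⟩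
  choose ε hεpos hεδ hrε hLε using hex
  have hε0 : Tendsto ε atTop (𝓝 0) := squeeze_zero (fun n => (hεpos n).le)
    (fun n => (hεδ n).le) hδ0
  have hε0' : Tendsto ε atTop (𝓝[>] 0) :=
    tendsto_nhdsWithin_iff.2 ⟨hε0, Eventually.of_forall hεpos⟩
  have hLp : MemLp L P μ := (hL p hp).2.1
  have hDp : ∀ J, MemLp (D J) P μ := fun J => (hD J p hp).2.1
  have hsm : ∀ {k : ℕ} (i : Fin k → Fin d) (n : ℕ),
      MemLp (smoothedLocalTimeDeriv X t z i (ε n)) P μ :=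
    fun i n => hX.memLp_smoothed hH hβ hHβ ht z i hPtop (hεpos n)
  refine ⟨?_, memLp_finsetSum _ fun J _ => (hDp J).const_mul _, ?_⟩
  · filter_upwards [eventually_ge_atTop 1] with n hn
    have h1 := (((hX.memLp_timeIntegral hH hβ hHβ htR hPtop
      (integrable_scaled hf (hrpos n hn) z)).const_mul (r n ^ d)).const_mul (r n ^ β)).sub
      (hLp.const_mul (r n ^ β * ∫ x, f x))
    exact h1.ae_eq (ae_of_all _ fun ω => (herr n ω).symm)
  · have hI : Tendsto (fun n => eLpNorm (timeIntegral X t (smoothedError f β z (r n) (ε n))) P μ)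
        atTop (𝓝 0) := by
      refine hX.tendsto_eLpNorm_timeIntegral hH hβ hHβ htR hPtop
        ((eventually_ge_atTop 1).mono fun n hn =>
          integrable_smoothedError z hf (hrpos n hn) (hεpos n))
        ((eventually_ge_atTop 1).mono fun n hn u =>
          norm_realFourier_smoothedError_le z hβ hf hmom u (h0 u) (hrpos n hn) (hεpos n) ?_)
        (fun u => tendsto_realFourier_smoothedError z hβ hf hmom u (h0 u) hrtop hεpos hε0 hδ0
          fun n => (hrε n).le)
      refine (hrε n).le.trans ?_
      rw [hδ]
      exact div_le_one_of_le₀ (by simp) (by positivity)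
    have hLL : Tendsto (fun n => eLpNorm ((r n ^ β * ∫ x, f x) •
        (smoothedLocalTimeDeriv X t z ![] (ε n) - L)) P μ) atTop (𝓝 0) := by
      refine tendsto_of_tendsto_of_tendsto_of_le_of_le tendsto_const_nhds
        (by simpa using ENNReal.tendsto_ofReal hδ0) (fun _ => zero_le) fun n => ?_
      rw [eLpNorm_const_smul, Real.enorm_eq_ofReal_abs]
      exact (hLε n).le
    have hDD : ∀ J : Fin β → Fin d, Tendsto (fun n => eLpNorm (momentCoeff f J •
        (smoothedLocalTimeDeriv X t z J (ε n) - D J)) P μ) atTop (𝓝 0) := by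
      intro J
      have := ENNReal.Tendsto.const_mul (a := ‖momentCoeff f J‖ₑ)
        ((hD J p hp).2.2.comp hε0') (Or.inr enorm_ne_top)
      rw [mul_zero] at this
      refine this.congr fun n => ?_
      rw [eLpNorm_const_smul]
      rfl
    have hsum := (hI.add hLL).add (tendsto_finsetSum Finset.univ fun J _ => hDD J)
    simp only [add_zero, Finset.sum_const_zero] at hsum
    refine tendsto_of_tendsto_of_tendsto_of_le_of_le' tendsto_const_nhds hsum
      (Eventually.of_forall fun _ => zero_le) ?_
    filter_upwards [eventually_ge_atTop 1] with n hn
    have m1 : AEStronglyMeasurable (timeIntegral X t (smoothedError f β z (r n) (ε n))) μ :=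
      (hX.integrable_timeIntegral hH hHd htR.le
        (integrable_smoothedError z hf (hrpos n hn) (hεpos n))).1
    have m2 : AEStronglyMeasurable ((r n ^ β * ∫ x, f x) •
        (smoothedLocalTimeDeriv X t z ![] (ε n) - L)) μ :=
      (((hsm ![] n).sub hLp).const_smul _).1
    have m3 : ∀ J : Fin β → Fin d, AEStronglyMeasurable (momentCoeff f J •
        (smoothedLocalTimeDeriv X t z J (ε n) - D J)) μ :=
      fun J => (((hsm J n).sub (hDp J)).const_smul _).1
    -- The difference splits into a time integral, covered by the Fourier criterion, and the
    -- smoothing errors of the local time and of its derivatives.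
    have heq : normalizedError X H β f t z L n - (fun ω => ∑ J, momentCoeff f J * D J ω) =ᵐ[μ]
        (timeIntegral X t (smoothedError f β z (r n) (ε n)) + (r n ^ β * ∫ x, f x) •
          (smoothedLocalTimeDeriv X t z ![] (ε n) - L)) +
        ∑ J : Fin β → Fin d, momentCoeff f J •
          (smoothedLocalTimeDeriv X t z J (ε n) - D J) := by
      filter_upwards [hX.timeIntegral_smoothedError hH hHd t z hf β (hrpos n hn) (hεpos n)]
        with ω hω
      simp only [Pi.sub_apply, Pi.add_apply, Finset.sum_apply, Pi.smul_apply, smul_eq_mul, hω,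
        herr, mul_sub, Finset.sum_sub_distrib]
      ring
    rw [eLpNorm_congr_ae heq]
    refine (eLpNorm_add_le (m1.add m2) (Finset.aestronglyMeasurable_sum _ fun J _ => m3 J)
      hP1).trans (add_le_add (eLpNorm_add_le m1 m2 hP1) ?_)
    exact eLpNorm_sum_le (fun J _ => m3 J) hP1

end IsClassG

end SecondOrder

/-! ### The classes `Θ^β` and the explicit form of the limits. -/

section Theta

variable {d : ℕ} {f : EuclideanSpace ℝ (Fin d) → ℝ}

/-- On the unit ball, of finite measure, `L²` gives `L¹`; outside it the weight is at least `1`. -/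
lemma integrable_of_memLp_two_of_integrable_mul_pow {β : ℕ} (hf : MemLp f 2 volume)
    (hmom : Integrable fun x => |f x| * ‖x‖ ^ β) : Integrable f := by
  have hball : IntegrableOn f (Metric.ball 0 1) :=
    have : IsFiniteMeasure (volume.restrict (Metric.ball (0 : EuclideanSpace ℝ (Fin d)) 1)) :=
      ⟨by simpa using measure_ball_lt_top⟩
    (hf.restrict _).integrable one_le_two
  refine ((hball.integrable_indicator measurableSet_ball).abs.add hmom).mono' hf.1
    (ae_of_all _ fun x => ?_)
  rw [Pi.add_apply, Real.norm_eq_abs]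
  by_cases hx : x ∈ Metric.ball (0 : EuclideanSpace ℝ (Fin d)) 1
  · rw [Set.indicator_of_mem hx]
    have : 0 ≤ |f x| * ‖x‖ ^ β := by positivity
    linarith
  · rw [Set.indicator_of_notMem hx, abs_zero, zero_add]
    have : 1 ≤ ‖x‖ := by simpa using hx
    exact le_mul_of_one_le_right (abs_nonneg _) (one_le_pow₀ this)

lemma integral_inner_mul_eq_zero (hf : Integrable f) {β : ℕ} (hβ : 1 ≤ β)
    (hmom : Integrable fun x => |f x| * ‖x‖ ^ β) (h : ∫ x, f x • x = 0)
    (u : EuclideanSpace ℝ (Fin d)) : ∫ x, inner ℝ x u * f x = 0 := by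
  have hint : Integrable fun x => f x • x := by
    refine (integrable_norm_pow_mul hf hmom hβ).mono' (hf.1.smul aestronglyMeasurable_id)
      (ae_of_all _ fun x => ?_)
    rw [norm_smul, pow_one, Real.norm_eq_abs]
  have := integral_inner (𝕜 := ℝ) hint u
  rw [h, inner_zero_right] at this
  rw [← this]
  congr 1; ext x
  rw [inner_smul_right, real_inner_comm, mul_comm]

lemma integral_sum_mul_eq_sum_momentCoeff (hf : Integrable f)
    (hmom : Integrable fun x => |f x| * ‖x‖ ^ 1) (D : Fin d → ℝ) :
    ∫ x, (∑ i, D i * x i) * f x = ∑ J : Fin 1 → Fin d, momentCoeff f J * D (J 0) := by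
  have e : ∀ x : EuclideanSpace ℝ (Fin d), (∑ i, D i * x i) * f x =
      ∑ J : Fin 1 → Fin d, D (J 0) * ((∏ j, x (J j)) * f x) := by
    intro x
    rw [Finset.sum_mul]
    refine (Fintype.sum_equiv (Equiv.funUnique (Fin 1) (Fin d)) _ _ fun J => ?_).symm
    simp [mul_assoc]
  simp_rw [e]
  rw [integral_finsetSum _ fun J _ => (integrable_prod_coord_mul hf hmom J).const_mul _]
  refine Finset.sum_congr rfl fun J _ => ?_
  rw [integral_const_mul, momentCoeff, Nat.factorial_one, Nat.cast_one, div_one, one_mul, mul_comm]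

/-- Maps `Fin 2 → Fin d` are ordered pairs `(i, k)`, so the factor `1 / 2` of the quadratic form is
the `1 / 2!` of `momentCoeff`. -/
lemma integral_sum_sum_mul_eq_sum_momentCoeff (hf : Integrable f)
    (hmom : Integrable fun x => |f x| * ‖x‖ ^ 2) (D : Fin d → Fin d → ℝ) :
    ∫ x : EuclideanSpace ℝ (Fin d), (1 / 2 * ∑ i, ∑ k, x i * D i k * x k) * f x =
      ∑ J : Fin 2 → Fin d, momentCoeff f J * D (J 0) (J 1) := by
  have e : ∀ x : EuclideanSpace ℝ (Fin d), (1 / 2 * ∑ i, ∑ k, x i * D i k * x k) * f x =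
      ∑ J : Fin 2 → Fin d, (1 / 2 * D (J 0) (J 1)) * ((∏ j, x (J j)) * f x) := by
    intro x
    rw [← Fintype.sum_prod_type', Finset.mul_sum, Finset.sum_mul]
    refine (Fintype.sum_equiv (finTwoArrowEquiv (Fin d)) _ _ fun J => ?_).symm
    rw [Fin.prod_univ_two]
    change _ = 1 / 2 * (x (J 0) * D (J 0) (J 1) * x (J 1)) * f x
    ring
  simp_rw [e]
  rw [integral_finsetSum _ fun J _ => (integrable_prod_coord_mul hf hmom J).const_mul _]
  refine Finset.sum_congr rfl fun J _ => ?_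
  rw [integral_const_mul, momentCoeff, Nat.factorial_two, Nat.cast_ofNat]
  ring

lemma mul_add_lt_one_of_lt_div {H b : ℝ} (hb : 0 ≤ b) (hd : d ≠ 0)
    (h : H < 1 / (2 * b + d)) : H * (2 * b + d) < 1 := by
  have : (0 : ℝ) < d := by exact_mod_cast Nat.pos_of_ne_zero hd
  rwa [lt_div_iff₀ (by positivity)] at h

end Theta

end

theorem theorem1p3 {Ω : Type*} [MeasurableSpace Ω] (μ : Measure Ω) [IsProbabilityMeasure μ]
    (d : ℕ) [NeZero d] (H : ℝ) (hH : 0 < H)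
    (X : ℝ≥0 → Ω → EuclideanSpace ℝ (Fin d)) (hX : IsClassG μ H X)
    (t : ℝ≥0) (ht : 0 < t) (z : EuclideanSpace ℝ (Fin d)) :
    -- the case `β = 1`
    (H < 1 / (2 * 1 + d) → ∀ f ∈ Theta d 1,
      (∃ L, IsLocalTime μ X t z L) ∧
      (∀ i : Fin d, ∃ Y, IsLocalTimeDeriv μ X t z ![i] Y) ∧
      (∀ n : ℕ, 1 ≤ n → ∀ᵐ ω ∂μ, IntervalIntegrable
        (fun s => f ((n : ℝ) ^ H • (X s.toNNReal ω - z))) volume 0 t) ∧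
      ∀ (L : Ω → ℝ) (D : Fin d → Ω → ℝ), IsLocalTime μ X t z L →
        (∀ i, IsLocalTimeDeriv μ X t z ![i] (D i)) →
        ∀ p : ℝ, 1 ≤ p → TendstoInLp μ (ENNReal.ofReal p)
          (normalizedError X H 1 f t z L) atTop
          (fun ω => ∫ x : EuclideanSpace ℝ (Fin d), (∑ i, D i ω * x i) * f x)) ∧
    -- the case `β = 2`
    (H < 1 / (2 * 2 + d) → ∀ f ∈ Theta d 2,
      (∃ L, IsLocalTime μ X t z L) ∧
      (∀ i k : Fin d, ∃ Y, IsLocalTimeDeriv μ X t z ![i, k] Y) ∧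
      (∀ n : ℕ, 1 ≤ n → ∀ᵐ ω ∂μ, IntervalIntegrable
        (fun s => f ((n : ℝ) ^ H • (X s.toNNReal ω - z))) volume 0 t) ∧
      ∀ (L : Ω → ℝ) (D : Fin d → Fin d → Ω → ℝ), IsLocalTime μ X t z L →
        (∀ i k, IsLocalTimeDeriv μ X t z ![i, k] (D i k)) →
        ∀ p : ℝ, 1 ≤ p → TendstoInLp μ (ENNReal.ofReal p)
          (normalizedError X H 2 f t z L) atTop
          (fun ω => ∫ x : EuclideanSpace ℝ (Fin d),
            (1 / 2 * ∑ i, ∑ k, x i * D i k ω * x k) * f x)) := by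
  constructor
  · intro hHd f hf
    obtain ⟨hf2, hmom, -⟩ := hf
    have hHβ : H * (2 * (1 : ℕ) + d) < 1 := by
      simpa using mul_add_lt_one_of_lt_div zero_le_one (NeZero.ne d) hHd
    have hmom' : Integrable fun x => |f x| * ‖x‖ ^ 1 := by simpa using hmom
    have hfi := integrable_of_memLp_two_of_integrable_mul_pow hf2 hmom'
    refine ⟨hX.exists_isLocalTimeDeriv hH le_rfl hHβ ht z (Nat.zero_le _) _,
      fun i => hX.exists_isLocalTimeDeriv hH le_rfl hHβ ht z le_rfl _, fun n hn => ?_,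
      fun L D hL hD p hp => ?_⟩
    · exact hX.ae_intervalIntegrable hH (IsClassG.mul_lt_one_of_mul_add_lt_one hH hHβ) t.2
        (integrable_scaled hfi (Real.rpow_pos_of_pos (by exact_mod_cast hn) _) z)
    · have hD' : ∀ J : Fin 1 → Fin d, IsLocalTimeDeriv μ X t z J (D (J 0)) := fun J => by
        have e : ![J 0] = J := by ext j; fin_cases j; rfl
        simpa only [e] using hD (J 0)
      -- For `β = 1` there is no degree strictly between `0` and `β`, so the moment condition is
      -- vacuous.
      have := hX.tendstoInLp_normalizedError hH le_rfl hHβ ht z hfi hmom'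
        (fun u m h1 h2 => by omega) hL hD' hp
      simpa only [integral_sum_mul_eq_sum_momentCoeff hfi hmom', Nat.cast_one] using this
  · intro hHd f hf
    obtain ⟨hf2, hmom, hzero⟩ := hf
    have hHβ : H * (2 * (2 : ℕ) + d) < 1 := by
      simpa using mul_add_lt_one_of_lt_div zero_le_two (NeZero.ne d) hHd
    have hmom' : Integrable fun x => |f x| * ‖x‖ ^ 2 := by
      simpa only [Real.rpow_two] using hmom
    have hfi := integrable_of_memLp_two_of_integrable_mul_pow hf2 hmom'
    refine ⟨hX.exists_isLocalTimeDeriv hH one_le_two hHβ ht z (Nat.zero_le _) _,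
      fun i k => hX.exists_isLocalTimeDeriv hH one_le_two hHβ ht z le_rfl _, fun n hn => ?_,
      fun L D hL hD p hp => ?_⟩
    · exact hX.ae_intervalIntegrable hH (IsClassG.mul_lt_one_of_mul_add_lt_one hH hHβ) t.2
        (integrable_scaled hfi (Real.rpow_pos_of_pos (by exact_mod_cast hn) _) z)
    · have hD' : ∀ J : Fin 2 → Fin d, IsLocalTimeDeriv μ X t z J (D (J 0) (J 1)) := fun J => by
        have e : ![J 0, J 1] = J := by ext j; fin_cases j <;> rfl
        simpa only [e] using hD (J 0) (J 1)
      have hvan : ∀ u : EuclideanSpace ℝ (Fin d), ∀ m, 1 ≤ m → m < 2 →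
          ∫ x, inner ℝ x u ^ m * f x = 0 := by
        intro u m h1 h2
        obtain rfl : m = 1 := by omega
        simpa only [pow_one] using
          integral_inner_mul_eq_zero hfi one_le_two hmom' (hzero one_lt_two) u
      have := hX.tendstoInLp_normalizedError hH one_le_two hHβ ht z hfi hmom' hvan hL hD' hp
      simpa only [integral_sum_sum_mul_eq_sum_momentCoeff hfi hmom', Nat.cast_ofNat] using this
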